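/- Let $A=\{0,1,2\}$, $\alpha=\{0,1\}$, $\beta=\{0,2\}$. Let $\rho'(x,y,z)$ hold on $A$ iff $x,y,z$ all lie in $\alpha$ or all lie in $\beta$, and for $k\in\mathbb N$ let $\tau_k$ be the $3k$-ary relation $$\tau_k(x_1,y_1,z_1,\ldots,x_k,y_k,z_k):=\rho'(x_1,y_1,z_1)\vee\cdots\vee\rho'(x_k,y_k,z_k).$$ Let $\mathcal B=(A;\{\tau_k:k\in\mathbb N\},0,1,2)$, that is, the infinite constraint language of all the $\tau_k$, expanded with constants naming all elements of $A$. An instance of $\mathrm{QCSP}(\mathcal B)$ is a sentence $Q_1x_1\cdots Q_nx_n\,\psi$ with $Q_i\in\{\forall,\exists\}$ and $\psi$ a conjunction of equalities and of atoms $\tau_k(\ldots)$, whose arguments are variables or constants; the question is whether the sentence is true in $\mathcal B$. In the tuple-listing encoding, each relation occurring in an instance is given by the list of all its tuples. Then: 1. $\mathrm{QCSP}(\mathcal B)$ is in P under the tuple-listing encoding. 2. The algebra $\mathrm{Pol}(\mathcal B)$ of all operations on $A$ that preserve every $\tau_k$ and the constants $0,1,2$ has the exponentially generated powers property (EGP):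 if $f(m)$ denotes the least size of a generating set of the power $\mathrm{Pol}(\mathcal B)^m$, then there is a constant $b>1$ with $f(m)=\Omega(b^m)$. In particular it does not have the polynomially generated powers property (PGP): there is no polynomial $p$ with $f=O(p)$. Thus, under the tuple-listing encoding, Chen's Conjecture (for a language $\mathcal B$ with all constants, $\mathrm{QCSP}(\mathcal B)$ is in NP if $\mathrm{Pol}(\mathcal B)$ has PGP and is PSPACE-complete otherwise) fails for infinite languages on a finite domain, in the sense that $\mathrm{Pol}(\mathcal B)$ has EGP and not PGP, yet $\mathrm{QCSP}(\mathcal B)$ is in P. -/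

import Mathlib

namespace QCSP

/-! ### Constraint languages and the relations `τ_k` -/

/-- A constraint language on the domain `D`: a (possibly infinite) set of relations on `D`, each
with its arity. All constants naming the elements of `D` are understood to be present as well:
they are terms of the sentences below and have to be preserved by polymorphisms. -/
abbrev ConstraintLanguage (D : Type) := Set (Σ r : ℕ, Set (Fin r → D))

/-- `ρ'(x,y,z)`: all of `x, y, z` lie in `α`, or all of them lie in `β`. -/
def rho' {D : Type} (α β : Set D) (x y z : D) : Prop :=
  (x ∈ α ∧ y ∈ α ∧ z ∈ α) ∨ (x ∈ β ∧ y ∈ β ∧ z ∈ β)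

/-- `τ_k(x₁,y₁,z₁,…,x_k,y_k,z_k) = ρ'(x₁,y₁,z₁) ∨ … ∨ ρ'(x_k,y_k,z_k)`, a relation of arity `3k`. -/
def tau {D : Type} (α β : Set D) (k : ℕ) : Set (Fin (3 * k) → D) :=
  {v | ∃ i : Fin k,
    rho' α β (v ⟨3 * i, by omega⟩) (v ⟨3 * i + 1, by omega⟩) (v ⟨3 * i + 2, by omega⟩)}

/-- The infinite language `{τ_k : k ∈ ℕ}` (with all constants). -/
def tauLanguage {D : Type} (α β : Set D) : ConstraintLanguage D :=
  Set.range fun k : ℕ => ⟨3 * k, tau α β k⟩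

/-! ### Polymorphisms, generating sets of powers, PGP and EGP -/

/-- An algebra on `D`, given by its set of basic operations, each with its arity. -/
abbrev Algebra (D : Type) := Set (Σ k : ℕ, ((Fin k → D) → D))

/-- `Pol` of a constraint language expanded with all constants: the operations that preserve every
relation of the language and every constant. -/
def Pol {D : Type} (B : ConstraintLanguage D) : Algebra D :=
  {f | (∀ R ∈ B, ∀ M : Fin f.1 → (Fin R.1 → D), (∀ j, M j ∈ R.2) →
          (fun i => f.2 fun j => M j i) ∈ R.2) ∧
       ∀ a : D, f.2 (fun _ => a) = a}

/-- The term operations of an algebra. -/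
inductive IsTermOp {D : Type} (A : Algebra D) : {k : ℕ} → ((Fin k → D) → D) → Prop
  | proj {k : ℕ} (j : Fin k) : IsTermOp A (fun x : Fin k → D => x j)
  | comp {k : ℕ} (f : Σ l : ℕ, ((Fin l → D) → D)) (hf : f ∈ A)
      (g : Fin f.1 → ((Fin k → D) → D)) (hg : ∀ j, IsTermOp A (g j)) :
      IsTermOp A (fun x : Fin k → D => f.2 fun j => g j x)

/-- `Λ ⊆ D^m` is a generating set for the power `A^m`. -/
def Generates {D : Type} (A : Algebra D) {m : ℕ} (Λ : Finset (Fin m → D)) : Prop :=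
  ∀ a : Fin m → D, ∃ (k : ℕ) (f : (Fin k → D) → D) (b : Fin k → (Fin m → D)),
    IsTermOp A f ∧ (∀ j, b j ∈ Λ) ∧ ∀ i, f (fun j => b j i) = a i

/-- `f_A(m)`: the least size of a generating set for `A^m` (used for finite `D`, where all of `D^m`
is a generating set). -/
noncomputable def genSize {D : Type} (A : Algebra D) (m : ℕ) : ℕ :=
  sInf {c | ∃ Λ : Finset (Fin m → D), Generates A Λ ∧ Λ.card = c}

/-- Polynomially generated powers: `f_A = O(p)` for some polynomial `p`. -/
def HasPGP {D : Type} (A : Algebra D) : Prop :=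
  ∃ p : Polynomial ℝ,
    (fun m : ℕ => (genSize A m : ℝ)) =O[Filter.atTop] fun m : ℕ => p.eval (m : ℝ)

/-- Exponentially generated powers: `f_A = Ω(b^m)` for some constant `b > 1`. -/
def HasEGP {D : Type} (A : Algebra D) : Prop :=
  ∃ b : ℝ, 1 < b ∧
    (fun m : ℕ => b ^ m) =O[Filter.atTop] fun m : ℕ => (genSize A m : ℝ)

/-! ### Quantified conjunctive sentences, with relations given by lists of tuples -/

inductive Quantifier
  | all
  | ex

/-- A term over `n` variables: a variable or a constant naming an element of `D`. -/
inductive Term (D : Type) (n : ℕ)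
  | var (i : Fin n)
  | const (a : D)

/-- An atom: an equality of terms, or a relation applied to terms, where the relation is given by a
list of its tuples (in any order, repetitions permitted). -/
inductive Atom (D : Type) (n : ℕ)
  | eq (s t : Term D n)
  | rel {r : ℕ} (scope : Fin r → Term D n) (tuples : List (Fin r → D))

/-- A prenex positive Horn sentence `Q₀x₀ Q₁x₁ … Qₙ₋₁xₙ₋₁ (conjunction of atoms)`. -/
structure Sentence (D : Type) where
  numVars : ℕ
  quant : Fin numVars → Quantifier
  atoms : List (Atom D numVars)

def Term.eval {D : Type} {n : ℕ} (v : Fin n → D) : Term D n → D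
  | .var i => v i
  | .const a => a

def Atom.Holds {D : Type} {n : ℕ} (v : Fin n → D) : Atom D n → Prop
  | .eq s t => s.eval v = t.eval v
  | .rel scope tuples => (fun i => (scope i).eval v) ∈ tuples

/-- Truth of `Q₀x₀ … Qₙ₋₁xₙ₋₁ ψ(x₀,…,xₙ₋₁)` over the domain `D`, outermost quantifier first. -/
def QuantHolds {D : Type} :
    (n : ℕ) → (Fin n → Quantifier) → ((Fin n → D) → Prop) → Prop
  | 0, _, ψ => ψ Fin.elim0
  | n + 1, q, ψ =>
    match q 0 with
    | .all => ∀ a : D, QuantHolds n (Fin.tail q) fun v => ψ (Fin.cons a v)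
    | .ex => ∃ a : D, QuantHolds n (Fin.tail q) fun v => ψ (Fin.cons a v)

def Sentence.IsTrue {D : Type} (φ : Sentence D) : Prop :=
  QuantHolds φ.numVars φ.quant fun v => ∀ A ∈ φ.atoms, A.Holds v

/-- The relation listed in the atom, if there is one, is a relation of the language `B`. -/
def Atom.IsOver {D : Type} {n : ℕ} (B : ConstraintLanguage D) : Atom D n → Prop
  | .eq _ _ => True
  | .rel (r := r) _ tuples => (⟨r, {t | t ∈ tuples}⟩ : Σ r : ℕ, Set (Fin r → D)) ∈ B

/-- The sentence is an instance of `QCSP(B)`. -/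
def Sentence.IsOver {D : Type} (B : ConstraintLanguage D) (φ : Sentence D) : Prop :=
  ∀ A ∈ φ.atoms, A.IsOver B

/-! ### The tuple-listing encoding -/

/-- The input alphabet (finite for finite `D`). -/
inductive Sym (D : Type)
  | all
  | ex
  | var
  | tick
  | elem (a : D)
  | eq
  | rel
  | tup

def Quantifier.encode {D : Type} : Quantifier → Sym D
  | .all => .all
  | .ex => .ex

/-- The variable `xᵢ` is written `var` followed by `i` ticks. As every variable of the sentence has
its own symbol among the quantifiers, indices are smaller than the length of the input, so that this
is polynomially equivalent to writing them in binary. -/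
def Term.encode {D : Type} {n : ℕ} : Term D n → List (Sym D)
  | .var i => .var :: List.replicate i .tick
  | .const a => [.elem a]

/-- A relational atom is written as its scope followed by all the listed tuples. -/
def Atom.encode {D : Type} {n : ℕ} : Atom D n → List (Sym D)
  | .eq s t => .eq :: (s.encode ++ t.encode)
  | .rel scope tuples =>
    .rel :: ((List.ofFn scope).flatMap Term.encode ++
      tuples.flatMap fun t => .tup :: (List.ofFn t).map .elem)

def Sentence.encode {D : Type} (φ : Sentence D) : List (Sym D) :=
  (List.ofFn φ.quant).map Quantifier.encode ++ φ.atoms.flatMap Atom.encode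

/-- `QCSP(B)` (`B` with all constants) under the tuple-listing encoding, as a set of strings. -/
def qcspTupleListing {D : Type} (B : ConstraintLanguage D) : Set (List (Sym D)) :=
  {w | ∃ φ : Sentence D, φ.IsOver B ∧ φ.IsTrue ∧ φ.encode = w}

/-! ### The complexity class P -/

open Classical in
/-- A set `L` of strings is in P: its characteristic function on all strings is computed by a
Turing machine in time polynomial in the length of the string. -/
def InP {S : Type} (L : Set (List S)) : Prop :=
  Nonempty (Turing.TM2ComputableInPolyTime (id : List S → List S) Computability.encodeBool
    fun w : List S => decide (w ∈ L))

end QCSP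

/-! Exponential generation. A polymorphism `f` of all `τ_k` must have an argument `j` that controls
membership of the value in `α` and in `β`: if every argument failed this on some tuple `x j`, these
failures could be placed in the different triples of `τ_k`, with `k` the arity of `f`, so that every
column satisfies one disjunct and the image satisfies none. Control by one argument survives
composition. A tuple over `{1, 2}` records at each coordinate exactly one of `α`, `β`, so a term
operation producing it must already have it as its controlling argument. All `2 ^ m` such tuples
therefore lie in every generating set of the `m`-th power.

Tractability. Since `0 ∈ α ∩ β`, every `τ_k` stays satisfied when entries are replaced by `0`. An
existential variable that the equalities do not tie to a constant or to a universal variable may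
thus be played as `0`. This canonical strategy is the same for all atoms, so the atoms decouple: the
sentence is true iff the equalities are coherent and, for each atom, every tuple obtained from
values of the universal variables is listed (`Sentence.IsTrue.val_mem`, `Sentence.Coherent.isTrue`).
There may be exponentially many such tuples, but the list is part of the input. It contains all of
them iff it contains one and is closed under changing one universal variable
(`Sentence.Coherent.forall_val_mem_iff`). That the list really is some `τ_k` is also a closure
condition: the good tuples are connected by changes of one triple at a time that keep some triple
good (`TripleClosed.mem_of_inTau`). Together these give `Sentence.isOver_and_isTrue_iff`.

Machines. The criterion uses only quantification over positions and factors of the input, counting,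
comparison, and reachability along the equalities. Structured stack programs are compiled to Turing
machines with exact step counts (`Cmd.Exec.reaches`). Programs with a fixed number of pointers into
the input decide a class of predicates (`PolyDec`) closed under Boolean operations, bounded
quantification, counting and reachability. The class is lifted from positions to factors (`Dec`),
where the encoded criterion `Accepts` can be written down almost verbatim. Unique parsing of strings
into marked blocks relates `Accepts` to sentences. -/

namespace QCSP

/-! ### Exponentially generated powers -/

section EGP

/-- Some argument of `f` controls membership of the value in `α` and in `β`. -/
def IsProjectiveFor {D : Type} (α β : Set D) {k : ℕ} (f : (Fin k → D) → D) : Prop :=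
  ∃ j, ∀ x, (x j ∈ α → f x ∈ α) ∧ (x j ∈ β → f x ∈ β)

/-- One counterexample `x j` per argument suffices to break preservation of `τ_k` for `k` the arity
of `f`. The elements `a` and `b` separate `α` from `β`, and idempotence lets them be used as fixed
entries of the matrix. -/
theorem isProjectiveFor_of_mem_pol {D : Type} {α β : Set D} {a b : D}
    (ha : a ∈ α) (ha' : a ∉ β) (hb : b ∈ β) (hb' : b ∉ α)
    {f : Σ k : ℕ, ((Fin k → D) → D)} (hf : f ∈ Pol (tauLanguage α β)) :
    IsProjectiveFor α β f.2 := by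
  by_contra hcon
  simp only [IsProjectiveFor, not_exists, not_forall] at hcon
  choose x hx using hcon
  obtain ⟨hpres, hconst⟩ := hf
  -- The witness `c` lies only in the set that `f (x j)` misses although `x j j` belongs to it: `a`
  -- if that set is `α`, and `b` if it is `β`.
  have key : ∀ j, ∃ c, ((x j j ∈ α ∧ c ∈ α) ∨ (x j j ∈ β ∧ c ∈ β)) ∧
      ¬ rho' α β (f.2 (x j)) c c := by
    intro j
    by_cases h : x j j ∈ α → f.2 (x j) ∈ α
    · have h2 : ¬ (x j j ∈ β → f.2 (x j) ∈ β) := fun h2 => hx j ⟨h, h2⟩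
      push Not at h2
      exact ⟨b, Or.inr ⟨h2.1, hb⟩, by rintro (h | h) <;> tauto⟩
    · push Not at h
      exact ⟨a, Or.inl ⟨h.1, ha⟩, by rintro (h | h) <;> tauto⟩
  choose c hc hr using key
  -- The `j`-th triple of rows is `(x j, c j, c j)` with constant last two rows. Column `j`
  -- satisfies the `j`-th disjunct, while the image of the `j`-th triple is `(f (x j), c j, c j)`,
  -- which violates it.
  let M : Fin f.1 → Fin (3 * f.1) → D := fun j i =>
    if i.1 % 3 = 0 then x ⟨i.1 / 3, by omega⟩ j else c ⟨i.1 / 3, by omega⟩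
  have hM := hpres ⟨3 * f.1, tau α β f.1⟩ ⟨f.1, rfl⟩ M (fun j => by
    refine ⟨j, ?_⟩
    have e1 : (3 * j.1 + 1) / 3 = j.1 := by omega
    have e2 : (3 * j.1 + 2) / 3 = j.1 := by omega
    have e3 : (3 * j.1 + 1) % 3 = 1 := by omega
    have e4 : (3 * j.1 + 2) % 3 = 2 := by omega
    simp only [M, Nat.mul_mod_right, e3, e4, e1, e2, if_true]
    have := hc j
    simp only [rho']
    simp
    tauto)
  obtain ⟨j, hj⟩ := hM
  have e1 : (3 * j.1 + 1) / 3 = j.1 := by omega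
  have e2 : (3 * j.1 + 2) / 3 = j.1 := by omega
  have e3 : (3 * j.1 + 1) % 3 = 1 := by omega
  have e4 : (3 * j.1 + 2) % 3 = 2 := by omega
  simp only [M, e3, e4, e1, e2, Nat.mul_mod_right, if_true, OfNat.ofNat_ne_zero, one_ne_zero,
    if_false, hconst] at hj
  refine hr j ?_
  simpa using hj

/-- The controlling argument of a composition is the controlling argument of the inner operation
standing at the controlling argument of the outer one. -/
theorem IsTermOp.isProjectiveFor {D : Type} {α β : Set D} {A : Algebra D}
    (hA : ∀ f ∈ A, IsProjectiveFor α β f.2) {k : ℕ} {f : (Fin k → D) → D} (hf : IsTermOp A f) :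
    IsProjectiveFor α β f := by
  induction hf with
  | proj j => exact ⟨j, fun x => ⟨id, id⟩⟩
  | comp f hf g _ ih =>
    obtain ⟨j, hj⟩ := hA f hf
    obtain ⟨i, hi⟩ := ih j
    exact ⟨i, fun x => ⟨fun h => (hj _).1 ((hi x).1 h), fun h => (hj _).2 ((hi x).2 h)⟩⟩

/-- Every tuple over `{1, 2}` belongs to every generating set, because it can only be produced by a
term operation one of whose arguments is that very tuple. -/
theorem two_pow_le_genSize (m : ℕ) :
    2 ^ m ≤ genSize (Pol (tauLanguage ({0, 1} : Set (Fin 3)) {0, 2})) m := by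
  -- The infimum is attained only if some generating set exists; the full power is one, through
  -- projections.
  have hne : {c | ∃ Λ : Finset (Fin m → Fin 3),
      Generates (Pol (tauLanguage ({0, 1} : Set (Fin 3)) {0, 2})) Λ ∧ Λ.card = c}.Nonempty :=
    ⟨_, Finset.univ, fun a => ⟨1, fun x => x 0, fun _ => a, .proj 0, fun _ => Finset.mem_univ _,
      fun _ => rfl⟩, rfl⟩
  obtain ⟨Λ, hΛ, hc⟩ := Nat.sInf_mem hne
  rw [genSize, ← hc]
  let e : (Fin m → Bool) → Fin m → Fin 3 := fun s i => if s i then 1 else 2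
  have he : Function.Injective e := by
    intro s s' h
    funext i
    have := congrFun h i
    simp only [e] at this
    cases hs : s i <;> cases hs' : s' i <;> simp_all
  have hsub : Finset.univ.image e ⊆ Λ := by
    intro a ha
    obtain ⟨s, -, rfl⟩ := Finset.mem_image.1 ha
    obtain ⟨k, f, b, hf, hb, hfb⟩ := hΛ (e s)
    obtain ⟨j, hj⟩ := hf.isProjectiveFor (α := {0, 1}) (β := {0, 2}) fun f hf =>
      isProjectiveFor_of_mem_pol (a := 1) (b := 2) (by simp) (by simp) (by simp) (by simp) hf
    -- At each coordinate the value lies in only one of `α` and `β`. A controlling entry `0` would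
    -- put it in both, and the other nonzero entry would put it in the wrong one.
    have : b j = e s := by
      funext i
      have := hj fun j => b j i
      rw [hfb] at this
      simp only [e] at this ⊢
      generalize b j i = y at this ⊢
      revert this y
      cases s i <;> simp <;> decide
    exact this ▸ hb j
  calc 2 ^ m = (Finset.univ.image e).card := by
        rw [Finset.card_image_of_injective _ he]; simp
    _ ≤ _ := Finset.card_le_card hsub

theorem hasEGP_pol_tauLanguage :
    HasEGP (Pol (tauLanguage ({0, 1} : Set (Fin 3)) {0, 2})) := by
  refine ⟨2, one_lt_two, Asymptotics.IsBigO.of_bound 1 (Filter.Eventually.of_forall fun m => ?_)⟩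
  rw [one_mul, Real.norm_of_nonneg (by positivity), Real.norm_of_nonneg (by positivity)]
  exact_mod_cast two_pow_le_genSize m

/-- Otherwise `b ^ m` would be bounded by a power of `m`, hence be little-o of itself. -/
theorem HasEGP.not_hasPGP {D : Type} {A : Algebra D} (h : HasEGP A) : ¬ HasPGP A := by
  rintro ⟨p, hp⟩
  obtain ⟨b, hb, hO⟩ := h
  have h1 : (fun m : ℕ => p.eval (m : ℝ)) =O[Filter.atTop]
      fun m : ℕ => (m : ℝ) ^ p.natDegree := by
    have := (Polynomial.isBigO_atTop_of_degree_le p (Polynomial.X ^ p.natDegree) (by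
      rw [Polynomial.degree_X_pow]; exact Polynomial.degree_le_natDegree)).comp_tendsto
        tendsto_natCast_atTop_atTop
    simpa [Function.comp_def] using this
  have h2 := (hO.trans (hp.trans h1)).trans_isLittleO
    (isLittleO_pow_const_const_pow_of_one_lt (R := ℝ) p.natDegree hb)
  exact Asymptotics.isLittleO_irrefl
    (Filter.Frequently.of_forall fun m => (pow_pos (one_pos.trans hb) m).ne') h2

end EGP

/-! ### Structured programs over stacks -/

/-- Structured programs working on stacks indexed by `K` with symbols from `Γ`. -/
inductive Cmd (K Γ : Type)
  | skip
  | push (r : K) (a : Γ)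
  | pop (r : K)
  | seq (c d : Cmd K Γ)
  | cases (r : K) (f : Option Γ → Cmd K Γ)
  | loop (r : K) (c : Cmd K Γ)

namespace Cmd

variable {K Γ : Type} [DecidableEq K]

/-- `Exec c s t s'`: started on the stacks `s`, the program `c` takes `t` steps and leaves the
stacks `s'`. `cases r f` branches on the top symbol of `r`, and `loop r c` repeats `c` as long as
the stack `r` is not empty. -/
inductive Exec : Cmd K Γ → (K → List Γ) → ℕ → (K → List Γ) → Prop
  | skip (s) : Exec skip s 1 s
  | push (r a s) : Exec (push r a) s 1 (Function.update s r (a :: s r))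
  | pop (r s) : Exec (pop r) s 1 (Function.update s r (s r).tail)
  | seq {c d s t s' t' s''} : Exec c s t s' → Exec d s' t' s'' → Exec (seq c d) s (t + t') s''
  | cases {r f s t s'} : Exec (f (s r).head?) s t s' → Exec (cases r f) s (1 + t) s'
  | loop_nil {r c s} : s r = [] → Exec (loop r c) s 1 s
  | loop_cons {r c s t s' t' s''} : s r ≠ [] → Exec c s t s' → Exec (loop r c) s' t' s'' →
      Exec (loop r c) s (1 + t + t') s''

/-! ### Translation to Turing machines -/

/-- The labels of the machine for a program. -/
def Lab : Cmd K Γ → Type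
  | skip => Unit
  | push _ _ => Unit
  | pop _ => Unit
  | seq c d => Lab c ⊕ Lab d
  | cases _ f => Option (Σ o, Lab (f o))
  | loop _ c => Option (Lab c)

noncomputable instance Lab.fintype [Fintype Γ] : (c : Cmd K Γ) → Fintype (Lab c)
  | skip => inferInstanceAs (Fintype Unit)
  | push _ _ => inferInstanceAs (Fintype Unit)
  | pop _ => inferInstanceAs (Fintype Unit)
  | seq c d =>
    letI := Lab.fintype c
    letI := Lab.fintype d
    inferInstanceAs (Fintype (Lab c ⊕ Lab d))
  | cases _ f =>
    letI := fun o => Lab.fintype (f o)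
    inferInstanceAs (Fintype (Option (Σ o, Lab (f o))))
  | loop _ c =>
    letI := Lab.fintype c
    inferInstanceAs (Fintype (Option (Lab c)))

def entry : (c : Cmd K Γ) → Lab c
  | skip => ()
  | push _ _ => ()
  | pop _ => ()
  | seq c _ => .inl (entry c)
  | cases _ _ => none
  | loop _ _ => none

/-- The stack alphabets of the machine: a Boolean output stack besides the stacks of the program. -/
abbrev Alph (K Γ : Type) : Option K → Type
  | none => Bool
  | some _ => Γ

open Turing.TM2.Stmt in
/-- The code of a program whose labels are embedded by `e`, and which is left for the label `x`. -/
def code {Λ : Type} : (c : Cmd K Γ) → (Lab c → Λ) → Λ → Lab c →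
    Turing.TM2.Stmt (Alph K Γ) Λ (Option Γ)
  | skip, _, x, _ => goto fun _ => x
  | push r a, _, x, _ => .push (some r) (fun _ => a) (goto fun _ => x)
  | pop r, _, x, _ => .pop (some r) (fun v _ => v) (goto fun _ => x)
  | seq c d, e, _, .inl l => code c (fun l => e (.inl l)) (e (.inr (entry d))) l
  | seq _ d, e, x, .inr l => code d (fun l => e (.inr l)) x l
  | cases r f, e, _, none => peek (some r) (fun _ o => o) (goto fun o => e (some ⟨o, entry (f o)⟩))
  | cases _ f, e, x, some l => code (f l.1) (fun l' => e (some ⟨l.1, l'⟩)) x l.2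
  | loop r c, e, x, none =>
    peek (some r) (fun _ o => o) (goto fun o => bif o.isSome then e (some (entry c)) else x)
  | loop _ c, e, _, some l => code c (fun l => e (some l)) (e none) l

/-- The stacks of the machine. -/
def stk (out : List Bool) (s : K → List Γ) : (o : Option K) → List (Alph K Γ o)
  | none => out
  | some r => s r

theorem update_stk (out : List Bool) (s : K → List Γ) (r : K) (l : List Γ) :
    Function.update (stk out s) (some r) l = stk out (Function.update s r l) := by
  funext o
  rcases o with _ | r'
  · exact Function.update_of_ne (by simp) _ _
  · by_cases h : r' = r
    · subst h
      exact (Function.update_self _ _ _).trans (Function.update_self (f := s) _ _).symm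
    · exact (Function.update_of_ne (by simpa using h) _ _).trans
        (Function.update_of_ne (f := s) h _).symm

theorem bind_step {Λ : Type} {M : Λ → Turing.TM2.Stmt (Alph K Γ) Λ (Option Γ)} {l : Λ}
    {q : Turing.TM2.Stmt (Alph K Γ) Λ (Option Γ)} (h : M l = q) (v : Option Γ)
    (S : (o : Option K) → List (Alph K Γ o)) :
    flip bind (Turing.TM2.step M) (some ⟨some l, v, S⟩) = some (Turing.TM2.stepAux q v S) := by
  subst h; rfl

/-- The costs in `Exec` count machine steps exactly, as each label executes one statement. The
embedding `e` and the exit label `x` are arbitrary so that the induction applies to subprograms. The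
internal state `v` is arbitrary because every branching statement first overwrites it by peeking. -/
theorem Exec.reaches {Λ : Type} {M : Λ → Turing.TM2.Stmt (Alph K Γ) Λ (Option Γ)}
    {c : Cmd K Γ} {s s' : K → List Γ} {t : ℕ} (h : Exec c s t s') :
    ∀ (e : Lab c → Λ) (x : Λ), (∀ l, M (e l) = code c e x l) → ∀ (out : List Bool) (v : Option Γ),
      ∃ v', (flip bind (Turing.TM2.step M))^[t] (some ⟨some (e (entry c)), v, stk out s⟩) =
        some ⟨some x, v', stk out s'⟩ := by
  induction h with
  | skip s =>
    intro e x hM out v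
    exact ⟨v, bind_step (hM _) _ _⟩
  | push r a s =>
    intro e x hM out v
    refine ⟨v, (bind_step (hM _) _ _).trans ?_⟩
    rw [← update_stk]
    rfl
  | pop r s =>
    intro e x hM out v
    refine ⟨v, (bind_step (hM _) _ _).trans ?_⟩
    rw [← update_stk]
    rfl
  | seq _ _ ih1 ih2 =>
    intro e x hM out v
    obtain ⟨v1, h1⟩ := ih1 (fun l => e (.inl l)) _ (fun l => hM (.inl l)) out v
    obtain ⟨v2, h2⟩ := ih2 (fun l => e (.inr l)) _ (fun l => hM (.inr l)) out v1
    exact ⟨v2, by rw [add_comm, Function.iterate_add_apply]; exact (congrArg _ h1).trans h2⟩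
  | @cases r f s t s' _ ih =>
    intro e x hM out v
    obtain ⟨v1, h1⟩ := ih (fun l => e (some ⟨_, l⟩)) _ (fun l => hM (some ⟨_, l⟩)) out (s r).head?
    refine ⟨v1, ?_⟩
    rw [add_comm, Function.iterate_add_apply]
    exact (congrArg _ (bind_step (hM _) _ _)).trans h1
  | @loop_nil r c s hs =>
    intro e x hM out v
    refine ⟨none, (bind_step (hM _) _ _).trans ?_⟩
    change some (Turing.TM2.Cfg.mk (some (bif (s r).head?.isSome then _ else x)) (s r).head? _) = _
    rw [hs]
    rfl
  | @loop_cons r c s t s' t' s'' hs _ _ ih1 ih2 =>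
    intro e x hM out v
    obtain ⟨v1, h1⟩ := ih1 (fun l => e (some l)) _ (fun l => hM (some l)) out (s r).head?
    obtain ⟨v2, h2⟩ := ih2 e x hM out v1
    refine ⟨v2, ?_⟩
    rw [add_comm (1 + t), Function.iterate_add_apply, add_comm 1, Function.iterate_add_apply, ← h2]
    refine congrArg _ (Eq.trans (congrArg _ ((bind_step (hM _) _ _).trans ?_)) h1)
    change some (Turing.TM2.Cfg.mk
      (some (bif (s r).head?.isSome then e (some (entry c)) else x)) (s r).head? _) = _
    obtain ⟨a, l, hl⟩ := List.exists_cons_of_ne_nil hs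
    rw [hl]
    rfl

/-- The label at which the machine for `c` stands when `c` is finished is `none`. -/
def machine (c : Cmd K Γ) (res : K) (yes : Γ → Bool) :
    Option (Lab c) → Turing.TM2.Stmt (Alph K Γ) (Option (Lab c)) (Option Γ)
  | some l => code c some none l
  | none => .pop (some res) (fun _ o => o) <| .push none (fun o => o.any yes) <|
      .load (fun _ => none) .halt

theorem stk_output (res : K) (a : Γ) (b : Bool) : stk [b] (fun _ : K => ([] : List Γ)) =
    Function.update (Function.update (stk [] (Function.update (fun _ => []) res [a])) (some res) [])
      none [b] := by
  rw [update_stk, Function.update_idem, Function.update_eq_self_iff.2 rfl]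
  funext o
  rcases o with _ | r <;> rfl

/-- A program that decides a language on every input within polynomially many steps, and clears all
stacks besides the one holding the answer, shows that the language is in P. -/
theorem inP_of_exec [Fintype K] [Fintype Γ] {L : Set (List Γ)} (c : Cmd K Γ) (inp res : K)
    (yes : Γ → Bool) (p : Polynomial ℕ)
    (h : ∀ w : List Γ, ∃ t ≤ p.eval w.length, ∃ a, (yes a = true ↔ w ∈ L) ∧
      Exec c (Function.update (fun _ => []) inp w) t (Function.update (fun _ => []) res [a])) :
    InP L := by
  classical
  let tm : Turing.FinTM2 :=
    { K := Option K
      k₀ := some inp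
      k₁ := none
      Γ := Alph K Γ
      Λ := Option (Lab c)
      main := some (entry c)
      σ := Option Γ
      initialState := none
      Γk₀Fin := inferInstanceAs (Fintype Γ)
      m := machine c res yes }
  refine ⟨{ tm := tm, inputAlphabet := Equiv.refl Γ, outputAlphabet := Equiv.refl Bool,
            time := p + 1, outputsFun := fun w => ?_ }⟩
  -- The additional step runs the label `none`: it pops the answer, pushes the output bit, resets
  -- the internal state and halts.
  have key : ∃ t ≤ (p + 1).eval w.length, (flip bind tm.step)^[t]
      (some (Turing.initList tm w)) = some (Turing.haltList tm [decide (w ∈ L)]) := by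
    obtain ⟨t, ht, a, ha, hex⟩ := h w
    obtain ⟨v, hv⟩ := hex.reaches (M := machine c res yes) some none (fun l => rfl) [] none
    refine ⟨t + 1, by simpa using ht, ?_⟩
    have e1 : Turing.initList tm w = ⟨some (some (entry c)), none,
        stk [] (Function.update (fun _ => []) inp w)⟩ := by
      simp only [Turing.initList]
      congr 1
      funext o
      rcases o with _ | r
      · rfl
      · by_cases hr : r = inp
        · subst hr
          have e : Function.update (fun _ => []) r w r = w := Function.update_self r w fun _ => []
          exact (dif_pos rfl).trans e.symm
        · exact (dif_neg fun h => hr (Option.some.inj h)).trans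
            (Function.update_of_ne (f := fun _ => []) hr _).symm
    have e2 : Turing.haltList tm [decide (w ∈ L)] = ⟨none, none,
        stk [yes a] (fun _ => [])⟩ := by
      have : yes a = decide (w ∈ L) := by
        rw [Bool.eq_iff_iff]; simpa using ha
      rw [this]
      simp only [Turing.haltList]
      congr 1
      funext o
      rcases o with _ | r
      · rfl
      · rfl
    rw [e1, e2, add_comm, Function.iterate_add_apply]
    refine (congrArg _ hv).trans ((bind_step rfl _ _).trans ?_)
    rw [stk_output res a (yes a)]
    change some (Turing.TM2.stepAux (machine c res yes none) _ _) = _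
    simp only [machine, Turing.TM2.stepAux]
    have e4 : stk [] (Function.update (fun _ => []) res [a]) (some res) = [a] :=
      by simp only [stk, Function.update_self]
    rw [e4]
    rfl
  have e0 : ∀ u : List Γ, List.map (Equiv.refl Γ).invFun u = u := fun u => List.map_id u
  have e0' : ∀ u : List Bool, List.map (Equiv.refl Bool).invFun u = u := fun u => List.map_id u
  obtain ⟨ht, hrun⟩ := key.choose_spec
  refine ⟨⟨key.choose, ?_⟩, ht⟩
  simp only [id, e0, e0', Computability.encodeBool, Option.map_some]
  exact hrun

end Cmd

/-! ### Programs with pointers into a string -/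

/-- The alphabet of the tuple-listing encoding over a domain with three elements. -/
abbrev Ab := Sym (Fin 3)

noncomputable instance : DecidableEq Ab := Classical.decEq _

noncomputable instance : Fintype Ab :=
  Fintype.ofSurjective
    (fun o : Fin 7 ⊕ Fin 3 => o.elim ![.all, .ex, .var, .tick, .eq, .rel, .tup] Sym.elem) (by
      rintro (_ | _ | _ | _ | a | _ | _ | _)
      exacts [⟨.inl 0, rfl⟩, ⟨.inl 1, rfl⟩, ⟨.inl 2, rfl⟩, ⟨.inl 3, rfl⟩, ⟨.inr a, rfl⟩,
        ⟨.inl 4, rfl⟩, ⟨.inl 5, rfl⟩, ⟨.inl 6, rfl⟩])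

/-- Truth values as symbols. -/
noncomputable def truth (p : Prop) : Ab := open Classical in if p then .all else .ex

theorem truth_eq_all {p : Prop} : truth p = .all ↔ p := by
  unfold truth; split <;> simp_all

theorem truth_of {p : Prop} (h : p) : truth p = .all := truth_eq_all.2 h

theorem truth_of_not {p : Prop} (h : ¬ p) : truth p = .ex := by simp [truth, h]

theorem truth_congr {p q : Prop} (h : p ↔ q) : truth p = truth q := by rw [propext h]

/-- Bounded by a polynomial. -/
def PolyBdd (f : ℕ → ℕ) : Prop := ∃ p : Polynomial ℕ, ∀ n, f n ≤ p.eval n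

namespace PolyBdd

theorem const (c : ℕ) : PolyBdd fun _ => c := ⟨Polynomial.C c, fun n => by simp⟩

theorem id : PolyBdd fun n => n := ⟨Polynomial.X, fun n => by simp⟩

theorem add {f g : ℕ → ℕ} (hf : PolyBdd f) (hg : PolyBdd g) : PolyBdd fun n => f n + g n := by
  obtain ⟨p, hp⟩ := hf
  obtain ⟨q, hq⟩ := hg
  exact ⟨p + q, fun n => by simpa using add_le_add (hp n) (hq n)⟩

theorem mul {f g : ℕ → ℕ} (hf : PolyBdd f) (hg : PolyBdd g) : PolyBdd fun n => f n * g n := by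
  obtain ⟨p, hp⟩ := hf
  obtain ⟨q, hq⟩ := hg
  exact ⟨p * q, fun n => by simpa using Nat.mul_le_mul (hp n) (hq n)⟩

end PolyBdd

namespace Cmd

/-- `Runs c s s' T`: started on `s`, the program `c` leaves `s'` after at most `T` steps. -/
def Runs {K Γ : Type} [DecidableEq K] (c : Cmd K Γ) (s s' : K → List Γ) (T : ℕ) : Prop :=
  ∃ t ≤ T, Exec c s t s'

namespace Runs

variable {K Γ : Type} [DecidableEq K] {c d : Cmd K Γ} {s s' s'' : K → List Γ} {T T' : ℕ}

theorem mono (h : Runs c s s' T) (hT : T ≤ T') : Runs c s s' T' :=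
  let ⟨t, ht, h⟩ := h
  ⟨t, ht.trans hT, h⟩

theorem congr (h : Runs c s s' T) (e : s' = s'') : Runs c s s'' T := e ▸ h

theorem seq (h : Runs c s s' T) (h' : Runs d s' s'' T') : Runs (c.seq d) s s'' (T + T') :=
  let ⟨t, ht, h⟩ := h
  let ⟨t', ht', h'⟩ := h'
  ⟨t + t', add_le_add ht ht', h.seq h'⟩

theorem cases {r : K} {f : Option Γ → Cmd K Γ} (h : Runs (f (s r).head?) s s' T) :
    Runs (.cases r f) s s' (1 + T) :=
  let ⟨t, ht, h⟩ := h
  ⟨1 + t, by omega, h.cases⟩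

/-- The family `S` plays the role of a loop invariant giving the complete contents of the stacks
after `j` rounds. Each round pays one step for the test, as does the final exit. -/
theorem loop_iter {r : K} (m : ℕ) (S : ℕ → K → List Γ) (hne : ∀ j < m, S j r ≠ [])
    (he : S m r = []) (h : ∀ j < m, Runs c (S j) (S (j + 1)) T) :
    Runs (.loop r c) (S 0) (S m) (m * (T + 1) + 1) := by
  induction m generalizing S with
  | zero => exact ⟨1, by simp, .loop_nil he⟩
  | succ m ih =>
    obtain ⟨t', ht', h'⟩ := ih (fun j => S (j + 1)) (fun j hj => hne _ (by omega)) he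
      (fun j hj => h _ (by omega))
    obtain ⟨t, ht, h⟩ := h 0 (by omega)
    exact ⟨1 + t + t', by rw [Nat.succ_mul]; omega, .loop_cons (hne 0 (by omega)) h h'⟩

end Runs

end Cmd

/-- The kinds of auxiliary stacks. -/
inductive Work
  | t
  | u
  | v
  | w
  | bits
  | seen
  | new
  deriving DecidableEq

instance : Fintype Work :=
  ⟨{.t, .u, .v, .w, .bits, .seen, .new}, fun x => by cases x <;> decide⟩

/-- Stacks besides those that hold the input string around a pointer: the stack of truth values
`.inl true`, the input stack `.inl false` and auxiliary stacks. -/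
abbrev Aux (D : ℕ) := Bool ⊕ (Work × Fin D)

/-- All stacks of a program with `D` pointers: the parts of the string to the left and to the right
of each pointer, and the auxiliary stacks. -/
abbrev Reg (D : ℕ) := (Fin D ⊕ Fin D) ⊕ Aux D

/-- The stacks when the pointers are at the positions `v` of the string `w`. -/
def pstk {D : ℕ} (w : List Ab) (v : Fin D → ℕ) (g : Aux D → List Ab) : Reg D → List Ab
  | .inl (.inl i) => (w.take (v i)).reverse
  | .inl (.inr i) => w.drop (v i)
  | .inr j => g j

section

open Cmd Function

variable {D : ℕ} {w : List Ab} {v : Fin D → ℕ} {g : Aux D → List Ab}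

theorem update_pstk (j : Aux D) (l : List Ab) :
    update (pstk w v g) (.inr j) l = pstk w v (update g j l) := by
  funext r
  rcases r with (r | r) | r
  · simp [pstk]
  · simp [pstk]
  · by_cases hr : r = j
    · subst hr; simp [pstk]
    · simp [pstk, hr]

theorem pstk_inr (j : Aux D) : pstk w v g (.inr j) = g j := rfl

theorem runs_push (j : Aux D) (a : Ab) (l : List Ab) :
    Runs (push (.inr j) a) (pstk w v (update g j l)) (pstk w v (update g j (a :: l))) 1 := by
  refine ⟨1, le_rfl, ?_⟩
  have := Exec.push (Sum.inr j) a (pstk w v (update g j l))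
  simpa [update_pstk, pstk_inr] using this

theorem runs_pop (j : Aux D) (a : Ab) (l : List Ab) :
    Runs (pop (.inr j)) (pstk w v (update g j (a :: l))) (pstk w v (update g j l)) 1 := by
  refine ⟨1, le_rfl, ?_⟩
  have := Exec.pop (Sum.inr j) (pstk w v (update g j (a :: l)))
  simpa [update_pstk, pstk_inr] using this

theorem runs_push' (j : Aux D) (a : Ab) :
    Runs (push (.inr j) a) (pstk w v g) (pstk w v (update g j (a :: g j))) 1 := by
  simpa using runs_push (g := g) j a (g j)

theorem runs_pop' (j : Aux D) :
    Runs (pop (.inr j)) (pstk w v g) (pstk w v (update g j (g j).tail)) 1 := by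
  refine ⟨1, le_rfl, ?_⟩
  have := Exec.pop (Sum.inr j) (pstk w v g)
  simpa [update_pstk, pstk_inr] using this

/-- Move a pointer to the right. -/
def moveR (i : Fin D) : Cmd (Reg D) Ab :=
  cases (.inl (.inr i)) fun
    | none => skip
    | some a => (pop (.inl (.inr i))).seq (push (.inl (.inl i)) a)

/-- Move a pointer to the left. -/
def moveL (i : Fin D) : Cmd (Reg D) Ab :=
  cases (.inl (.inl i)) fun
    | none => skip
    | some a => (pop (.inl (.inl i))).seq (push (.inl (.inr i)) a)

theorem runs_moveR (i : Fin D) (h : v i < w.length) :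
    Runs (moveR i) (pstk w v g) (pstk w (update v i (v i + 1)) g) 3 := by
  have e : (pstk w v g (.inl (.inr i))).head? = some w[v i] := by simp [pstk, h]
  refine Runs.cases (T := 2) ?_
  rw [e]
  refine ⟨2, le_rfl, ?_⟩
  have := (Exec.pop (Sum.inl (Sum.inr i)) (pstk w v g)).seq
    (Exec.push (Sum.inl (Sum.inl i)) w[v i] _)
  convert this using 1
  funext r
  rcases r with (r | r) | r
  · by_cases hr : r = i
    · subst hr; simp [pstk, List.take_add_one, h, -List.take_append_getElem]
    · simp [pstk, hr]
  · by_cases hr : r = i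
    · subst hr; simp [pstk]
    · simp [pstk, hr]
  · simp [pstk]

theorem runs_moveL (i : Fin D) (h : 0 < v i) (h' : v i ≤ w.length) :
    Runs (moveL i) (pstk w v g) (pstk w (update v i (v i - 1)) g) 3 := by
  have hl : v i - 1 < w.length := by omega
  have et : w.take (v i) = w.take (v i - 1) ++ [w[v i - 1]] := by
    conv_lhs => rw [show v i = v i - 1 + 1 by omega, List.take_add_one]
    simp [hl]
  have ed : w.drop (v i - 1) = w[v i - 1] :: w.drop (v i) := by
    rw [List.drop_eq_getElem_cons hl, show v i - 1 + 1 = v i by omega]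
  have e : (pstk w v g (.inl (.inl i))).head? = some w[v i - 1] := by simp [pstk, et, -List.take_append_getElem]
  refine Runs.cases (T := 2) ?_
  rw [e]
  refine ⟨2, le_rfl, ?_⟩
  have := (Exec.pop (Sum.inl (Sum.inl i)) (pstk w v g)).seq
    (Exec.push (Sum.inl (Sum.inr i)) w[v i - 1] _)
  convert this using 1
  funext r
  rcases r with (r | r) | r
  · by_cases hr : r = i
    · subst hr; simp [pstk, et, -List.take_append_getElem]
    · simp [pstk, hr]
  · by_cases hr : r = i
    · subst hr; simp [pstk, ed]
    · simp [pstk, hr]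
  · simp [pstk]

/-- Run a program with the pointer `i` at all positions. -/
def forEach (i : Fin D) (c : Cmd (Reg D) Ab) : Cmd (Reg D) Ab :=
  c.seq ((loop (.inl (.inr i)) ((moveR i).seq c)).seq (loop (.inl (.inl i)) (moveL i)))

theorem runs_rewind (i : Fin D) (h : v i ≤ w.length) :
    Runs (loop (.inl (.inl i)) (moveL i)) (pstk w v g) (pstk w (update v i 0) g)
      (w.length * 4 + 1) := by
  have := Runs.loop_iter (r := .inl (.inl i)) (c := moveL i) (T := 3) (v i)
    (fun j => pstk w (update v i (v i - j)) g)
    (fun j hj => by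
      have : v i - j ≠ 0 := by omega
      have h' : w ≠ [] := by rintro rfl; simp at h; omega
      simp [pstk, this, h']) (by simp [pstk]) (fun j hj => by
      have := runs_moveL (w := w) (v := update v i (v i - j)) (g := g) i
        (by rw [update_self]; omega) (by rw [update_self]; omega)
      rwa [update_idem, update_self, Nat.sub_sub] at this)
  simp only [Nat.sub_self, Nat.sub_zero, update_eq_self] at this
  exact this.mono (by nlinarith)

/-- `G j` is the auxiliary memory before the visit of position `j`. The end of the string counts as
a position, which makes `w.length + 1` rounds: the body runs once before the first move and once
after each move. The rewind restores the pointer. -/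
theorem runs_forEach {i : Fin D} {c : Cmd (Reg D) Ab} {T : ℕ} (G : ℕ → Aux D → List Ab)
    (hv : v i = 0) (h : ∀ j ≤ w.length,
      Runs c (pstk w (update v i j) (G j)) (pstk w (update v i j) (G (j + 1))) T) :
    Runs (forEach i c) (pstk w v (G 0)) (pstk w v (G (w.length + 1)))
      ((w.length + 1) * (T + 8) + 2) := by
  have e : update v i 0 = v := by rw [← hv, update_eq_self]
  have h1 := Runs.loop_iter (r := .inl (.inr i)) (c := (moveR i).seq c) w.length
    (fun j => pstk w (update v i j) (G (j + 1))) (fun j hj => by simp [pstk, hj])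
    (by simp [pstk]) (fun j hj => by
      have := runs_moveR (w := w) (v := update v i j) (g := G (j + 1)) i
        (by rw [update_self]; omega)
      rw [update_idem, update_self] at this
      exact this.seq (h (j + 1) hj))
  have h0 := h 0 (Nat.zero_le _)
  have h2 := runs_rewind (w := w) (v := update v i w.length) (g := G (w.length + 1)) i (by simp)
  rw [update_idem, e] at h2
  rw [e] at h0
  simp only [e] at h1
  exact (h0.seq (h1.seq h2)).mono (by ring_nf; omega)

/-- Add the position of the pointer `i`, in unary, to the stack `u`. -/
def addTo (t u : Aux D) (i : Fin D) : Cmd (Reg D) Ab :=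
  (loop (.inl (.inl i)) ((moveL i).seq (push (.inr t) .tick))).seq
    (loop (.inr t) ((pop (.inr t)).seq ((moveR i).seq (push (.inr u) .tick))))

/-- Walking the pointer back to the start loses its position, so the number of moves is kept on `t`.
Emptying `t` then restores the pointer and deposits the same number of ticks on `u`. -/
theorem runs_addTo {t u : Aux D} (htu : t ≠ u) (i : Fin D) (h : v i ≤ w.length) (ht : g t = []) :
    Runs (addTo t u i) (pstk w v g)
      (pstk w v (update g u (List.replicate (v i) .tick ++ g u))) (w.length * 11 + 2) := by
  have h1 := Runs.loop_iter (r := .inl (.inl i)) (c := (moveL i).seq (push (.inr t) .tick))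
    (T := 4) (v i)
    (fun j => pstk w (update v i (v i - j)) (update g t (List.replicate j Sym.tick)))
    (fun j hj => by
      have : v i - j ≠ 0 := by omega
      have h' : w ≠ [] := by rintro rfl; simp at h; omega
      simp [pstk, this, h']) (by simp [pstk]) (fun j hj => by
      have := runs_moveL (w := w) (v := update v i (v i - j))
        (g := update g t (List.replicate j Sym.tick)) i
        (by rw [update_self]; omega) (by rw [update_self]; omega)
      rw [update_idem, update_self, Nat.sub_sub] at this
      exact this.seq (runs_push _ _ _))
  have h2 := Runs.loop_iter (r := .inr t)
    (c := (pop (.inr t)).seq ((moveR i).seq (push (.inr u) .tick))) (T := 1 + (3 + 1)) (v i)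
    (fun j => pstk w (update v i j)
      (update (update g t (List.replicate (v i - j) Sym.tick)) u (List.replicate j .tick ++ g u)))
    (fun j hj => by
      have : v i - j ≠ 0 := by omega
      simp [pstk, htu, this]) (by simp [pstk, htu]) (fun j hj => by
      have e : v i - j = v i - (j + 1) + 1 := by omega
      simp only [e, List.replicate_succ, List.cons_append]
      simp only [update_comm htu]
      have h3 := runs_moveR (w := w) (v := update v i j) (g := update (update g u
          (List.replicate j Sym.tick ++ g u)) t (List.replicate (v i - (j + 1)) Sym.tick)) i
          (by rw [update_self]; omega)
      rw [update_idem, update_self] at h3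
      have h4 := runs_push (w := w) (v := update v i (j + 1))
        (g := update g t (List.replicate (v i - (j + 1)) Sym.tick)) u .tick
        (List.replicate j Sym.tick ++ g u)
      simp only [update_comm htu] at h4
      exact (runs_pop t _ _).seq (h3.seq h4))
  have e : update v i (v i) = v := update_eq_self _ _
  have e' : update g t [] = g := by rw [← ht, update_eq_self]
  have e'' : update g u (g u) = g := update_eq_self _ _
  simp only [Nat.sub_zero, Nat.sub_self, e, List.replicate_zero, e', List.nil_append] at h1 h2
  have e3 : update (update g t (List.replicate (v i) Sym.tick)) u (g u) =
      update g t (List.replicate (v i) .tick) := by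
    rw [update_comm htu, e'']
  rw [e3] at h2
  exact (h1.seq h2).mono (by nlinarith)

end

/-! ### Clearing, transferring and comparing stacks. -/

section

open Cmd Function

variable {D : ℕ} {w : List Ab} {v : Fin D → ℕ} {g : Aux D → List Ab}

theorem runs_cases {j : Aux D} {f : Option Ab → Cmd (Reg D) Ab} {o : Option Ab} {T : ℕ}
    {s' : Reg D → List Ab} (ho : (g j).head? = o) (h : Runs (f o) (pstk w v g) s' T) :
    Runs (cases (.inr j) f) (pstk w v g) s' (1 + T) :=
  Runs.cases (by rw [pstk_inr, ho]; exact h)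

/-- Empty a stack. -/
def clear {K : Type} (r : K) : Cmd K Ab := loop r (pop r)

theorem runs_clear (j : Aux D) :
    Runs (clear (.inr j)) (pstk w v g) (pstk w v (update g j [])) ((g j).length * 2 + 1) := by
  have := Runs.loop_iter (r := .inr j) (c := pop (.inr j)) (T := 1) (g j).length
    (fun i => pstk w v (update g j ((g j).drop i)))
    (fun i hi => by rw [pstk_inr, update_self]; simpa using hi)
    (by rw [pstk_inr, update_self]; simp) (fun i hi => by
      have := runs_pop' (w := w) (v := v) (g := update g j ((g j).drop i)) j
      rwa [update_idem, update_self, List.tail_drop] at this)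
  simpa [clear] using this

/-- Empty the stack `j` onto the stack `j'`. -/
noncomputable def transfer (j j' : Aux D) : Cmd (Reg D) Ab :=
  loop (.inr j) (cases (.inr j) fun
    | none => skip
    | some a => (pop (.inr j)).seq (push (.inr j') a))

theorem runs_transfer {j j' : Aux D} (hj : j ≠ j') :
    Runs (transfer j j') (pstk w v g)
      (pstk w v (update (update g j []) j' ((g j).reverse ++ g j'))) ((g j).length * 4 + 1) := by
  have := Runs.loop_iter (r := .inr j) (c := cases (.inr j) fun
    | none => skip
    | some a => (pop (.inr j)).seq (push (.inr j') a)) (T := 1 + (1 + 1)) (g j).length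
    (fun i => pstk w v (update (update g j ((g j).drop i)) j' (((g j).take i).reverse ++ g j')))
    (fun i hi => by rw [pstk_inr, update_of_ne hj, update_self]; simpa using hi)
    (by rw [pstk_inr, update_of_ne hj, update_self]; simp) (fun i hi => by
      have e : (g j).drop i = (g j)[i] :: (g j).drop (i + 1) := List.drop_eq_getElem_cons hi
      have e' : ((g j).take (i + 1)).reverse = (g j)[i] :: ((g j).take i).reverse := by
        rw [List.take_add_one]; simp [hi, -List.take_append_getElem]
      refine runs_cases (o := some (g j)[i]) (by rw [update_of_ne hj, update_self, e]; rfl) ?_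
      rw [e, e']
      refine Runs.seq ?_ (runs_push _ _ _)
      rw [update_comm hj, update_comm hj]
      exact runs_pop _ _ _)
  simpa [transfer] using this

/-- Compare the stack `u` of ticks with the position of the pointer `i`. -/
noncomputable def compare (t u x y r : Aux D) (i : Fin D) : Cmd (Reg D) Ab :=
  (addTo t x i).seq <|
  (loop (.inr u) ((pop (.inr u)).seq (cases (.inr x) fun
    | none => push (.inr y) .tick
    | some _ => pop (.inr x)))).seq <|
  (cases (.inr x) fun
    | none => cases (.inr y) fun
      | none => push (.inr r) (truth True)
      | some _ => push (.inr r) (truth False)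
    | some _ => push (.inr r) (truth False)).seq <|
  (clear (.inr x)).seq (clear (.inr y))

/-- The comparison is a two-sided truncated subtraction: each tick of `u` cancels a tick of `x`, or
goes to `y` when `x` is exhausted. In the end `x` holds `v i - a` ticks and `y` holds `a - v i`, so
equality means that both are empty. -/
theorem runs_compare {t u x y r : Aux D} {i : Fin D} {a : ℕ} (hd : [t, u, x, y, r].Nodup)
    (hi : v i ≤ w.length) (ht : g t = []) (hu : g u = []) (hx : g x = []) (hy : g y = []) :
    Runs (compare t u x y r i) (pstk w v (update g u (List.replicate a .tick)))
      (pstk w v (update g r (truth (a = v i) :: g r))) (w.length * 13 + a * 10 + 20) := by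
  simp only [List.nodup_cons, List.mem_cons, List.not_mem_nil, or_false, not_or] at hd
  obtain ⟨⟨htu, htx, hty, htr⟩, ⟨hux, huy, hur⟩, ⟨hxy, hxr⟩, hyr, -⟩ := hd
  -- The memory with given contents of `u`, `x` and `y`; the identities that follow make commuting
  -- the updates automatic.
  let tri : List Ab → List Ab → List Ab → Aux D → List Ab := fun a b c =>
    update (update (update g u a) x b) y c
  have hgu : ∀ a b c l, update (tri a b c) u l = tri l b c := fun a b c l => by
    simp only [tri]
    rw [update_comm (Ne.symm huy), update_comm (Ne.symm hux), update_idem]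
  have hgx : ∀ a b c l, update (tri a b c) x l = tri a l c := fun a b c l => by
    simp only [tri]
    rw [update_comm (Ne.symm hxy), update_idem]
  have hgy : ∀ a b c l, update (tri a b c) y l = tri a b l := fun a b c l => by
    simp only [tri]
    rw [update_idem]
  have gu : ∀ a b c, tri a b c u = a := fun a b c => by simp [tri, hux, huy]
  have gx : ∀ a b c, tri a b c x = b := fun a b c => by simp [tri, hxy]
  have gy : ∀ a b c, tri a b c y = c := fun a b c => by simp [tri]
  have e0 : ∀ a, tri a [] [] = update g u a := fun a => by
    simp only [tri]
    rw [update_eq_self_iff.2, update_eq_self_iff.2]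
    · rw [update_of_ne (Ne.symm hux), hx]
    · rw [update_of_ne (Ne.symm hxy), update_of_ne (Ne.symm huy), hy]
  have e00 : tri [] [] [] = g := by rw [e0, update_eq_self_iff.2 hu.symm]
  have h1 := runs_addTo (w := w) (v := v) (g := tri (List.replicate a Sym.tick) [] []) htx i hi
    (by rw [e0, update_of_ne htu, ht])
  rw [hgx, gx, List.append_nil] at h1
  have h2 := Runs.loop_iter (r := .inr u) (c := (pop (.inr u)).seq (cases (.inr x) fun
    | none => push (.inr y) .tick
    | some _ => pop (.inr x))) (T := 1 + (1 + 1)) a (fun j => pstk w v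
      (tri (List.replicate (a - j) Sym.tick) (List.replicate (v i - j) Sym.tick)
        (List.replicate (j - v i) Sym.tick)))
    (fun j hj => by
      rw [pstk_inr, gu]
      have : a - j ≠ 0 := by omega
      simp [this]) (by rw [pstk_inr, gu]; simp) (fun j hj => by
      have ea : a - j = (a - (j + 1)) + 1 := by omega
      have h3 := runs_pop' (w := w) (v := v) (g := tri (List.replicate (a - j) Sym.tick)
        (List.replicate (v i - j) Sym.tick) (List.replicate (j - v i) Sym.tick)) u
      rw [hgu, gu, List.tail_replicate, Nat.sub_sub] at h3
      refine h3.seq ?_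
      by_cases hj' : j < v i
      · have ex : v i - j = v i - (j + 1) + 1 := by omega
        refine runs_cases (o := some .tick) (by rw [gx, ex]; rfl) ?_
        have h4 := runs_pop' (w := w) (v := v) (g := tri (List.replicate (a - (j + 1)) Sym.tick)
          (List.replicate (v i - j) Sym.tick) (List.replicate (j - v i) Sym.tick)) x
        rw [hgx, gx, List.tail_replicate, Nat.sub_sub] at h4
        rwa [show j + 1 - v i = j - v i by omega]
      · have ex : v i - j = 0 := by omega
        refine runs_cases (o := none) (by rw [gx, ex]; rfl) ?_
        have h4 := runs_push' (w := w) (v := v) (g := tri (List.replicate (a - (j + 1)) Sym.tick)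
          (List.replicate (v i - j) Sym.tick) (List.replicate (j - v i) Sym.tick)) y .tick
        rw [hgy, gy, ← List.replicate_succ] at h4
        rwa [show j + 1 - v i = j - v i + 1 by omega, show v i - (j + 1) = v i - j by omega])
  simp only [Nat.sub_zero, Nat.zero_sub, Nat.sub_self, List.replicate_zero] at h2
  set X := List.replicate (v i - a) Sym.tick with hX
  set Y := List.replicate (a - v i) Sym.tick with hY
  have h3 : Runs (cases (.inr x) fun
    | none => cases (.inr y) fun
      | none => push (.inr r) (truth True)
      | some _ => push (.inr r) (truth False)
    | some _ => push (.inr r) (truth False)) (pstk w v (tri [] X Y))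
      (pstk w v (update (tri [] X Y) r (truth (a = v i) :: g r))) 3 := by
    have hr : tri [] X Y r = g r := by
      simp only [tri]
      rw [update_of_ne (Ne.symm hyr), update_of_ne (Ne.symm hxr), update_of_ne (Ne.symm hur)]
    have h4 := fun p => runs_push' (w := w) (v := v) (g := tri [] X Y) r p
    rw [hr] at h4
    by_cases h : v i ≤ a
    · by_cases h' : a ≤ v i
      · refine runs_cases (T := 1 + 1) (o := none) (by rw [gx, hX, Nat.sub_eq_zero_of_le h]; rfl) ?_
        refine runs_cases (o := none) (by rw [gy, hY, Nat.sub_eq_zero_of_le h']; rfl) ?_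
        rw [show truth (a = v i) = truth True from truth_congr (iff_true_intro (le_antisymm h' h))]
        exact h4 _
      · refine runs_cases (T := 1 + 1) (o := none) (by rw [gx, hX, Nat.sub_eq_zero_of_le h]; rfl) ?_
        refine runs_cases (o := some .tick) (by
          rw [gy, hY, show a - v i = a - v i - 1 + 1 by omega]; rfl) ?_
        rw [show truth (a = v i) = truth False from truth_congr (iff_false_intro fun e => h' e.le)]
        exact h4 _
    · refine (runs_cases (T := 1) (o := some .tick) (by
        rw [gx, hX, show v i - a = v i - a - 1 + 1 by omega]; rfl) ?_).mono (by omega)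
      rw [show truth (a = v i) = truth False from truth_congr (iff_false_intro fun e => h e.ge)]
      exact h4 _
  have h5 := runs_clear (w := w) (v := v) (g := update (tri [] X Y) r (truth (a = v i) :: g r)) x
  rw [update_of_ne hxr, gx, update_comm (Ne.symm hxr), hgx] at h5
  have h6 := runs_clear (w := w) (v := v) (g := update (tri [] [] Y) r (truth (a = v i) :: g r)) y
  rw [update_of_ne hyr, gy, update_comm (Ne.symm hyr), hgy, e00] at h6
  rw [← e0]
  refine (h1.seq (h2.seq (h3.seq (h5.seq h6)))).mono ?_
  rw [hX, hY, List.length_replicate, List.length_replicate]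
  omega

end

/-! ### Predicates on positions decided in polynomial time -/

section

open Cmd Function

/-- The positions `v` of the first `k` pointers; the others are at the beginning. -/
def pad (D : ℕ) {k : ℕ} (v : Fin k → ℕ) : Fin D → ℕ := fun i => if h : i.1 < k then v ⟨i, h⟩ else 0

theorem pad_le {D k : ℕ} {v : Fin k → ℕ} {n : ℕ} (hv : ∀ i, v i ≤ n) (i : Fin D) :
    pad D v i ≤ n := by
  unfold pad; split
  · exact hv _
  · exact Nat.zero_le _

theorem pad_snoc {D k : ℕ} (hk : k < D) (v : Fin k → ℕ) (x : ℕ) :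
    pad D (Fin.snoc v x : Fin (k + 1) → ℕ) = update (pad D v) ⟨k, hk⟩ x := by
  funext i
  by_cases h : i = ⟨k, hk⟩
  · subst h; simp [pad, Fin.snoc]
  · have h' : i.1 ≠ k := fun e => h (Fin.ext e)
    rw [update_of_ne h]
    unfold pad Fin.snoc
    by_cases h1 : i.1 < k
    · simp [h1, Nat.lt_succ_of_lt h1]
    · have : ¬ i.1 < k + 1 := by omega
      simp [h1, this]

theorem pad_castLE {D k : ℕ} (hk : k ≤ D) (v : Fin k → ℕ) (i : Fin k) :
    pad D v (i.castLE hk) = v i := by simp [pad]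

/-- `c` decides `P`, the truth value being pushed on the stack of truth values, with the first `k`
pointers as variables, and using the auxiliary stacks from the index `k` on. -/
def Decides {D k : ℕ} (c : Cmd (Reg D) Ab) (P : List Ab → (Fin k → ℕ) → Prop) (T : ℕ → ℕ) : Prop :=
  ∀ w v, (∀ i, v i ≤ w.length) → ∀ g : Aux D → List Ab, (∀ x i, k ≤ i.1 → g (.inr (x, i)) = []) →
    Runs c (pstk w (pad D v) g) (pstk w (pad D v) (update g (.inl true) (truth (P w v) ::
      g (.inl true)))) (T w.length)

/-- Predicates on a string and positions in this string that are decided in polynomial time by a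
program with pointers. -/
def PolyDec (k : ℕ) (P : List Ab → (Fin k → ℕ) → Prop) : Prop :=
  ∃ D₀, k ≤ D₀ ∧ ∀ D, D₀ ≤ D → ∃ (c : Cmd (Reg D) Ab) (T : ℕ → ℕ), PolyBdd T ∧ Decides c P T

namespace PolyDec

variable {k : ℕ} {P Q : List Ab → (Fin k → ℕ) → Prop}

theorem congr (h : PolyDec k P) (e : ∀ w v, (∀ i, v i ≤ w.length) → (P w v ↔ Q w v)) :
    PolyDec k Q := by
  obtain ⟨D₀, hk, h⟩ := h
  refine ⟨D₀, hk, fun D hD => ?_⟩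
  obtain ⟨c, T, hT, h⟩ := h D hD
  refine ⟨c, T, hT, fun w v hv g hg => ?_⟩
  rw [← truth_congr (e w v hv)]
  exact h w v hv g hg

theorem sym (i : Fin k) (a : Ab) : PolyDec k fun w v => w[v i]? = some a := by
  refine ⟨k, le_rfl, fun D hD => ?_⟩
  refine ⟨cases (.inl (.inr (i.castLE hD))) fun o => push (.inr (.inl true)) (truth (o = some a)),
    fun _ => 2, .const 2, fun w v _ g _ => ?_⟩
  refine Runs.cases (T := 1) ?_
  have e : (pstk w (pad D v) g (.inl (.inr (i.castLE hD)))).head? = w[v i]? := by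
    simp [pstk, pad_castLE]
  rw [e]
  exact runs_push' _ _

theorem not (h : PolyDec k P) : PolyDec k fun w v => ¬ P w v := by
  obtain ⟨D₀, hk, h⟩ := h
  refine ⟨D₀, hk, fun D hD => ?_⟩
  obtain ⟨c, T, hT, h⟩ := h D hD
  refine ⟨c.seq (cases (.inr (.inl true)) fun o =>
    (pop (.inr (.inl true))).seq (push (.inr (.inl true)) (truth (o ≠ some .all)))),
    fun n => T n + (1 + (1 + 1)), hT.add (.const _), fun w v hv g hg => ?_⟩
  refine (h w v hv g hg).seq (runs_cases rfl ?_)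
  refine (runs_pop _ _ _).seq ?_
  rw [update_eq_self]
  refine (runs_push' _ _).congr ?_
  rw [update_self, List.head?_cons]
  simp only [ne_eq, Option.some.injEq, truth_eq_all]

theorem and (h : PolyDec k P) (h' : PolyDec k Q) : PolyDec k fun w v => P w v ∧ Q w v := by
  obtain ⟨D₀, hk, h⟩ := h
  obtain ⟨D₁, -, h'⟩ := h'
  -- Both programs must run on the same stacks. This is why `PolyDec` supplies a program for every
  -- sufficiently large number of pointers.
  refine ⟨max D₀ D₁, hk.trans (le_max_left _ _), fun D hD => ?_⟩
  obtain ⟨c, T, hT, h⟩ := h D ((le_max_left _ _).trans hD)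
  obtain ⟨c', T', hT', h'⟩ := h' D ((le_max_right _ _).trans hD)
  refine ⟨c.seq (c'.seq (cases (.inr (.inl true)) fun o =>
    if o = some .all then pop (.inr (.inl true)) else
      (pop (.inr (.inl true))).seq ((pop (.inr (.inl true))).seq
        (push (.inr (.inl true)) (truth False))))),
    fun n => T n + (T' n + (1 + (1 + (1 + 1)))), hT.add (hT'.add (.const _)),
    fun w v hv g hg => ?_⟩
  have h2 := h' w v hv (update g (.inl true) (truth (P w v) :: g (.inl true))) (fun x i hi => by
    rw [update_of_ne (by simp)]; exact hg x i hi)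
  rw [update_idem, update_self] at h2
  refine (h w v hv g hg).seq (h2.seq (runs_cases rfl ?_))
  rw [update_self, List.head?_cons]
  by_cases hQ : Q w v
  · rw [if_pos (congrArg some (truth_of hQ)), truth_congr (and_iff_left hQ)]
    exact (runs_pop _ _ _).mono (by omega)
  · rw [if_neg (fun h => hQ (truth_eq_all.1 (Option.some.inj h))), truth_of_not (p := P w v ∧ Q w v) (fun h => hQ h.2),
      truth_of_not (p := False) id]
    exact (runs_pop _ _ _).seq ((runs_pop _ _ _).seq (runs_push _ _ _))

theorem or (h : PolyDec k P) (h' : PolyDec k Q) : PolyDec k fun w v => P w v ∨ Q w v :=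
  (h.not.and h'.not).not.congr fun w v _ => by tauto

theorem imp (h : PolyDec k P) (h' : PolyDec k Q) : PolyDec k fun w v => P w v → Q w v :=
  (h.and h'.not).not.congr fun w v _ => by tauto

theorem const (p : Prop) : PolyDec k fun _ _ => p :=
  ⟨k, le_rfl, fun _ _ => ⟨push (.inr (.inl true)) (truth p), fun _ => 1, .const 1,
    fun _ _ _ _ _ => runs_push' _ _⟩⟩

/-- The position `v i + v j` is `v l`. -/
theorem add (i j l : Fin k) : PolyDec k fun _ v => v i + v j = v l := by
  refine ⟨k + 1, by omega, fun D hD => ?_⟩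
  have hk : k ≤ D := by omega
  -- By the convention in `Decides`, the auxiliary stacks of index `k` are empty on entry, so they
  -- are free work space; one pointer beyond the `k` variables guarantees that they exist.
  let a : Work → Aux D := fun x => .inr (x, ⟨k, by omega⟩)
  refine ⟨(addTo (a .t) (a .u) (i.castLE hk)).seq ((addTo (a .t) (a .u) (j.castLE hk)).seq
    (compare (a .t) (a .u) (a .v) (a .w) (.inl true) (l.castLE hk))),
    fun n => n * 11 + 2 + (n * 11 + 2 + (n * 33 + 20)), ?_, fun w v hv g hg => ?_⟩
  · exact ((PolyBdd.id.mul (.const _)).add (.const _)).add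
      (((PolyBdd.id.mul (.const _)).add (.const _)).add
        ((PolyBdd.id.mul (.const _)).add (.const _)))
  have hg' : ∀ x, g (a x) = [] := fun x => hg x _ le_rfl
  have htu : a .t ≠ a .u := by simp [a]
  have h1 := runs_addTo (w := w) (v := pad D v) (g := g) htu (i.castLE hk)
    (pad_le hv _) (hg' _)
  have h2 := runs_addTo (w := w) (v := pad D v) (g := update g (a .u)
    (List.replicate (pad D v (i.castLE hk)) Sym.tick ++ g (a .u))) htu (j.castLE hk)
    (pad_le hv _) (by rw [update_of_ne htu]; exact hg' _)
  rw [update_idem, update_self, hg', List.append_nil, List.replicate_append_replicate] at h2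
  rw [hg', List.append_nil] at h1
  have h3 := runs_compare (w := w) (v := pad D v) (g := g) (t := a .t) (u := a .u) (x := a .v)
    (y := a .w) (r := .inl true) (i := l.castLE hk)
    (a := pad D v (j.castLE hk) + pad D v (i.castLE hk)) (by simp [a]) (pad_le hv _)
    (hg' _) (hg' _) (hg' _) (hg' _)
  refine ((h1.seq (h2.seq h3)).mono ?_).congr ?_
  · have := pad_le hv (i.castLE hk)
    have := pad_le hv (j.castLE hk)
    dsimp only
    omega
  · simp only [pad_castLE]
    rw [add_comm (v j)]

end PolyDec

end

/-! ### Bounded quantification, counting and reachability -/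

section

open Cmd Function

theorem Decides.snoc {D k : ℕ} {c : Cmd (Reg D) Ab} {P : List Ab → (Fin (k + 1) → ℕ) → Prop}
    {T : ℕ → ℕ} (h : Decides c P T) (hk : k < D) {w : List Ab} {v : Fin k → ℕ}
    (hv : ∀ i, v i ≤ w.length) {x : ℕ} (hx : x ≤ w.length) {g : Aux D → List Ab}
    (hg : ∀ x i, k + 1 ≤ i.1 → g (.inr (x, i)) = []) :
    Runs c (pstk w (update (pad D v) ⟨k, hk⟩ x) g) (pstk w (update (pad D v) ⟨k, hk⟩ x)
      (update g (.inl true) (truth (P w (Fin.snoc v x)) :: g (.inl true)))) (T w.length) := by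
  have := h w (Fin.snoc v x) (fun i => by
    refine Fin.lastCases ?_ (fun i => ?_) i
    · rwa [Fin.snoc_last]
    · rw [Fin.snoc_castSucc]; exact hv i) g hg
  rwa [pad_snoc hk] at this

theorem pad_of_le {D k : ℕ} {v : Fin k → ℕ} {i : Fin D} (h : k ≤ i.1) : pad D v i = 0 :=
  dif_neg (by omega)

namespace PolyDec

variable {k : ℕ}

/-- Pointer `k` runs through all positions, while the top of the truth stack holds the disjunction
over the positions already visited. The program for `P` uses work stacks from index `k + 1` on only.
-/
theorem ex {P : List Ab → (Fin k → ℕ) → ℕ → Prop}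
    (h : PolyDec (k + 1) fun w v => P w (Fin.init v) (v (Fin.last k))) :
    PolyDec k fun w v => ∃ x, x ≤ w.length ∧ P w v x := by
  obtain ⟨D₀, hk, h⟩ := h
  refine ⟨D₀, by omega, fun D hD => ?_⟩
  obtain ⟨c, T, hT, h⟩ := h D hD
  have hkD : k < D := by omega
  refine ⟨(push (.inr (.inl true)) (truth False)).seq (forEach ⟨k, hkD⟩
    (c.seq (cases (.inr (.inl true)) fun o => (pop (.inr (.inl true))).seq
      (if o = some .all then (pop (.inr (.inl true))).seq (push (.inr (.inl true)) (truth True))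
        else skip)))),
    fun n => 1 + ((n + 1) * (T n + 4 + 8) + 2),
    (PolyBdd.const _).add (((PolyBdd.id.add (.const _)).mul
      ((hT.add (.const _)).add (.const _))).add (.const _)), fun w v hv g hg => ?_⟩
  refine (runs_push' _ _).seq ?_
  have := runs_forEach (w := w) (v := pad D v) (i := ⟨k, hkD⟩) (T := T w.length + 4)
    (c := c.seq (cases (.inr (.inl true)) fun o => (pop (.inr (.inl true))).seq
      (if o = some .all then (pop (.inr (.inl true))).seq (push (.inr (.inl true)) (truth True))
        else skip)))
    (fun j => update g (.inl true) (truth (∃ x < j, P w v x) :: g (.inl true)))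
    (pad_of_le le_rfl) (fun j hj => ?_)
  · simpa [Nat.lt_succ_iff] using this
  have h1 := h.snoc hkD hv hj (g := update g (.inl true) (truth (∃ x < j, P w v x) ::
    g (.inl true))) (fun x i hi => by rw [update_of_ne (by simp)]; exact hg x i (by omega))
  rw [update_idem, update_self, Fin.init_snoc, Fin.snoc_last] at h1
  refine h1.seq (runs_cases (T := 1 + (1 + 1)) rfl ((runs_pop _ _ _).seq ?_))
  rw [update_self, List.head?_cons]
  by_cases hP : P w v j
  · rw [if_pos (congrArg some (truth_of hP)), show truth (∃ x < j + 1, P w v x) = truth True from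
      truth_congr (iff_true_intro ⟨j, by omega, hP⟩)]
    exact (runs_pop _ _ _).seq (runs_push _ _ _)
  · rw [if_neg (fun h => hP (truth_eq_all.1 (Option.some.inj h))),
      show truth (∃ x < j + 1, P w v x) = truth (∃ x < j, P w v x) from truth_congr ?_]
    · exact ⟨1, by omega, .skip _⟩
    · constructor
      · rintro ⟨x, hx, hx'⟩
        have : x ≠ j := fun e => hP (e ▸ hx')
        exact ⟨x, by omega, hx'⟩
      · rintro ⟨x, hx, hx'⟩
        exact ⟨x, by omega, hx'⟩

theorem all {P : List Ab → (Fin k → ℕ) → ℕ → Prop}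
    (h : PolyDec (k + 1) fun w v => P w (Fin.init v) (v (Fin.last k))) :
    PolyDec k fun w v => ∀ x, x ≤ w.length → P w v x :=
  (ex (P := fun w v x => ¬ P w v x) h.not).not.congr fun w v _ => by push Not; rfl

-- Successes are counted in unary on a work stack of index `k`, which the program for `P` leaves
-- alone, and the total is then compared with the position of pointer `i`.
open Classical in
theorem count {P : List Ab → (Fin k → ℕ) → ℕ → Prop} (i : Fin k)
    (h : PolyDec (k + 1) fun w v => P w (Fin.init v) (v (Fin.last k))) :
    PolyDec k fun w v => Nat.count (P w v) (w.length + 1) = v i := by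
  obtain ⟨D₀, hk, h⟩ := h
  refine ⟨D₀, by omega, fun D hD => ?_⟩
  obtain ⟨c, T, hT, h⟩ := h D hD
  have hkD : k < D := by omega
  let a : Work → Aux D := fun x => .inr (x, ⟨k, hkD⟩)
  let body := c.seq (cases (.inr (.inl true)) fun o => (pop (.inr (.inl true))).seq
      (if o = some .all then push (.inr (a .u)) .tick else skip))
  refine ⟨(forEach ⟨k, hkD⟩ body).seq
    (compare (a .t) (a .u) (a .v) (a .w) (.inl true) (i.castLE hkD.le)),
    fun n => (n + 1) * (T n + 3 + 8) + 2 + (n * 13 + (n + 1) * 10 + 20),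
    (((PolyBdd.id.add (.const _)).mul ((hT.add (.const _)).add (.const _))).add (.const _)).add
      (((PolyBdd.id.mul (.const _)).add ((PolyBdd.id.add (.const _)).mul (.const _))).add
        (.const _)), fun w v hv g hg => ?_⟩
  have hg' : ∀ x, g (a x) = [] := fun x => hg x _ le_rfl
  have h1 := runs_forEach (w := w) (v := pad D v) (i := ⟨k, hkD⟩) (T := T w.length + 3)
    (c := body)
    (fun j => update g (a .u) (List.replicate (Nat.count (P w v) j) .tick))
    (pad_of_le le_rfl) (fun j hj => ?_)
  · have h2 := runs_compare (w := w) (v := pad D v) (g := g) (t := a .t) (u := a .u) (x := a .v)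
      (y := a .w) (r := .inl true) (i := i.castLE hkD.le)
      (a := Nat.count (P w v) (w.length + 1)) (by simp [a]) (pad_le hv _)
      (hg' _) (hg' _) (hg' _) (hg' _)
    have e : update g (a .u) [] = g := update_eq_self_iff.2 (hg' _).symm
    simp only [Nat.count_zero, List.replicate_zero, e] at h1
    rw [pad_castLE] at h2
    refine (h1.seq h2).mono ?_
    have : Nat.count (P w v) (w.length + 1) ≤ w.length + 1 := Nat.count_le _
    dsimp only
    omega
  have hu : (.inl true : Aux D) ≠ a .u := by simp [a]
  have h3 := h.snoc hkD hv hj (g := update g (a .u) (List.replicate (Nat.count (P w v) j) .tick))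
    (fun x i hi => by
      rw [update_of_ne]
      · exact hg x i (by omega)
      · simp only [a, ne_eq, Sum.inr.injEq, Prod.mk.injEq, not_and]
        rintro - rfl
        simp at hi)
  rw [Fin.init_snoc, Fin.snoc_last] at h3
  refine h3.seq (runs_cases (T := 1 + 1) rfl ((runs_pop _ _ _).seq ?_))
  rw [update_eq_self, update_self, List.head?_cons]
  by_cases hP : P w v j
  · rw [if_pos (congrArg some (truth_of hP)), Nat.count_succ, if_pos hP, List.replicate_succ]
    exact runs_push _ _ _
  · rw [if_neg (fun h => hP (truth_eq_all.1 (Option.some.inj h))), Nat.count_succ, if_neg hP]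
    exact ⟨1, le_rfl, .skip _⟩

end PolyDec

/-! ### Sets of positions stored as strings, and iteration of a successor relation. -/

variable {D : ℕ} {w : List Ab} {v : Fin D → ℕ} {g : Aux D → List Ab}

/-- The characteristic string of a set of positions. -/
noncomputable def bitsOf (n : ℕ) (S : ℕ → Prop) : List Ab :=
  (List.range (n + 1)).map fun j => truth (S j)

theorem length_bitsOf (n : ℕ) (S : ℕ → Prop) : (bitsOf n S).length = n + 1 := by simp [bitsOf]

/-- Store the set of positions decided by `c` as a string. -/
noncomputable def collect (a : Work → Aux D) (y : Fin D) (c : Cmd (Reg D) Ab) : Cmd (Reg D) Ab :=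
  (forEach y (c.seq (cases (.inr (.inl true)) fun
    | none => skip
    | some b => (pop (.inr (.inl true))).seq (push (.inr (a .new)) b)))).seq
  ((clear (.inr (a .bits))).seq (transfer (a .new) (a .bits)))

/-- The new string grows on a stack of its own, because `c` may still consult the old one on `bits`;
hence `c` is required to work for any contents `l` of `new`. The string is built in reverse, and the
final transfer turns it around. -/
theorem runs_collect {i : Fin D} {y : Fin D} {c : Cmd (Reg D) Ab} {T : ℕ} {Q : ℕ → Prop}
    (hv : v y = 0) (hnew : g (.inr (.new, i)) = [])
    (h : ∀ j ≤ w.length, ∀ l, Runs c (pstk w (update v y j) (update g (.inr (.new, i)) l))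
      (pstk w (update v y j) (update (update g (.inr (.new, i)) l) (.inl true)
        (truth (Q j) :: g (.inl true)))) T) :
    Runs (collect (fun x => .inr (x, i)) y c) (pstk w v g)
      (pstk w v (update g (.inr (.bits, i)) (bitsOf w.length Q)))
      ((w.length + 1) * (T + 20) + 4 + (g (.inr (.bits, i))).length * 2) := by
  let a : Work → Aux D := fun x => .inr (x, i)
  have hF : ∀ x, (.inl true : Aux D) ≠ a x := by simp [a]
  have h1 := runs_forEach (w := w) (v := v) (i := y) (T := T + 3)
    (c := c.seq (cases (.inr (.inl true)) fun
      | none => skip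
      | some b => (pop (.inr (.inl true))).seq (push (.inr (a .new)) b)))
    (fun j => update g (a .new) ((List.range j).map fun j => truth (Q j)).reverse)
    hv (fun j hj => by
      refine (h j hj _).seq (runs_cases (T := 2) (o := some (truth (Q j)))
        (by rw [update_self, List.head?_cons]) ?_)
      refine Runs.seq (T := 1) (T' := 1) (runs_pop _ _ _) ?_
      have e : update (update g (a .new) ((List.range j).map fun j => truth (Q j)).reverse)
          (.inl true) (g (.inl true)) =
          update g (a .new) ((List.range j).map fun j => truth (Q j)).reverse := by
        rw [update_eq_self_iff, update_of_ne (hF _)]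
      rw [e, List.range_succ]
      simp only [List.map_append, List.reverse_append, List.map_cons, List.map_nil,
        List.reverse_cons, List.reverse_nil, List.nil_append, List.singleton_append]
      exact runs_push _ _ _)
  have hbn : a .bits ≠ a .new := by simp [a]
  have h2 := runs_clear (w := w) (v := v) (g := update g (a .new) (bitsOf w.length Q).reverse)
    (a .bits)
  have h3 := runs_transfer (w := w) (v := v) (g := update (update g (a .new)
    (bitsOf w.length Q).reverse) (a .bits) []) hbn.symm
  have e : update (update (update (update g (a .new) (bitsOf w.length Q).reverse) (a .bits) [])
      (a .new) []) (a .bits) (bitsOf w.length Q) = update g (a .bits) (bitsOf w.length Q) := by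
    rw [update_comm hbn, update_idem, update_idem,
      show update g (a .new) [] = g from update_eq_self_iff.2 hnew.symm]
  rw [update_of_ne hbn.symm, update_self, update_self, List.reverse_reverse, List.append_nil,
    List.length_reverse, length_bitsOf, e] at h3
  rw [update_of_ne hbn] at h2
  simp only [List.range_zero, List.map_nil, List.reverse_nil,
    show update g (a .new) [] = g from update_eq_self_iff.2 hnew.symm] at h1
  refine (h1.seq (h2.seq h3)).mono ?_
  simp only [a]
  nlinarith

/-- Decide whether the stored set has an element accepted by `c`. -/
noncomputable def probe (a : Work → Aux D) (x : Fin D) (c : Cmd (Reg D) Ab) : Cmd (Reg D) Ab :=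
  (push (.inr (.inl true)) (truth False)).seq <|
  (forEach x (c.seq (cases (.inr (.inl true)) fun o => (pop (.inr (.inl true))).seq <|
    cases (.inr (a .bits)) fun
      | none => skip
      | some b => (pop (.inr (a .bits))).seq <| (push (.inr (a .seen)) b).seq <|
        if o = some .all ∧ b = .all then
          (pop (.inr (.inl true))).seq (push (.inr (.inl true)) (truth True))
        else skip))).seq
  (transfer (a .seen) (a .bits))

/-- The stack `bits` is unrolled onto `seen` in step with the pointer `x`, so that its top always
belongs to the current position. Transferring `seen` back restores the stored set for the next use.
-/
theorem runs_probe {i : Fin D} {x : Fin D} {c : Cmd (Reg D) Ab} {T : ℕ} {S Q : ℕ → Prop}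
    (hv : v x = 0) (hbits : g (.inr (.bits, i)) = bitsOf w.length S)
    (hseen : g (.inr (.seen, i)) = [])
    (h : ∀ j ≤ w.length, ∀ l l' m, Runs c
      (pstk w (update v x j) (update (update (update g (.inr (.bits, i)) l) (.inr (.seen, i)) l')
        (.inl true) m))
      (pstk w (update v x j) (update (update (update g (.inr (.bits, i)) l) (.inr (.seen, i)) l')
        (.inl true) (truth (Q j) :: m))) T) :
    Runs (probe (fun x => .inr (x, i)) x c) (pstk w v g)
      (pstk w v (update g (.inl true) (truth (∃ j ≤ w.length, S j ∧ Q j) :: g (.inl true))))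
      ((w.length + 1) * (T + 20) + 4) := by
  let a : Work → Aux D := fun x => .inr (x, i)
  have hbF : a .bits ≠ (.inl true : Aux D) := by simp [a]
  have hsF : a .seen ≠ (.inl true : Aux D) := by simp [a]
  have hbs : a .bits ≠ a .seen := by simp [a]
  let st : List Ab → List Ab → List Ab → Aux D → List Ab := fun l l' m =>
    update (update (update g (a .bits) l) (a .seen) l') (.inl true) m
  have st0 : ∀ m, st (bitsOf w.length S) [] m = update g (.inl true) m := fun m => by
    have e : update (update g (a .bits) (bitsOf w.length S)) (a .seen) [] = g := by
      rw [show update g (a .bits) (bitsOf w.length S) = g from update_eq_self_iff.2 hbits.symm]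
      exact update_eq_self_iff.2 hseen.symm
    simp only [st, e]
  have hb : ∀ l l' m l₁, update (st l l' m) (a .bits) l₁ = st l₁ l' m := fun l l' m l₁ => by
    simp only [st]
    rw [update_comm hbF.symm, update_comm hbs.symm, update_idem]
  have hs : ∀ l l' m l₁, update (st l l' m) (a .seen) l₁ = st l l₁ m := fun l l' m l₁ => by
    simp only [st]
    rw [update_comm hsF.symm, update_idem]
  have gb : ∀ l l' m, st l l' m (a .bits) = l := fun l l' m => by simp [st, hbF, hbs]
  have gs : ∀ l l' m, st l l' m (a .seen) = l' := fun l l' m => by simp [st, hsF]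
  have gF : ∀ l l' m, st l l' m (.inl true) = m := fun l l' m => by simp [st]
  let B := bitsOf w.length S
  have h1 := runs_forEach (w := w) (v := v) (i := x) (T := T + 7)
    (c := c.seq (cases (.inr (.inl true)) fun o => (pop (.inr (.inl true))).seq <|
      cases (.inr (a .bits)) fun
        | none => skip
        | some b => (pop (.inr (a .bits))).seq <| (push (.inr (a .seen)) b).seq <|
          if o = some .all ∧ b = .all then
            (pop (.inr (.inl true))).seq (push (.inr (.inl true)) (truth True))
          else skip))
    (fun j => st (B.drop j) (B.take j).reverse
      (truth (∃ x < j, S x ∧ Q x) :: g (.inl true)))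
    hv (fun j hj => by
      have hj' : j < B.length := by simp only [B, length_bitsOf]; omega
      have ed : B.drop j = truth (S j) :: B.drop (j + 1) := by
        rw [List.drop_eq_getElem_cons hj']; simp [B, bitsOf]
      have et : (B.take (j + 1)).reverse = truth (S j) :: (B.take j).reverse := by
        rw [List.take_add_one]
        simp only [hj', getElem?_pos]
        simp [B, bitsOf, -List.take_append_getElem]
      refine (h j hj _ _ _).seq (runs_cases (T := 6) (o := some (truth (Q j)))
        (by rw [update_self, List.head?_cons]) ?_)
      refine Runs.seq (T := 1) (T' := 5) (runs_pop _ _ _) ?_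
      refine runs_cases (T := 4) (j := a .bits) (o := some (truth (S j)))
        ((congrArg List.head? (gb _ _ _)).trans (by rw [ed]; rfl)) ?_
      have h2 := runs_pop' (w := w) (v := update v x j) (g := st (B.drop j) (B.take j).reverse
        (truth (∃ x < j, S x ∧ Q x) :: g (.inl true))) (a .bits)
      have h3 := runs_push' (w := w) (v := update v x j) (g := st (B.drop (j + 1))
        (B.take j).reverse (truth (∃ x < j, S x ∧ Q x) :: g (.inl true))) (a .seen) (truth (S j))
      rw [hb, gb, List.tail_drop] at h2
      rw [hs, gs, ← et] at h3
      refine (h2.seq (h3.seq (T' := 2) ?_)).mono (by omega)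
      by_cases hP : S j ∧ Q j
      · rw [if_pos ⟨congrArg some (truth_of hP.2), truth_of hP.1⟩,
          show truth (∃ x < j + 1, S x ∧ Q x) = truth True from
          truth_congr (iff_true_intro ⟨j, by omega, hP⟩)]
        exact (runs_pop _ _ _).seq (runs_push _ _ _)
      · rw [if_neg (fun h => hP ⟨truth_eq_all.1 h.2, truth_eq_all.1 (Option.some.inj h.1)⟩),
          show truth (∃ x < j + 1, S x ∧ Q x) = truth (∃ x < j, S x ∧ Q x) from truth_congr ?_]
        · exact ⟨1, by omega, .skip _⟩
        · constructor
          · rintro ⟨x, hx, hx'⟩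
            have : x ≠ j := fun e => hP (e ▸ hx')
            exact ⟨x, by omega, hx'⟩
          · rintro ⟨x, hx, hx'⟩
            exact ⟨x, by omega, hx'⟩)
  have h0 := runs_push' (w := w) (v := v) (g := g) (.inl true) (truth False)
  have h4 := runs_transfer (w := w) (v := v) (g := st [] B.reverse
    (truth (∃ j ≤ w.length, S j ∧ Q j) :: g (.inl true))) hbs.symm
  rw [gs, hs, gb, hb, List.reverse_reverse, List.append_nil, st0, List.length_reverse,
    length_bitsOf] at h4
  have eB : B.length = w.length + 1 := length_bitsOf _ _
  simp only [Nat.not_lt_zero, false_and, exists_false, List.drop_zero, List.take_zero,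
    List.reverse_nil, st0, B] at h1
  rw [List.drop_of_length_le eB.le, List.take_of_length_le eB.le] at h1
  simp only [Nat.lt_succ_iff] at h1
  refine (h0.seq (h1.seq h4)).mono ?_
  nlinarith

/-- Reachability in at most `m` steps along `R` inside `{0, …, n}`. -/
def reachIter (n : ℕ) (R : ℕ → ℕ → Prop) (a : ℕ) : ℕ → ℕ → Prop
  | 0 => fun y => y = a
  | m + 1 => fun y => ∃ x ≤ n, reachIter n R a m x ∧ (R x y ∨ x = y)

/-- The sets reached within `m` steps increase, stay constant once they repeat, and live in a set of
`n + 1` elements, so `n + 1` rounds reach everything. -/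
theorem reachIter_iff {n : ℕ} {R : ℕ → ℕ → Prop} {a b : ℕ} (ha : a ≤ n) (hb : b ≤ n) :
    reachIter n R a (n + 1) b ↔
      Relation.ReflTransGen (fun x y => x ≤ n ∧ y ≤ n ∧ R x y) a b := by
  classical
  constructor
  · have : ∀ m y, y ≤ n → reachIter n R a m y →
        Relation.ReflTransGen (fun x y => x ≤ n ∧ y ≤ n ∧ R x y) a y := by
      intro m
      induction m with
      | zero => rintro y _ rfl; exact .refl
      | succ m ih =>
        rintro y hy ⟨x, hx, hm, h | rfl⟩
        · exact (ih x hx hm).tail ⟨hx, hy, h⟩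
        · exact ih x hx hm
    exact this _ b hb
  · let F : ℕ → Finset ℕ := fun m => (Finset.range (n + 1)).filter (reachIter n R a m)
    have hF : ∀ m y, y ∈ F m ↔ y ≤ n ∧ reachIter n R a m y := fun m y => by
      simp [F]
    have hmono : ∀ m, F m ⊆ F (m + 1) := fun m y hy => by
      rw [hF] at hy ⊢
      exact ⟨hy.1, y, hy.1, hy.2, .inr rfl⟩
    have hstep : ∀ m, F m = F (m + 1) → F (m + 1) = F (m + 2) := fun m h => by
      refine (hmono _).antisymm fun y hy => ?_
      rw [hF] at hy ⊢
      obtain ⟨hy, x, hx, hm, hxy⟩ := hy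
      have : x ∈ F m := by rw [h, hF]; exact ⟨hx, hm⟩
      exact ⟨hy, x, hx, ((hF _ _).1 this).2, hxy⟩
    -- Until the sets stabilize, each round adds an element to the initial `a`. For `m = n` the
    -- second alternative exceeds the `n + 1` available positions.
    have hcard : ∀ m, F m = F (m + 1) ∨ m + 2 ≤ (F (m + 1)).card := by
      intro m
      have hlt : F m ≠ F (m + 1) → (F m).card < (F (m + 1)).card := fun h =>
        Finset.card_lt_card ((hmono m).ssubset_of_ne h)
      induction m with
      | zero =>
        by_cases h : F 0 = F 1
        · exact .inl h
        · have : 0 < (F 0).card := Finset.card_pos.2 ⟨a, (hF _ _).2 ⟨ha, rfl⟩⟩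
          have := hlt h
          exact .inr (by simp only [zero_add] at *; omega)
      | succ m ih =>
        by_cases h : F (m + 1) = F (m + 2)
        · exact .inl h
        · rcases ih (fun h => Finset.card_lt_card ((hmono m).ssubset_of_ne h)) with h' | h'
          · exact absurd (hstep m h') h
          · have := hlt h
            exact .inr (by simp only [add_assoc, Nat.reduceAdd] at *; omega)
    have hst : F n = F (n + 1) := by
      rcases hcard n with h | h
      · exact h
      · have : (F (n + 1)).card ≤ (Finset.range (n + 1)).card :=
          Finset.card_le_card (Finset.filter_subset _ _)
        rw [Finset.card_range] at this
        omega
    intro h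
    have : b ∈ F (n + 1) := by
      clear hb
      induction h with
      | refl =>
        have : ∀ m, a ∈ F m := fun m => by
          induction m with
          | zero => exact (hF _ _).2 ⟨ha, rfl⟩
          | succ m ih => exact hmono m ih
        exact this _
      | @tail x y _ hxy ih =>
        rw [hstep n hst, hF]
        exact ⟨hxy.2.1, x, hxy.1, ((hF _ _).1 ih).2, .inl hxy.2.2⟩
    exact ((hF _ _).1 this).2

end

section

open Cmd Function

namespace PolyDec

variable {k : ℕ}

theorem eq (i j : Fin k) : PolyDec k fun _ v => v i = v j := by
  -- Addition is the only arithmetic available so far; `x + x = x` expresses that `x` is zero.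
  refine (ex (P := fun _ v x => x + x = x ∧ v i + x = v j) ?_).congr ?_
  · exact (add (Fin.last k) (Fin.last k) (Fin.last k)).and (add i.castSucc (Fin.last k) j.castSucc)
  · intro _ v _
    constructor
    · rintro ⟨x, -, hx, h⟩
      omega
    · intro h
      exact ⟨0, Nat.zero_le _, rfl, h⟩

/-- Breadth-first search with one stored set. Of the three additional pointers, `z` merely counts
`w.length + 1` rounds, `x` runs over the stored set and `y` over the candidates for the next one. -/
theorem reach {R : List Ab → (Fin k → ℕ) → ℕ → ℕ → Prop} (i j : Fin k)
    (h : PolyDec (k + 3) fun w v => R w (Fin.init (Fin.init (Fin.init v)))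
      (v (Fin.last (k + 1)).castSucc) (v (Fin.last (k + 2)))) :
    PolyDec k fun w v =>
      Relation.ReflTransGen (fun x y => x ≤ w.length ∧ y ≤ w.length ∧ R w v x y) (v i) (v j) := by
  obtain ⟨D₁, hk₁, h₁⟩ := eq (Fin.last (k + 2)) (i.castSucc.castSucc.castSucc)
  obtain ⟨D₂, hk₂, h₂⟩ := h.or (eq (Fin.last (k + 1)).castSucc (Fin.last (k + 2)))
  obtain ⟨D₃, hk₃, h₃⟩ := eq (Fin.last (k + 1)).castSucc (j.castSucc.castSucc.castSucc)
  refine ⟨max D₁ (max D₂ D₃), by omega, fun D hD => ?_⟩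
  obtain ⟨c₁, T₁, hT₁, h₁⟩ := h₁ D (by omega)
  obtain ⟨c₂, T₂, hT₂, h₂⟩ := h₂ D (by omega)
  obtain ⟨c₃, T₃, hT₃, h₃⟩ := h₃ D (by omega)
  let z : Fin D := ⟨k, by omega⟩
  let x : Fin D := ⟨k + 1, by omega⟩
  let y : Fin D := ⟨k + 2, by omega⟩
  have hzx : z ≠ x := by simp [z, x]
  have hzy : z ≠ y := by simp [z, y]
  have hxy : x ≠ y := by simp [x, y]
  let a : Work → Aux D := fun x => .inr (x, z)
  -- Store the singleton of the starting point, replace the stored set by its reflexive successor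
  -- set once per position of `z`, then ask whether it contains the target, and clean up.
  refine ⟨(collect a y c₁).seq ((forEach z (collect a y (probe a x c₂))).seq
    ((probe a x c₃).seq (clear (.inr (a .bits))))),
    fun n => ((n + 1) * (T₁ n + 20) + 4 + 0 * 2) + (((n + 1) * ((n + 1) *
      (((n + 1) * (T₂ n + 20) + 4) + 20) + 4 + (n + 1) * 2 + 8) + 2) +
      (((n + 1) * (T₃ n + 20) + 4) + ((n + 1) * 2 + 1))), ?_, fun w v hv g hg => ?_⟩
  · repeat' first
      | assumption | exact PolyBdd.const _ | exact PolyBdd.id | apply PolyBdd.add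
      | apply PolyBdd.mul
  have hz0 : pad D v z = 0 := pad_of_le le_rfl
  have hx0 : pad D v x = 0 := pad_of_le (by simp [x])
  have hy0 : pad D v y = 0 := pad_of_le (by simp [y])
  -- The update of `y` stands inside that of `x` because the search moves `y` in its outer loop and
  -- `x` in its inner one; `hp` reconciles this with the order of the variables.
  let p : ℕ → ℕ → ℕ → Fin D → ℕ := fun m s t => update (update (update (pad D v) z m) y t) x s
  have hp : ∀ m s t, pad D (Fin.snoc (Fin.snoc (Fin.snoc v m : Fin (k + 1) → ℕ) s :
      Fin (k + 2) → ℕ) t : Fin (k + 3) → ℕ) = p m s t := fun m s t => by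
    rw [pad_snoc (k := k + 2) y.2, pad_snoc (k := k + 1) x.2, pad_snoc z.2]
    exact update_comm hxy _ _ _
  have hrun : ∀ {c : Cmd (Reg D) Ab} {P : List Ab → (Fin (k + 3) → ℕ) → Prop} {T : ℕ → ℕ},
      Decides c P T → ∀ m s t, m ≤ w.length → s ≤ w.length → t ≤ w.length →
      ∀ g : Aux D → List Ab, (∀ x i, k + 3 ≤ i.1 → g (.inr (x, i)) = []) →
      Runs c (pstk w (p m s t) g) (pstk w (p m s t) (update g (.inl true)
        (truth (P w (Fin.snoc (Fin.snoc (Fin.snoc v m : Fin (k + 1) → ℕ) s :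
          Fin (k + 2) → ℕ) t : Fin (k + 3) → ℕ)) :: g (.inl true)))) (T w.length) := by
    intro c P T hc m s t hm hs ht g hg
    have := hc w (Fin.snoc (Fin.snoc (Fin.snoc v m : Fin (k + 1) → ℕ) s :
          Fin (k + 2) → ℕ) t : Fin (k + 3) → ℕ) (fun i => by
      refine Fin.lastCases (by rwa [Fin.snoc_last]) (fun i => ?_) i
      rw [Fin.snoc_castSucc]
      refine Fin.lastCases (by rwa [Fin.snoc_last]) (fun i => ?_) i
      rw [Fin.snoc_castSucc]
      refine Fin.lastCases (by rwa [Fin.snoc_last]) (fun i => ?_) i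
      rw [Fin.snoc_castSucc]
      exact hv i) g hg
    rwa [hp] at this
  have hrest : ∀ (g : Aux D → List Ab) (r : Work) (l : List Ab),
      (∀ x i, k + 3 ≤ i.1 → g (.inr (x, i)) = []) →
      ∀ x i, k + 3 ≤ i.1 → update g (a r) l (.inr (x, i)) = [] := by
    intro g r l hg x i hi
    rw [update_of_ne]
    · exact hg x i hi
    · simp only [a, ne_eq, Sum.inr.injEq, Prod.mk.injEq, not_and]
      rintro - rfl
      simp [z] at hi
  have hrest' : ∀ (g : Aux D → List Ab) (l : List Ab),
      (∀ x i, k + 3 ≤ i.1 → g (.inr (x, i)) = []) →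
      ∀ x i, k + 3 ≤ i.1 → update g (.inl true) l (.inr (x, i)) = [] := by
    intro g l hg x i hi
    rw [update_of_ne (by simp)]
    exact hg x i hi
  have hg3 : ∀ x i, k + 3 ≤ i.1 → g (.inr (x, i)) = [] := fun x i hi => hg x i (by omega)
  have hga : ∀ r, g (a r) = [] := fun r => hg r z le_rfl
  have hF : ∀ r, (.inl true : Aux D) ≠ a r := by simp [a]
  let S := reachIter w.length (R w v) (v i)
  -- the set containing just the starting point
  have r1 := runs_collect (w := w) (v := pad D v) (g := g) (i := z) (y := y) (c := c₁)
    (T := T₁ w.length) (Q := S 0) hy0 (hga _) (fun t ht l => by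
      have e : update (pad D v) y t = p 0 0 t := by
        simp only [p]
        rw [show update (pad D v) z 0 = pad D v from update_eq_self_iff.2 hz0.symm]
        exact (update_eq_self_iff.2 (by rw [update_of_ne hxy, hx0])).symm
      have := hrun h₁ 0 0 t (Nat.zero_le _) (Nat.zero_le _) ht (update g (a .new) l)
        (hrest _ _ _ hg3)
      simp only [Fin.snoc_last, Fin.snoc_castSucc, update_of_ne (hF _)] at this
      rw [e]
      exact this)
  rw [show g (.inr (.bits, z)) = [] from hga _, List.length_nil] at r1
  have r2 := runs_forEach (w := w) (v := pad D v) (i := z) (T := (w.length + 1) *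
      (((w.length + 1) * (T₂ w.length + 20) + 4) + 20) + 4 + (w.length + 1) * 2)
    (c := collect a y (probe a x c₂))
    (fun m => update g (a .bits) (bitsOf w.length (S m))) hz0 (fun m hm => by
      have r := runs_collect (w := w) (v := update (pad D v) z m)
        (g := update g (a .bits) (bitsOf w.length (S m))) (i := z) (y := y) (c := probe a x c₂)
        (T := (w.length + 1) * (T₂ w.length + 20) + 4) (Q := S (m + 1))
        (by rw [update_of_ne hzy.symm, hy0])
        (by rw [update_of_ne (by simp [a])]; exact hga _) (fun t ht l => by
          have hG : ∀ x i, k + 3 ≤ i.1 → update (update g (a .bits) (bitsOf w.length (S m)))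
              (.inr (.new, z)) l (.inr (x, i)) = [] := hrest _ .new _ (hrest _ .bits _ hg3)
          have r' := runs_probe (w := w) (v := update (update (pad D v) z m) y t)
            (g := update (update g (a .bits) (bitsOf w.length (S m))) (.inr (.new, z)) l)
            (i := z) (x := x) (c := c₂) (T := T₂ w.length) (S := S m)
            (Q := fun s => R w v s t ∨ s = t)
            (by rw [update_of_ne hxy, update_of_ne hzx.symm, hx0])
            (by rw [update_of_ne (by simp)]; exact update_self _ _ _)
            (by
              rw [update_of_ne (by simp), update_of_ne (by simp [a])]
              exact hga _) (fun s hs l₁ l₂ l₃ => by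
              have := hrun h₂ m s t hm hs ht _ (hrest' _ l₃ (hrest _ .seen l₂
                (hrest _ .bits l₁ hG)))
              simpa only [Fin.snoc_last, Fin.snoc_castSucc, Fin.init_snoc, update_self,
                update_idem] using this)
          have e : (update (update g (a .bits) (bitsOf w.length (S m))) (.inr (.new, z)) l)
              (.inl true) = update g (a .bits) (bitsOf w.length (S m)) (.inl true) :=
            update_of_ne (hF .new) _ _
          rw [e] at r'
          exact r')
      rw [show update g (a .bits) (bitsOf w.length (S m)) (.inr (.bits, z)) =
        bitsOf w.length (S m) from update_self _ _ _, length_bitsOf, update_idem] at r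
      exact r)
  have r3 := runs_probe (w := w) (v := pad D v)
    (g := update g (a .bits) (bitsOf w.length (S (w.length + 1)))) (i := z) (x := x) (c := c₃)
    (T := T₃ w.length) (S := S (w.length + 1)) (Q := fun s => s = v j) hx0
    (update_self _ _ _) (by rw [update_of_ne (by simp [a])]; exact hga _) (fun s hs l₁ l₂ l₃ => by
      have e : update (pad D v) x s = p 0 s 0 := by
        simp only [p]
        rw [show update (pad D v) z 0 = pad D v from update_eq_self_iff.2 hz0.symm,
          show update (pad D v) y 0 = pad D v from update_eq_self_iff.2 hy0.symm]
      have := hrun h₃ 0 s 0 (Nat.zero_le _) hs (Nat.zero_le _) _ (hrest' _ l₃ (hrest _ .seen l₂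
        (hrest _ .bits l₁ (hrest _ .bits (bitsOf w.length (S (w.length + 1))) hg3))))
      rw [e]
      simp only [Fin.snoc_last, Fin.snoc_castSucc, update_self] at this
      exact this.congr (congrArg (pstk w _) (update_idem ..)))
  have e4 : truth (∃ s ≤ w.length, S (w.length + 1) s ∧ s = v j) = truth
      (Relation.ReflTransGen (fun x y => x ≤ w.length ∧ y ≤ w.length ∧ R w v x y) (v i) (v j)) := by
    refine truth_congr (Iff.trans ?_ (reachIter_iff (hv i) (hv j)))
    constructor
    · rintro ⟨s, -, hs, rfl⟩
      exact hs
    · exact fun h => ⟨_, hv j, h, rfl⟩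
  rw [e4, update_of_ne (hF _)] at r3
  have r4 := runs_clear (w := w) (v := pad D v) (g := update (update g (a .bits)
    (bitsOf w.length (S (w.length + 1)))) (.inl true) (truth (Relation.ReflTransGen
      (fun x y => x ≤ w.length ∧ y ≤ w.length ∧ R w v x y) (v i) (v j)) :: g (.inl true)))
    (a .bits)
  rw [update_of_ne (hF _).symm, update_self, length_bitsOf, update_comm (hF _), update_idem,
    show update g (a .bits) [] = g from update_eq_self_iff.2 (hga _).symm] at r4
  exact r1.seq (r2.seq (r3.seq r4))

end PolyDec

/-! ### From predicates to languages -/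

/-- Run a program for each of the indices in a list. -/
def forList {K ι : Type} : List ι → (ι → Cmd K Ab) → Cmd K Ab
  | [], _ => skip
  | i :: l, c => (c i).seq (forList l c)

theorem runs_forList {D : ℕ} {C : Fin D → Cmd (Reg D) Ab} {u u' : List Ab} {g : Aux D → List Ab}
    {τ : ℕ} (hC : ∀ i s, s (.inl (.inr i)) = u → Runs (C i) s (update s (.inl (.inr i)) u') τ) :
    Runs (forList (List.finRange D) C) (pstk u (fun _ => 0) g) (pstk u' (fun _ => 0) g)
      (D * τ + 1) := by
  have key : ∀ l : List (Fin D), l.Nodup → ∀ s : Reg D → List Ab,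
      (∀ i ∈ l, s (.inl (.inr i)) = u) →
      Runs (forList l C) s (fun r => Sum.elim (Sum.elim (fun i => s (.inl (.inl i))) (fun i =>
        if i ∈ l then u' else s (.inl (.inr i)))) (fun j => s (.inr j)) r)
        (l.length * τ + 1) := by
    intro l
    induction l with
    | nil =>
      intro _ s _
      refine (show Runs skip s s _ from ⟨1, by simp, .skip _⟩).congr ?_
      funext r
      rcases r with (r | r) | r <;> simp
    | cons i l ih =>
      intro hl s hs
      rw [List.nodup_cons] at hl
      have h1 := hC i s (hs i (by simp))
      have h2 := ih hl.2 (update s (.inl (.inr i)) u') (fun i' hi' => by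
        rw [update_of_ne]
        · exact hs i' (by simp [hi'])
        · simp only [ne_eq, Sum.inl.injEq, Sum.inr.injEq]
          rintro rfl
          exact hl.1 hi')
      refine ((h1.seq h2).mono (by rw [List.length_cons]; nlinarith)).congr ?_
      funext r
      rcases r with (r | r) | r
      · simp
      · by_cases hr : r = i
        · subst hr
          simp
        · simp [hr]
      · simp
  refine ((key _ (List.nodup_finRange D) _ fun _ _ => by simp [pstk]).mono (by simp)).congr ?_
  funext r
  rcases r with (r | r) | r <;> simp [pstk]

/-- Every pointer needs its own copy of the input. The input is reversed onto the truth stack, and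
popping it from there onto all right-hand stacks at once restores its order. After the decision
these copies are erased, so that only the answer remains. -/
theorem PolyDec.inP {P : List Ab → Prop} (h : PolyDec 0 fun w _ => P w) : InP {w | P w} := by
  obtain ⟨D, -, h⟩ := h
  obtain ⟨c, T, ⟨p, hp⟩, h⟩ := h D le_rfl
  let copy : Cmd (Reg D) Ab := loop (.inr (.inl true)) (cases (.inr (.inl true)) fun
    | none => skip
    | some a => (pop (.inr (.inl true))).seq
      (forList (List.finRange D) fun i => push (.inl (.inr i)) a))
  let reset : Cmd (Reg D) Ab := forList (List.finRange D) fun i => clear (.inl (.inr i))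
  refine inP_of_exec ((transfer (.inl false) (.inl true)).seq (copy.seq (c.seq reset)))
    (.inr (.inl false)) (.inr (.inl true)) (fun a => decide (a = .all))
    -- For input length `n`, reversing costs `4 * n + 1`, copying `n * (D + 4) + 1` and erasing `D *
    -- (2 * n + 1) + 1`; the remaining `p` bounds the decision itself.
    (p + Polynomial.X * Polynomial.C (3 * D + 8) + Polynomial.C (D + 3)) (fun w => ?_)
  have einit : ∀ (j : Aux D) (u : List Ab), update (fun _ => []) (Sum.inr j) u =
      pstk [] (fun _ : Fin D => 0) (update (fun _ => []) j u) := by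
    intro j u
    rw [← update_pstk]
    congr 1
    funext r
    rcases r with (r | r) | r <;> simp [pstk]
  have h1 := runs_transfer (w := []) (v := fun _ : Fin D => 0)
    (g := update (fun _ => []) (.inl false) w) (j := .inl false) (j' := .inl true) (by simp)
  have e1 : update (update (update (fun _ : Aux D => ([] : List Ab)) (.inl false) w) (.inl false) [])
      (.inl true) w.reverse = update (fun _ => []) (.inl true) w.reverse := by
    rw [update_idem]
    congr 1
    exact update_eq_self_iff.2 rfl
  rw [update_self, update_of_ne (by simp), List.append_nil, e1] at h1
  have h2 := Runs.loop_iter (r := .inr (.inl true)) (c := cases (.inr (.inl true)) fun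
    | none => skip
    | some a => (pop (.inr (.inl true))).seq
      (forList (List.finRange D) fun i => push (.inl (.inr i)) a)) (T := 1 + (1 + (D * 1 + 1)))
    w.length (fun j => pstk (w.drop (w.length - j)) (fun _ => 0)
      (update (fun _ => []) (.inl true) (w.reverse.drop j)))
    (fun j hj => by rw [pstk_inr, update_self]; simpa using hj)
    (by rw [pstk_inr, update_self]; simp) (fun j hj => by
      have hj' : w.length - (j + 1) < w.length := by omega
      have ed : w.reverse.drop j = w[w.length - (j + 1)] :: w.reverse.drop (j + 1) := by
        rw [List.drop_eq_getElem_cons (by simpa using hj), List.getElem_reverse]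
        congr 2
        omega
      have ew : w.drop (w.length - (j + 1)) = w[w.length - (j + 1)] :: w.drop (w.length - j) := by
        rw [List.drop_eq_getElem_cons hj', show w.length - (j + 1) + 1 = w.length - j by omega]
      refine runs_cases (o := some w[w.length - (j + 1)]) (by rw [update_self, ed]; rfl) ?_
      rw [ed, ew]
      refine (runs_pop _ _ _).seq (runs_forList fun i s hs => ?_)
      exact ⟨1, le_rfl, by rw [← hs]; exact .push _ _ _⟩)
  simp only [Nat.sub_zero, List.drop_length, List.drop_zero, Nat.sub_self] at h2
  rw [List.drop_of_length_le (by simp)] at h2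
  have e0 : update (fun _ : Aux D => ([] : List Ab)) (.inl true) [] = fun _ => [] :=
    update_eq_self_iff.2 rfl
  have h3 := h w (fun i => i.elim0) (fun i => i.elim0) (fun _ => []) (fun _ _ _ => rfl)
  have ev : pad D (fun i : Fin 0 => (i.elim0 : ℕ)) = fun _ => 0 := by
    funext i; simp [pad]
  rw [ev] at h3
  rw [e0] at h2
  have h4 := runs_forList (D := D) (u := w) (u' := []) (C := fun i => clear (.inl (.inr i)))
    (g := update (fun _ => []) (.inl true) [truth (P w)]) (τ := w.length * 2 + 1)
    (fun i s hs => by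
      have := Runs.loop_iter (r := .inl (.inr i)) (c := pop (.inl (.inr i))) (T := 1) w.length
        (fun j => update s (.inl (.inr i)) (w.drop j))
        (fun j hj => by rw [update_self]; simpa using hj)
        (by rw [update_self]; simp) (fun j hj => by
          have := Exec.pop (Sum.inl (Sum.inr i)) (update s (.inl (.inr i)) (w.drop j))
          rw [update_idem, update_self, List.tail_drop] at this
          exact ⟨1, le_rfl, this⟩)
      simpa [clear, ← hs] using this)
  obtain ⟨t, ht, hex⟩ := h1.seq (h2.seq (h3.seq h4))
  refine ⟨t, ht.trans ?_, truth (P w), ?_, ?_⟩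
  · have := hp w.length
    simp only [Polynomial.eval_add, Polynomial.eval_mul, Polynomial.eval_X, Polynomial.eval_C]
    nlinarith
  · rw [decide_eq_true_iff, truth_eq_all]; rfl
  · rw [einit, einit]
    exact hex

end

/-! ### Predicates on strings decided in polynomial time -/

/-- The part of a string between two positions. -/
def slice (w : List Ab) (a b : ℕ) : List Ab := (w.take b).drop a

section

variable {w : List Ab} {a b c : ℕ}

theorem length_slice (hb : b ≤ w.length) : (slice w a b).length = b - a := by
  simp [slice, Nat.min_eq_left hb]

theorem slice_of_le (h : b ≤ a) : slice w a b = [] := by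
  rw [slice, List.drop_eq_nil_iff, List.length_take]; omega

theorem getElem?_slice (i : ℕ) : (slice w a b)[i]? = if a + i < b then w[a + i]? else none := by
  rw [slice, List.getElem?_drop, List.getElem?_take]

theorem slice_append_slice (hac : a ≤ c) (hcb : c ≤ b) :
    slice w a c ++ slice w c b = slice w a b := by
  unfold slice
  have h : w.take c = (w.take b).take c := by rw [List.take_take, Nat.min_eq_left hcb]
  rw [h]
  conv_rhs => rw [← List.take_append_drop c (w.take b), List.drop_append]
  rw [List.length_take, List.length_take]
  by_cases hb : b ≤ w.length
  · rw [show a - min c (min b w.length) = 0 by omega, List.drop_zero]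
  · rw [show min b w.length = w.length by omega]
    by_cases hc : c ≤ w.length
    · rw [show a - min c w.length = 0 by omega, List.drop_zero]
    · have h2 : (w.take b).drop c = [] := by
        rw [List.drop_eq_nil_iff, List.length_take]; omega
      rw [h2, List.drop_nil]

/-- Splitting a factor of `w` amounts to choosing a cut position in `w`. This turns quantification
over strings into quantification over positions. -/
theorem eq_slice_of_append_eq {u v : List Ab} (hb : b ≤ w.length) (hab : a ≤ b)
    (h : u ++ v = slice w a b) : u = slice w a (a + u.length) ∧ v = slice w (a + u.length) b ∧
      a + u.length ≤ b := by
  have hl : u.length ≤ b - a := by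
    rw [← length_slice hb, ← h, List.length_append]; omega
  have hs := slice_append_slice (w := w) (a := a) (c := a + u.length) (b := b) (by omega) (by omega)
  rw [← h] at hs
  obtain ⟨h1, h2⟩ := List.append_inj hs (by rw [length_slice (by omega)]; omega)
  exact ⟨h1.symm, h2.symm, by omega⟩

-- The induction truncates the factor at `N`, so that the two counts grow by the same amount when
-- `N` passes a position.
open Classical in
theorem countP_slice (p : Ab → Prop)
    [DecidablePred fun y => (a ≤ y ∧ y < b) ∧ ∃ x, p x ∧ w[y]? = some x] (hb : b ≤ w.length) :
    (slice w a b).countP (fun x => decide (p x)) =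
      Nat.count (fun y => (a ≤ y ∧ y < b) ∧ ∃ x, p x ∧ w[y]? = some x) (w.length + 1) := by
  have key : ∀ N, (slice w a (min b N)).countP (fun x => decide (p x)) =
      Nat.count (fun y => (a ≤ y ∧ y < b) ∧ ∃ x, p x ∧ w[y]? = some x) N := by
    intro N
    induction N with
    | zero => rw [slice_of_le (by omega)]; simp
    | succ N ih =>
      rw [Nat.count_succ, ← ih]
      by_cases hN : a ≤ N ∧ N < b
      · have hN' : N < w.length := by omega
        rw [show min b (N + 1) = N + 1 by omega, show min b N = N by omega,
          ← slice_append_slice (c := N) hN.1 (by omega), List.countP_append]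
        have e : slice w N (N + 1) = [w[N]] := by
          refine List.ext_getElem? fun i => ?_
          rw [getElem?_slice]
          rcases i with _ | i
          · simp [hN']
          · rw [if_neg (by omega)]; simp
        rw [e]
        simp [hN, hN']
      · rw [if_neg (fun h => hN h.1), add_zero]
        by_cases h : a ≤ N
        · rw [show min b (N + 1) = min b N by omega]
        · rw [slice_of_le (by omega), slice_of_le (by omega)]
  rw [← key, show min b (w.length + 1) = b by omega]

end

/-! ### Order of positions and equality of factors. -/

namespace PolyDec

variable {k : ℕ}

theorem le (i j : Fin k) : PolyDec k fun _ v => v i ≤ v j := by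
  refine (ex (P := fun _ v x => v i + x = v j) (add i.castSucc (Fin.last k) j.castSucc)).congr ?_
  intro w v hv
  constructor
  · rintro ⟨x, -, h⟩
    omega
  · intro h
    exact ⟨v j - v i, by have := hv j; omega, by omega⟩

theorem lt (i j : Fin k) : PolyDec k fun _ v => v i < v j :=
  (le j i).not.congr fun _ _ _ => not_le

theorem forall_fintype {ι : Type} [Finite ι] {P : ι → List Ab → (Fin k → ℕ) → Prop}
    (h : ∀ i, PolyDec k (P i)) : PolyDec k fun w v => ∀ i, P i w v := by
  classical
  cases nonempty_fintype ι
  have : ∀ s : Finset ι, PolyDec k fun w v => ∀ i ∈ s, P i w v := by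
    intro s
    induction s using Finset.induction_on with
    | empty => exact (const True).congr fun w v _ => by simp
    | insert i s _ ih => exact ((h i).and ih).congr fun w v _ => by simp
  exact (this Finset.univ).congr fun w v _ => by simp

theorem exists_fintype {ι : Type} [Finite ι] {P : ι → List Ab → (Fin k → ℕ) → Prop}
    (h : ∀ i, PolyDec k (P i)) : PolyDec k fun w v => ∃ i, P i w v :=
  (forall_fintype fun i => (h i).not).not.congr fun w v _ => by push Not; rfl

theorem symEq (i j : Fin k) : PolyDec k fun w v => w[v i]? = w[v j]? := by
  refine (forall_fintype fun a : Ab => ((sym i a).imp (sym j a)).and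
    ((sym j a).imp (sym i a))).congr fun w v _ => ?_
  constructor
  · intro h
    refine Option.ext fun a => ⟨fun h' => (h a).1 h', fun h' => (h a).2 h'⟩
  · intro h a
    rw [h]
    exact ⟨id, id⟩

theorem sliceEq (i i' j j' : Fin k) :
    PolyDec k fun w v => slice w (v i) (v i') = slice w (v j) (v j') := by
  -- `d` is an offset, `p` and `q` are the corresponding positions
  refine (all (P := fun w v d => ∀ p, p ≤ w.length → ∀ q, q ≤ w.length → v i + d = p →
    v j + d = q → (p < v i' → q < v j' ∧ w[p]? = w[q]?) ∧ (q < v j' → p < v i')) ?_).congr ?_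
  · refine all (P := fun w v p => ∀ q, q ≤ w.length → Fin.init v i + v (Fin.last k) = p →
      Fin.init v j + v (Fin.last k) = q → (p < Fin.init v i' → q < Fin.init v j' ∧ w[p]? = w[q]?) ∧
      (q < Fin.init v j' → p < Fin.init v i')) ?_
    refine all (P := fun w v q => Fin.init (Fin.init v) i + Fin.init v (Fin.last k) =
      v (Fin.last (k + 1)) → Fin.init (Fin.init v) j + Fin.init v (Fin.last k) = q →
      (v (Fin.last (k + 1)) < Fin.init (Fin.init v) i' → q < Fin.init (Fin.init v) j' ∧
        w[v (Fin.last (k + 1))]? = w[q]?) ∧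
      (q < Fin.init (Fin.init v) j' → v (Fin.last (k + 1)) < Fin.init (Fin.init v) i')) ?_
    exact (add _ _ _).imp ((add _ _ _).imp (((lt _ _).imp ((lt _ _).and (symEq _ _))).and
      ((lt _ _).imp (lt _ _))))
  · intro w v hv
    have hi' := hv i'
    have hj' := hv j'
    constructor
    · intro h
      refine List.ext_getElem? fun d => ?_
      rw [getElem?_slice, getElem?_slice]
      by_cases h1 : v i + d < v i'
      · by_cases hd : v j + d ≤ w.length
        · have := (h d (by omega) _ (by omega) _ hd rfl rfl).1 h1
          rw [if_pos h1, if_pos this.1, this.2]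
        -- Here `v j + d` lies beyond the string, so the hypothesis does not cover the offset `d`.
        -- The smaller offset at which the second factor would reach the end of the string already
        -- gives a contradiction.
        · have hj := hv j
          have := ((h (w.length - v j) (by omega) (v i + (w.length - v j)) (by omega) w.length le_rfl
            rfl (by omega)).1 (by omega)).1
          omega
      · by_cases h2 : v j + d < v j'
        · exfalso
          by_cases hd : v i + d ≤ w.length
          · exact h1 ((h d (by omega) _ hd _ (by omega) rfl rfl).2 h2)
          · have hi := hv i
            have := (h (w.length - v i) (by omega) w.length le_rfl (v j + (w.length - v i)) (by omega)
              (by omega) rfl).2 (by omega)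
            omega
        · rw [if_neg h1, if_neg h2]
    · rintro h d - p hp q hq rfl rfl
      have e := congrArg (fun l => l[d]?) h
      simp only [getElem?_slice] at e
      constructor
      · intro h1
        rw [if_pos h1, List.getElem?_eq_getElem (show v i + d < w.length by omega)] at e
        split_ifs at e with h2
        exact ⟨h2, by rw [← e]; exact List.getElem?_eq_getElem _⟩
      · intro h2
        rw [if_pos h2, List.getElem?_eq_getElem (show v j + d < w.length by omega)] at e
        split_ifs at e with h1
        exact h1

end PolyDec

/-- Predicates on tuples of strings such that it can be decided in polynomial time whether given
factors of a given string satisfy them. -/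
def Dec (k : ℕ) (P : (Fin k → List Ab) → Prop) : Prop :=
  ∀ (m : ℕ) (f g : Fin k → Fin m), PolyDec m fun w v => P fun i => slice w (v (f i)) (v (g i))

namespace Dec

variable {k : ℕ} {P Q : (Fin k → List Ab) → Prop}

theorem congr (h : Dec k P) (e : ∀ x, P x ↔ Q x) : Dec k Q :=
  fun m f g => (h m f g).congr fun _ _ _ => e _

theorem not (h : Dec k P) : Dec k fun x => ¬ P x := fun m f g => (h m f g).not

theorem and (h : Dec k P) (h' : Dec k Q) : Dec k fun x => P x ∧ Q x :=
  fun m f g => (h m f g).and (h' m f g)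

theorem or (h : Dec k P) (h' : Dec k Q) : Dec k fun x => P x ∨ Q x :=
  fun m f g => (h m f g).or (h' m f g)

theorem imp (h : Dec k P) (h' : Dec k Q) : Dec k fun x => P x → Q x :=
  fun m f g => (h m f g).imp (h' m f g)

theorem const (p : Prop) : Dec k fun _ => p := fun _ _ _ => .const p

theorem forall_fintype {ι : Type} [Finite ι] {P : ι → (Fin k → List Ab) → Prop}
    (h : ∀ i, Dec k (P i)) : Dec k fun x => ∀ i, P i x :=
  fun m f g => .forall_fintype fun i => h i m f g

theorem exists_fintype {ι : Type} [Finite ι] {P : ι → (Fin k → List Ab) → Prop}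
    (h : ∀ i, Dec k (P i)) : Dec k fun x => ∃ i, P i x :=
  fun m f g => .exists_fintype fun i => h i m f g

theorem eq (i j : Fin k) : Dec k fun x => x i = x j := fun _ _ _ => .sliceEq _ _ _ _

/-- Quantification over the ways to split a string into two parts. -/
theorem split {P : (Fin k → List Ab) → List Ab → List Ab → Prop} (i : Fin k)
    (h : Dec (k + 2) fun x => P (Fin.init (Fin.init x)) (x (Fin.last k).castSucc)
      (x (Fin.last (k + 1)))) :
    Dec k fun x => ∃ u v, u ++ v = x i ∧ P x u v := by
  intro m f g
  have h1 := h (m + 1)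
    (Fin.snoc (Fin.snoc (fun j => (f j).castSucc) (f i).castSucc : Fin (k + 1) → Fin (m + 1))
      (Fin.last m) : Fin (k + 2) → Fin (m + 1))
    (Fin.snoc (Fin.snoc (fun j => (g j).castSucc) (Fin.last m) : Fin (k + 1) → Fin (m + 1))
      (g i).castSucc : Fin (k + 2) → Fin (m + 1))
  -- A factor whose end precedes its start is empty but admits no cut position in between. Its only
  -- splitting is into two empty strings, both represented by the same bounds.
  have h2 := h m (Fin.snoc (Fin.snoc f (f i) : Fin (k + 1) → Fin m) (f i) : Fin (k + 2) → Fin m)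
    (Fin.snoc (Fin.snoc g (g i) : Fin (k + 1) → Fin m) (g i) : Fin (k + 2) → Fin m)
  have h3 := PolyDec.ex (P := fun w v c => (v (f i) ≤ c ∧ c ≤ v (g i)) ∧
    P (fun j => slice w (v (f j)) (v (g j))) (slice w (v (f i)) c) (slice w c (v (g i))))
    (((PolyDec.le (f i).castSucc (Fin.last m)).and (PolyDec.le (Fin.last m) (g i).castSucc)).and
      (h1.congr fun w v _ => by
        unfold Fin.init
        simp only [Fin.snoc_castSucc, Fin.snoc_last]))
  refine (h3.or ((PolyDec.lt (g i) (f i)).and h2)).congr fun w v hv => ?_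
  unfold Fin.init
  simp only [Fin.snoc_castSucc, Fin.snoc_last]
  constructor
  · rintro (⟨c, _, ⟨hc, hc'⟩, hP⟩ | ⟨hlt, hP⟩)
    · exact ⟨_, _, slice_append_slice hc hc', hP⟩
    · rw [slice_of_le hlt.le] at hP ⊢
      exact ⟨[], [], rfl, hP⟩
  · rintro ⟨u, t, hut, hP⟩
    by_cases hle : v (f i) ≤ v (g i)
    · obtain ⟨h1, h2, h3⟩ := eq_slice_of_append_eq (hv _) hle hut
      have := hv (g i)
      refine Or.inl ⟨_, by omega, ⟨by omega, h3⟩, ?_⟩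
      rwa [← h1, ← h2]
    · rw [slice_of_le (by omega), List.append_eq_nil_iff] at hut
      refine Or.inr ⟨by omega, ?_⟩
      rw [slice_of_le (by omega)]
      rwa [hut.1, hut.2] at hP

/-- Universal quantification over the ways to split a string into two parts. -/
theorem forall_split {P : (Fin k → List Ab) → List Ab → List Ab → Prop} (i : Fin k)
    (h : Dec (k + 2) fun x => P (Fin.init (Fin.init x)) (x (Fin.last k).castSucc)
      (x (Fin.last (k + 1)))) :
    Dec k fun x => ∀ u v, u ++ v = x i → P x u v :=
  (split (P := fun x u v => ¬ P x u v) i h.not).not.congr fun x => by push Not; rfl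

-- Numbers are compared through a position `c` equal to the length of the `j`-th factor. For bounds
-- in the wrong order this length is zero, expressed by `c + c = c`. The case `i = j` of this lemma
-- gives emptiness and universal conditions on symbols.
open Classical in
theorem countP_eq (p : Ab → Prop) (i j : Fin k) :
    Dec k fun x => (x i).countP (fun a => decide (p a)) = (x j).length := by
  intro m f g
  have h := PolyDec.ex (k := m) (P := fun w v c => ((v (f j) ≤ v (g j) ∧ v (f j) + c = v (g j)) ∨
      (v (g j) < v (f j) ∧ c + c = c)) ∧
      @Nat.count (fun y => (v (f i) ≤ y ∧ y < v (g i)) ∧ ∃ x, p x ∧ w[y]? = some x)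
        (fun _ => propDecidable _) (w.length + 1) = c)
    ((((PolyDec.le (f j).castSucc (g j).castSucc).and (.add (f j).castSucc (Fin.last m)
      (g j).castSucc)).or ((PolyDec.lt (g j).castSucc (f j).castSucc).and
        (.add (Fin.last m) (Fin.last m) (Fin.last m)))).and
      (PolyDec.count (P := fun w v y => (Fin.init v (f i) ≤ y ∧ y < Fin.init v (g i)) ∧
        ∃ x, p x ∧ w[y]? = some x) (Fin.last m)
        (((PolyDec.le (f i).castSucc.castSucc (Fin.last (m + 1))).and
          (PolyDec.lt (Fin.last (m + 1)) (g i).castSucc.castSucc)).and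
          (PolyDec.exists_fintype fun a : Ab => (PolyDec.const (p a)).and (.sym _ a)))))
  refine h.congr fun w v hv => ?_
  have e := @countP_slice w (v (f i)) (v (g i)) p (fun _ => propDecidable _) (hv _)
  dsimp only
  rw [length_slice (hv _), e]
  constructor
  · rintro ⟨c, hc, hc', h⟩
    rw [h]
    omega
  · intro h
    have := hv (g j)
    exact ⟨_, by omega, by omega, h⟩

open Classical in
theorem length_eq (i j : Fin k) : Dec k fun x => (x i).length = (x j).length :=
  (countP_eq (fun _ => True) i j).congr fun x => by simp

theorem eq_nil (i : Fin k) : Dec k fun x => x i = [] := by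
  classical
  exact (countP_eq (fun _ => False) i i).congr fun x => by
    simp [eq_comm (a := 0)]

theorem forall_mem (p : Ab → Prop) (i : Fin k) : Dec k fun x => ∀ a ∈ x i, p a := by
  classical
  exact (countP_eq p i i).congr fun x => by
    rw [List.countP_eq_length]; simp

/-- Strings of length one. -/
theorem eq_singleton (i : Fin k) (a : Ab) : Dec k fun x => x i = [a] := by
  refine (((forall_split (P := fun _ u v => u = [] ∨ v = []) i ((eq_nil _).or (eq_nil _))).and
    (eq_nil i).not).and (forall_mem (· = a) i)).congr fun x => ?_
  constructor
  · rintro ⟨⟨h1, h2⟩, h3⟩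
    obtain ⟨b, l, hl⟩ := List.exists_cons_of_ne_nil h2
    have h4 := h1 [b] l (by rw [hl]; rfl)
    have h5 := h3 b (by rw [hl]; simp)
    simp only [List.cons_ne_self, false_or] at h4
    simp_all
  · intro h
    rw [h]
    refine ⟨⟨fun u v huv => ?_, by simp⟩, by simp⟩
    rcases u with _ | ⟨b, u⟩
    · simp
    · simp_all

/-- Reachability along a decidable relation between prefixes of a string. -/
theorem reach {R : (Fin k → List Ab) → List Ab → List Ab → Prop} (t i j : Fin k)
    (h : Dec (k + 2) fun x => R (Fin.init (Fin.init x)) (x (Fin.last k).castSucc)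
      (x (Fin.last (k + 1)))) :
    Dec k fun x => x i <+: x t ∧ x j <+: x t ∧
      Relation.ReflTransGen (fun u v => u <+: x t ∧ v <+: x t ∧ R x u v) (x i) (x j) := by
  intro m f g
  -- Five positions are added: the ends `c` and `d` of the two given prefixes, the round counter of
  -- `PolyDec.reach`, and the ends of the source and the target of a step, in this order.
  have h1 := h (m + 5)
    (Fin.snoc (Fin.snoc (fun j => (f j).castSucc.castSucc.castSucc.castSucc.castSucc)
      (f t).castSucc.castSucc.castSucc.castSucc.castSucc : Fin (k + 1) → Fin (m + 5))
      (f t).castSucc.castSucc.castSucc.castSucc.castSucc : Fin (k + 2) → Fin (m + 5))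
    (Fin.snoc (Fin.snoc (fun j => (g j).castSucc.castSucc.castSucc.castSucc.castSucc)
      (Fin.last (m + 3)).castSucc : Fin (k + 1) → Fin (m + 5))
      (Fin.last (m + 4)) : Fin (k + 2) → Fin (m + 5))
  have h2 := PolyDec.ex (k := m) (P := fun w v c => ∃ d, d ≤ w.length ∧
      (((v (f t) ≤ c ∧ c ≤ v (g t)) ∧ (v (f t) ≤ d ∧ d ≤ v (g t))) ∧
      (slice w (v (f t)) c = slice w (v (f i)) (v (g i)) ∧
      slice w (v (f t)) d = slice w (v (f j)) (v (g j)))) ∧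
      Relation.ReflTransGen (fun x y => x ≤ w.length ∧ y ≤ w.length ∧
        ((v (f t) ≤ x ∧ x ≤ v (g t)) ∧ (v (f t) ≤ y ∧ y ≤ v (g t))) ∧
        R (fun j => slice w (v (f j)) (v (g j))) (slice w (v (f t)) x) (slice w (v (f t)) y)) c d)
    (PolyDec.ex (P := fun w v d => (((Fin.init v (f t) ≤ v (Fin.last m) ∧
      v (Fin.last m) ≤ Fin.init v (g t)) ∧ (Fin.init v (f t) ≤ d ∧ d ≤ Fin.init v (g t))) ∧
      (slice w (Fin.init v (f t)) (v (Fin.last m)) = slice w (Fin.init v (f i)) (Fin.init v (g i)) ∧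
      slice w (Fin.init v (f t)) d = slice w (Fin.init v (f j)) (Fin.init v (g j)))) ∧
      Relation.ReflTransGen (fun x y => x ≤ w.length ∧ y ≤ w.length ∧
        ((Fin.init v (f t) ≤ x ∧ x ≤ Fin.init v (g t)) ∧
          (Fin.init v (f t) ≤ y ∧ y ≤ Fin.init v (g t))) ∧
        R (fun j => slice w (Fin.init v (f j)) (Fin.init v (g j)))
          (slice w (Fin.init v (f t)) x) (slice w (Fin.init v (f t)) y)) (v (Fin.last m)) d)
      (((((PolyDec.le _ _).and (.le _ _)).and ((PolyDec.le _ _).and (.le _ _))).and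
        ((PolyDec.sliceEq _ _ _ _).and (.sliceEq _ _ _ _))).and
        (PolyDec.reach (R := fun w v x y =>
          ((Fin.init (Fin.init v) (f t) ≤ x ∧ x ≤ Fin.init (Fin.init v) (g t)) ∧
          (Fin.init (Fin.init v) (f t) ≤ y ∧ y ≤ Fin.init (Fin.init v) (g t))) ∧
          R (fun j => slice w (Fin.init (Fin.init v) (f j)) (Fin.init (Fin.init v) (g j)))
            (slice w (Fin.init (Fin.init v) (f t)) x) (slice w (Fin.init (Fin.init v) (f t)) y))
          (Fin.last m).castSucc (Fin.last (m + 1))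
          ((((PolyDec.le (f t).castSucc.castSucc.castSucc.castSucc.castSucc
              (Fin.last (m + 3)).castSucc).and (.le (Fin.last (m + 3)).castSucc
                (g t).castSucc.castSucc.castSucc.castSucc.castSucc)).and
            ((PolyDec.le (f t).castSucc.castSucc.castSucc.castSucc.castSucc
              (Fin.last (m + 4))).and (.le (Fin.last (m + 4))
                (g t).castSucc.castSucc.castSucc.castSucc.castSucc))).and
            (h1.congr fun w v _ => by
              unfold Fin.init
              simp only [Fin.snoc_castSucc, Fin.snoc_last])))))
  -- The second disjunct treats a factor `t` with its bounds in the wrong order: it is empty, and so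
  -- are all its prefixes.
  refine (h2.or ((PolyDec.lt (g t) (f t)).and (((PolyDec.sliceEq (f i) (g i) (f t) (g t))).and
    (.sliceEq (f j) (g j) (f t) (g t))))).congr fun w v hv => ?_
  dsimp only
  set p := v (f t)
  set q := v (g t) with hq
  have hqn : q ≤ w.length := hv _
  by_cases hpq : p ≤ q
  swap
  · have e : slice w p q = [] := slice_of_le (by omega)
    rw [e]
    simp only [List.prefix_nil]
    constructor
    · rintro (⟨c, -, d, -, h, -⟩ | ⟨-, h, h'⟩)
      · omega
      · exact ⟨h, h', by rw [h, h']⟩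
    · rintro ⟨h, h', -⟩
      exact .inr ⟨by omega, h, h'⟩
  have hpre : ∀ u, u <+: slice w p q → u = slice w p (p + u.length) ∧ p + u.length ≤ q := by
    rintro u ⟨u', hu⟩
    have := eq_slice_of_append_eq hqn hpq hu
    exact ⟨this.1, this.2.2⟩
  have hpre' : ∀ c, p ≤ c → c ≤ q → slice w p c <+: slice w p q := fun c hc hc' =>
    ⟨_, slice_append_slice hc hc'⟩
  constructor
  · rintro (⟨c, -, d, -, ⟨⟨hc, hd⟩, hci, hdj⟩, hreach⟩ | ⟨h, -⟩)
    swap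
    · omega
    rw [← hci, ← hdj]
    refine ⟨hpre' _ hc.1 hc.2, hpre' _ hd.1 hd.2, ?_⟩
    refine hreach.lift (fun c => slice w p c) ?_
    rintro x y ⟨-, -, ⟨hx, hy⟩, hR⟩
    exact ⟨hpre' _ hx.1 hx.2, hpre' _ hy.1 hy.2, hR⟩
  · rintro ⟨hi, hj, hreach⟩
    obtain ⟨hi1, hi2⟩ := hpre _ hi
    obtain ⟨hj1, hj2⟩ := hpre _ hj
    refine .inl ⟨_, by omega, _, by omega, ⟨⟨⟨by omega, hi2⟩, ⟨by omega, hj2⟩⟩, hi1.symm,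
      hj1.symm⟩, ?_⟩
    refine hreach.lift (fun u => p + u.length) ?_
    rintro x y ⟨hx, hy, hR⟩
    obtain ⟨hx1, hx2⟩ := hpre _ hx
    obtain ⟨hy1, hy2⟩ := hpre _ hy
    refine ⟨(show p + x.length ≤ w.length by omega), (show p + y.length ≤ w.length by omega),
      ⟨⟨Nat.le_add_right _ _, hx2⟩, ⟨Nat.le_add_right _ _, hy2⟩⟩, ?_⟩
    rwa [← hx1, ← hy1]

theorem inP {P : List Ab → Prop} (h : Dec 1 fun x => P (x 0)) : InP {w | P w} := by
  refine PolyDec.inP ?_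
  have h1 := h 2 ![0] ![1]
  -- The whole input is the factor between the position `a` with `a + a = a` and the largest
  -- position `b`.
  have h2 := PolyDec.ex (k := 0) (P := fun w v a => ∃ b, b ≤ w.length ∧
    ((a + a = a ∧ ∀ c, c ≤ w.length → c ≤ b) ∧ P (slice w a b)))
    (PolyDec.ex (P := fun w v b => (v (Fin.last 0) + v (Fin.last 0) = v (Fin.last 0) ∧
      ∀ c, c ≤ w.length → c ≤ b) ∧ P (slice w (v (Fin.last 0)) b))
      (((PolyDec.add _ _ _).and (PolyDec.all (P := fun w v c => c ≤ v (Fin.last 1))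
        (.le (Fin.last 2) (Fin.last 1).castSucc))).and h1))
  refine h2.congr fun w v _ => ?_
  have e : slice w 0 w.length = w := by simp [slice]
  constructor
  · rintro ⟨a, -, b, hb, ⟨ha, hb'⟩, hP⟩
    have ha : a = 0 := by omega
    have hb : b = w.length := le_antisymm hb (hb' _ le_rfl)
    rwa [ha, hb, e] at hP
  · intro hP
    exact ⟨0, Nat.zero_le _, w.length, le_rfl, ⟨rfl, fun _ => id⟩, by rwa [e]⟩

end Dec

namespace Dec

variable {k : ℕ} {P : (Fin k → List Ab) → Prop}

theorem comp (h : Dec k P) {l : ℕ} (σ : Fin k → Fin l) : Dec l fun x => P fun i => x (σ i) :=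
  fun m f g => h m (fun i => f (σ i)) (fun i => g (σ i))

/-- Quantification over the ways to split a string into three parts. -/
theorem split₃ {P : (Fin k → List Ab) → List Ab → List Ab → List Ab → Prop} (i : Fin k)
    (h : Dec (k + 3) fun x => P (Fin.init (Fin.init (Fin.init x))) (x (Fin.last k).castSucc.castSucc)
      (x (Fin.last (k + 1)).castSucc) (x (Fin.last (k + 2)))) :
    Dec k fun x => ∃ u m v, u ++ (m ++ v) = x i ∧ P x u m v := by
  refine (split (P := fun x u r => ∃ m v, m ++ v = r ∧ P x u m v) i ?_).congr fun x => ?_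
  · refine split (P := fun y m v => P (Fin.init (Fin.init y)) (y (Fin.last k).castSucc) m v)
      (Fin.last (k + 1)) ?_
    refine (h.comp (Fin.snoc (Fin.snoc (fun j => j.castSucc.castSucc.castSucc)
      (Fin.last (k + 2)).castSucc : Fin (k + 2) → Fin (k + 4)) (Fin.last (k + 3)) :
      Fin (k + 3) → Fin (k + 4))).congr fun x => ?_
    unfold Fin.init
    simp only [Fin.snoc_castSucc, Fin.snoc_last]
  · constructor
    · rintro ⟨u, r, hr, m, v, rfl, h⟩
      exact ⟨u, m, v, hr, h⟩
    · rintro ⟨u, m, v, hr, h⟩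
      exact ⟨u, _, hr, m, v, rfl, h⟩

/-- Removing a first symbol. -/
theorem cons {P : (Fin k → List Ab) → List Ab → Prop} (a : Ab) (i : Fin k)
    (h : Dec (k + 1) fun x => P (Fin.init x) (x (Fin.last k))) :
    Dec k fun x => ∃ t, a :: t = x i ∧ P x t := by
  refine (split (P := fun x u t => u = [a] ∧ P x t) i ((eq_singleton _ a).and ?_)).congr
    fun x => ?_
  · refine (h.comp (Fin.snoc (fun j => j.castSucc.castSucc) (Fin.last (k + 1)) :
      Fin (k + 1) → Fin (k + 2))).congr fun x => ?_
    unfold Fin.init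
    simp only [Fin.snoc_castSucc, Fin.snoc_last]
  · constructor
    · rintro ⟨u, t, ht, rfl, h⟩
      exact ⟨t, ht, h⟩
    · rintro ⟨t, ht, h⟩
      exact ⟨[a], t, ht, rfl, h⟩

end Dec

/-! ### Strings composed of marked blocks -/

/-- The string is empty or starts with a marker. -/
def Bound (p : Ab → Bool) (s : List Ab) : Prop := ∀ a ∈ s.head?, p a = true

/-- A marker followed by symbols that are not markers. -/
def IsBlock (p : Ab → Bool) (b : List Ab) : Prop :=
  ∃ a t, a :: t = b ∧ p a = true ∧ ∀ c ∈ t, p c = false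

/-- The string `s` continues with the block `b` after its part `u`. -/
def BlockAt (p : Ab → Bool) (s u b : List Ab) : Prop :=
  ∃ v, u ++ (b ++ v) = s ∧ IsBlock p b ∧ Bound p v

section Blocks

variable {p : Ab → Bool}

theorem bound_nil : Bound p [] := by simp [Bound]

theorem IsBlock.bound_append {b : List Ab} (h : IsBlock p b) (s : List Ab) : Bound p (b ++ s) := by
  obtain ⟨a, t, rfl, ha, -⟩ := h
  simpa [Bound] using ha

theorem bound_flatten {l : List (List Ab)} (h : ∀ b ∈ l, IsBlock p b) : Bound p l.flatten := by
  cases l with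
  | nil => exact bound_nil
  | cons b l => exact (h b (by simp)).bound_append _

/-- The first marker, or the end of the string if there is none, determines the cut. -/
theorem unmarked_append_inj {t t' r r' : List Ab} (ht : ∀ c ∈ t, p c = false)
    (ht' : ∀ c ∈ t', p c = false) (hr : Bound p r) (hr' : Bound p r') (h : t ++ r = t' ++ r') :
    t = t' ∧ r = r' := by
  induction t generalizing t' with
  | nil =>
    cases t' with
    | nil => exact ⟨rfl, h⟩
    | cons a t' =>
      have h1 : p a = true := hr a (by rw [← List.nil_append r, h]; simp)
      rw [ht' a (by simp)] at h1
      cases h1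
  | cons a t ih =>
    cases t' with
    | nil =>
      have h1 : p a = true := hr' a (by rw [← List.nil_append r', ← h]; simp)
      rw [ht a (by simp)] at h1
      cases h1
    | cons a' t' =>
      simp only [List.cons_append, List.cons.injEq] at h
      obtain ⟨h1, h2⟩ := ih (fun c hc => ht c (by simp [hc])) (fun c hc => ht' c (by simp [hc])) h.2
      exact ⟨by rw [h.1, h1], h2⟩

theorem IsBlock.append_inj {b b' r r' : List Ab} (hb : IsBlock p b) (hb' : IsBlock p b')
    (hr : Bound p r) (hr' : Bound p r') (h : b ++ r = b' ++ r') : b = b' ∧ r = r' := by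
  obtain ⟨a, t, rfl, -, ht⟩ := hb
  obtain ⟨a', t', rfl, -, ht'⟩ := hb'
  simp only [List.cons_append, List.cons.injEq] at h
  obtain ⟨h1, h2⟩ := unmarked_append_inj ht ht' hr hr' h.2
  exact ⟨by rw [h.1, h1], h2⟩

/-- Parsing is unique: every block starts at a marker and extends to just before the next one. -/
theorem flatten_blocks_inj {l l' : List (List Ab)} (hl : ∀ b ∈ l, IsBlock p b)
    (hl' : ∀ b ∈ l', IsBlock p b) (h : l.flatten = l'.flatten) : l = l' := by
  induction l generalizing l' with
  | nil =>
    cases l' with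
    | nil => rfl
    | cons b l' =>
      obtain ⟨a, t, rfl, -, -⟩ := hl' b (by simp)
      simp at h
  | cons b l ih =>
    cases l' with
    | nil =>
      obtain ⟨a, t, rfl, -, -⟩ := hl b (by simp)
      simp at h
    | cons b' l' =>
      simp only [List.flatten_cons] at h
      obtain ⟨h1, h2⟩ := (hl b (by simp)).append_inj (hl' b' (by simp))
        (bound_flatten fun c hc => hl c (by simp [hc]))
        (bound_flatten fun c hc => hl' c (by simp [hc])) h
      rw [h1, ih (fun c hc => hl c (by simp [hc])) (fun c hc => hl' c (by simp [hc])) h2]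

theorem exists_unmarked_append_flatten (p : Ab → Bool) (s : List Ab) : ∃ (t : List Ab) (l : List (List Ab)),
    (∀ c ∈ t, p c = false) ∧ (∀ b ∈ l, IsBlock p b) ∧ s = t ++ l.flatten := by
  induction s with
  | nil => exact ⟨[], [], by simp⟩
  | cons a s ih =>
    obtain ⟨t, l, ht, hl, rfl⟩ := ih
    by_cases ha : p a = true
    · refine ⟨[], (a :: t) :: l, by simp, ?_, by simp⟩
      intro b hb
      rcases List.mem_cons.1 hb with rfl | hb
      · exact ⟨a, t, rfl, ha, ht⟩
      · exact hl b hb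
    · refine ⟨a :: t, l, ?_, hl, by simp⟩
      intro c hc
      rcases List.mem_cons.1 hc with rfl | hc
      · simpa using ha
      · exact ht c hc

theorem Bound.exists_flatten {s : List Ab} (h : Bound p s) :
    ∃ l : List (List Ab), (∀ b ∈ l, IsBlock p b) ∧ s = l.flatten := by
  obtain ⟨t, l, ht, hl, hs⟩ := exists_unmarked_append_flatten p s
  refine ⟨l, hl, ?_⟩
  obtain ⟨rfl, -⟩ := unmarked_append_inj (t := []) (r := s) (by simp) ht h (bound_flatten hl) hs
  exact hs

theorem countP_flatten_blocks {l : List (List Ab)} (h : ∀ b ∈ l, IsBlock p b) :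
    l.flatten.countP p = l.length := by
  induction l with
  | nil => rfl
  | cons b l ih =>
    obtain ⟨a, t, rfl, ha, ht⟩ := h b (by simp)
    rw [List.flatten_cons, List.countP_append, ih fun c hc => h c (by simp [hc]),
      List.countP_cons_of_pos ha, List.countP_eq_zero.2 fun c hc => by simp [ht c hc]]
    simp [add_comm]

/-- The blocks of a string composed of blocks are those it is composed of. -/
theorem blockAt_flatten {l : List (List Ab)} (hl : ∀ b ∈ l, IsBlock p b) {u b : List Ab} :
    BlockAt p l.flatten u b ↔ ∃ l₁ l₂, l = l₁ ++ b :: l₂ ∧ u = l₁.flatten := by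
  constructor
  · rintro ⟨v, h, hb, hv⟩
    obtain ⟨l₃, hl₃, h₃⟩ := (hb.bound_append v).exists_flatten
    obtain ⟨t, l₁, ht, hl₁, hu⟩ := exists_unmarked_append_flatten p u
    rw [h₃, hu, List.append_assoc, ← List.flatten_append] at h
    have h13 : ∀ b ∈ l₁ ++ l₃, IsBlock p b := fun c hc =>
      (List.mem_append.1 hc).elim (hl₁ c) (hl₃ c)
    obtain ⟨rfl, h⟩ := unmarked_append_inj (t' := []) ht (by simp) (bound_flatten h13)
      (bound_flatten hl) h
    have h := flatten_blocks_inj h13 hl h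
    obtain ⟨l₂, hl₂, rfl⟩ := hv.exists_flatten
    have h₄ := flatten_blocks_inj (l := b :: l₂) (l' := l₃) (p := p) (fun c hc => by
      rcases List.mem_cons.1 hc with rfl | hc
      · exact hb
      · exact hl₂ c hc) hl₃ (by simpa using h₃)
    subst h₄
    exact ⟨l₁, l₂, h.symm, by simpa using hu⟩
  · rintro ⟨l₁, l₂, rfl, rfl⟩
    refine ⟨l₂.flatten, by simp, hl b (by simp), bound_flatten fun c hc => hl c (by simp [hc])⟩

theorem exists_blockAt_flatten {l : List (List Ab)} (hl : ∀ b ∈ l, IsBlock p b) {b : List Ab} :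
    (∃ u, BlockAt p l.flatten u b) ↔ b ∈ l := by
  simp only [blockAt_flatten hl]
  constructor
  · rintro ⟨u, l₁, l₂, rfl, -⟩
    simp
  · intro h
    obtain ⟨l₁, l₂, rfl⟩ := List.append_of_mem h
    exact ⟨_, l₁, l₂, rfl, rfl⟩

/-- Each preceding block contributes exactly one marker, so counting markers recovers the index of a
block. This is how the terms of a scope are matched with the entries of a tuple. -/
theorem exists_blockAt_flatten_countP {l : List (List Ab)} (hl : ∀ b ∈ l, IsBlock p b)
    {b : List Ab} {i : ℕ} :
    (∃ u, BlockAt p l.flatten u b ∧ u.countP p = i) ↔ l[i]? = some b := by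
  simp only [blockAt_flatten hl]
  constructor
  · rintro ⟨u, ⟨l₁, l₂, rfl, rfl⟩, rfl⟩
    rw [countP_flatten_blocks fun c hc => hl c (by simp [hc])]
    simp
  · intro h
    obtain ⟨hi, h'⟩ := List.getElem?_eq_some_iff.1 h
    refine ⟨_, ⟨l.take i, l.drop (i + 1), ?_, rfl⟩, ?_⟩
    · rw [← h', ← List.drop_eq_getElem_cons, List.take_append_drop]
    · rw [countP_flatten_blocks fun c hc => hl c (List.mem_of_mem_take hc)]
      simp [hi.le]

end Blocks

namespace Dec

variable {k : ℕ}

theorem bound (p : Ab → Bool) (i : Fin k) : Dec k fun x => Bound p (x i) := by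
  refine (forall_fintype fun a : Ab => (cons (P := fun _ _ => p a = false) a i (const _)).not).congr
    fun x => ?_
  unfold Bound
  cases x i with
  | nil => simp
  | cons b t => simp

theorem isBlock (p : Ab → Bool) (i : Fin k) : Dec k fun x => IsBlock p (x i) := by
  exact exists_fintype fun a : Ab => cons a i ((const _).and (forall_mem (fun c => p c = false) _))
    |>.congr fun x => by rfl

/-- Quantification over the blocks of a string. -/
theorem exists_block {P : (Fin k → List Ab) → List Ab → List Ab → Prop} (p : Ab → Bool) (i : Fin k)
    (h : Dec (k + 2) fun x => P (Fin.init (Fin.init x)) (x (Fin.last k).castSucc)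
      (x (Fin.last (k + 1)))) :
    Dec k fun x => ∃ u b, BlockAt p (x i) u b ∧ P x u b := by
  refine (split₃ (P := fun x u b v => (IsBlock p b ∧ Bound p v) ∧ P x u b) i
    (((isBlock p _).and (bound p _)).and (h.comp Fin.castSucc))).congr fun x => ?_
  constructor
  · rintro ⟨u, b, v, hs, ⟨hb, hv⟩, h⟩
    exact ⟨u, b, ⟨v, hs, hb, hv⟩, h⟩
  · rintro ⟨u, b, ⟨v, hs, hb, hv⟩, h⟩
    exact ⟨u, b, v, hs, ⟨hb, hv⟩, h⟩

theorem forall_block {P : (Fin k → List Ab) → List Ab → List Ab → Prop} (p : Ab → Bool) (i : Fin k)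
    (h : Dec (k + 2) fun x => P (Fin.init (Fin.init x)) (x (Fin.last k).castSucc)
      (x (Fin.last (k + 1)))) :
    Dec k fun x => ∀ u b, BlockAt p (x i) u b → P x u b :=
  (exists_block (P := fun x u b => ¬ P x u b) p i h.not).not.congr fun x => by push Not; rfl

end Dec

/-! ### Strategies for quantified sentences -/

section Strategies

variable {D : Type}

/-- `F` packages all Skolem functions into one map from assignments to plays; `hex` says that an
existential move depends on earlier universal moves only. The values of `g` at existential variables
are irrelevant padding. -/
theorem quantHolds_of_strategy [Nonempty D] {n : ℕ} {q : Fin n → Quantifier} {ψ : (Fin n → D) → Prop}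
    (F : (Fin n → D) → Fin n → D) (hall : ∀ g u, q u = .all → F g u = g u)
    (hex : ∀ g g' i, q i = .ex → (∀ u < i, q u = .all → g u = g' u) → F g i = F g' i)
    (hψ : ∀ g, ψ (F g)) : QuantHolds n q ψ := by
  induction n with
  | zero =>
    have := hψ Fin.elim0
    rwa [Subsingleton.elim (F _) Fin.elim0] at this
  | succ n ih =>
    have step : ∀ a, (∀ g, F (Fin.cons a g) 0 = a) →
        QuantHolds n (Fin.tail q) fun v => ψ (Fin.cons a v) := by
      intro a ha
      refine ih (fun g => Fin.tail (F (Fin.cons a g))) (fun g u hu => ?_) (fun g g' i hi h => ?_)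
        fun g => ?_
      · exact (hall _ u.succ hu).trans (Fin.cons_succ _ _ _)
      · refine hex _ _ i.succ hi fun u hu hqu => ?_
        cases u using Fin.cases with
        | zero => rfl
        | succ u => simpa using h u (by simpa using hu) hqu
      · have := hψ (Fin.cons a g)
        rwa [← Fin.cons_self_tail (F _), ha] at this
    unfold QuantHolds
    cases h0 : q 0 with
    | all => exact fun a => step a fun g => hall _ 0 h0
    | ex =>
      obtain ⟨d⟩ := ‹Nonempty D›
      -- No variable precedes the first one, so its value under `F` is the same for all assignments.
      exact ⟨F (fun _ => d) 0, step _ fun g => hex _ _ 0 h0 fun u hu => absurd hu (by simp)⟩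

theorem QuantHolds.exists_play {n : ℕ} {q : Fin n → Quantifier} {ψ : (Fin n → D) → Prop}
    (h : QuantHolds n q ψ) (c : Fin n → D) : ∃ v, ψ v ∧ ∀ u, q u = .all → v u = c u := by
  induction n with
  | zero => exact ⟨_, h, fun u => u.elim0⟩
  | succ n ih =>
    unfold QuantHolds at h
    cases h0 : q 0 with
    | all =>
      rw [h0] at h
      obtain ⟨v, hv, hc⟩ := ih (h (c 0)) (Fin.tail c)
      refine ⟨_, hv, fun u hu => ?_⟩
      cases u using Fin.cases with
      | zero => rfl
      | succ u => exact hc u hu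
    | ex =>
      rw [h0] at h
      obtain ⟨a, h⟩ := h
      obtain ⟨v, hv, hc⟩ := ih h (Fin.tail c)
      refine ⟨_, hv, fun u hu => ?_⟩
      cases u using Fin.cases with
      | zero => rw [h0] at hu; cases hu
      | succ u => exact hc u hu

/-- Two plays that first differ at a given universal variable. -/
theorem QuantHolds.exists_two_plays {n : ℕ} {q : Fin n → Quantifier} {ψ : (Fin n → D) → Prop}
    (h : QuantHolds n q ψ) {u : Fin n} (hu : q u = .all) (a b : D) :
    ∃ v v', ψ v ∧ ψ v' ∧ v u = a ∧ v' u = b ∧ ∀ i < u, v i = v' i := by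
  induction n with
  | zero => exact u.elim0
  | succ n ih =>
    unfold QuantHolds at h
    have step : ∀ d (u : Fin n), Fin.tail q u = .all →
        (QuantHolds n (Fin.tail q) fun v => ψ (Fin.cons d v)) → ∃ v v' : Fin (n + 1) → D,
        ψ v ∧ ψ v' ∧ v u.succ = a ∧ v' u.succ = b ∧ ∀ i < u.succ, v i = v' i := by
      intro d u hu h
      obtain ⟨v, v', hv, hv', hva, hvb, hi⟩ := ih h hu
      refine ⟨_, _, hv, hv', hva, hvb, fun i hiu => ?_⟩
      cases i using Fin.cases with
      | zero => rfl
      | succ i => exact hi i (by simpa using hiu)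
    cases h0 : q 0 with
    | all =>
      rw [h0] at h
      cases u using Fin.cases with
      | zero =>
        obtain ⟨v, hv, -⟩ := (h a).exists_play fun _ => a
        obtain ⟨v', hv', -⟩ := (h b).exists_play fun _ => a
        exact ⟨_, _, hv, hv', rfl, rfl, fun i hi => absurd hi (by simp)⟩
      | succ u => exact step a u hu (h a)
    | ex =>
      rw [h0] at h
      obtain ⟨d, h⟩ := h
      cases u using Fin.cases with
      | zero => rw [h0] at hu; cases hu
      | succ u => exact step d u hu h

end Strategies

/-! ### The equalities of a sentence -/

namespace Sentence

variable (φ : Sentence (Fin 3))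

def Edge (i j : Fin φ.numVars) : Prop :=
  .eq (.var i) (.var j) ∈ φ.atoms ∨ .eq (.var j) (.var i) ∈ φ.atoms

/-- The equalities between variables force the two variables to be equal. -/
def Sim : Fin φ.numVars → Fin φ.numVars → Prop := Relation.ReflTransGen φ.Edge

/-- The equalities force the variable to take the given value. -/
def ConstOf (i : Fin φ.numVars) (a : Fin 3) : Prop :=
  ∃ j, φ.Sim i j ∧ (.eq (.var j) (.const a) ∈ φ.atoms ∨ .eq (.const a) (.var j) ∈ φ.atoms)

def IsConst : Term (Fin 3) φ.numVars → Fin 3 → Prop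
  | .var i, a => φ.ConstOf i a
  | .const b, a => b = a

/-- The equalities force the term to be equal to the given universally quantified variable. -/
def IsUniv : Term (Fin 3) φ.numVars → Fin φ.numVars → Prop
  | .var i, u => φ.Sim i u ∧ φ.quant u = .all
  | .const _, _ => False

def IsFree (t : Term (Fin 3) φ.numVars) : Prop := (∀ a, ¬ φ.IsConst t a) ∧ ∀ u, ¬ φ.IsUniv t u

/-- The equalities of the sentence are satisfiable for all values of the universally quantified
variables. -/
structure Coherent : Prop where
  eq_const : ∀ a b, .eq (.const a) (.const b) ∈ φ.atoms → a = b
  const_unique : ∀ i a b, φ.ConstOf i a → φ.ConstOf i b → a = b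
  univ_not_const : ∀ u a, φ.quant u = .all → ¬ φ.ConstOf u a
  univ_tied : ∀ i u, φ.Sim i u → φ.quant u = .all → i = u ∨ (φ.quant i = .ex ∧ u < i)

open Classical in
/-- The value of a term when terms that are not forced to be equal to a constant or to a
universally quantified variable take the value zero. -/
noncomputable def val (g : Fin φ.numVars → Fin 3) (t : Term (Fin 3) φ.numVars) : Fin 3 :=
  if h : ∃ a, φ.IsConst t a then h.choose else if h : ∃ u, φ.IsUniv t u then g h.choose else 0

variable {φ}

theorem Sim.symm {i j : Fin φ.numVars} (h : φ.Sim i j) : φ.Sim j i :=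
  haveI : Std.Symm φ.Edge := ⟨fun _ _ h => Or.symm h⟩
  Relation.ReflTransGen.stdSymm.symm _ _ h

theorem Sim.trans {i j k : Fin φ.numVars} (h : φ.Sim i j) (h' : φ.Sim j k) : φ.Sim i k :=
  Relation.ReflTransGen.trans h h'

theorem Sim.constOf {i j : Fin φ.numVars} (h : φ.Sim i j) {a : Fin 3} :
    φ.ConstOf i a ↔ φ.ConstOf j a :=
  ⟨fun ⟨k, hk, h'⟩ => ⟨k, h.symm.trans hk, h'⟩, fun ⟨k, hk, h'⟩ => ⟨k, h.trans hk, h'⟩⟩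

theorem Sim.val {i j : Fin φ.numVars} (h : φ.Sim i j) (g : Fin φ.numVars → Fin 3) :
    φ.val g (.var i) = φ.val g (.var j) := by
  have h1 : φ.IsConst (.var i) = φ.IsConst (.var j) := funext fun a => propext h.constOf
  have h2 : φ.IsUniv (.var i) = φ.IsUniv (.var j) := funext fun u => propext
    ⟨fun h' => ⟨h.symm.trans h'.1, h'.2⟩, fun h' => ⟨h.trans h'.1, h'.2⟩⟩
  unfold Sentence.val
  rw [h1, h2]

/-! ### Values under the canonical assignment. -/

namespace Coherent

variable (h : φ.Coherent)
include h

theorem isConst_unique {t : Term (Fin 3) φ.numVars} {a b : Fin 3} (ha : φ.IsConst t a)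
    (hb : φ.IsConst t b) : a = b := by
  cases t with
  | var i => exact h.const_unique i a b ha hb
  | const c => exact Eq.trans (Eq.symm ha) hb

theorem isUniv_unique {t : Term (Fin 3) φ.numVars} {u u' : Fin φ.numVars} (hu : φ.IsUniv t u)
    (hu' : φ.IsUniv t u') : u = u' := by
  cases t with
  | var i =>
    rcases h.univ_tied u u' (hu.1.symm.trans hu'.1) hu'.2 with h | ⟨h, -⟩
    · exact h
    · rw [hu.2] at h; cases h
  | const c => exact hu.elim

theorem not_isConst {t : Term (Fin 3) φ.numVars} {u : Fin φ.numVars} (hu : φ.IsUniv t u)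
    (a : Fin 3) : ¬ φ.IsConst t a := by
  cases t with
  | var i => exact fun h' => h.univ_not_const u a hu.2 (hu.1.constOf.1 h')
  | const c => exact hu.elim

theorem val_of_isConst {t : Term (Fin 3) φ.numVars} {a : Fin 3} (ha : φ.IsConst t a)
    (g : Fin φ.numVars → Fin 3) : φ.val g t = a := by
  have h' : ∃ a, φ.IsConst t a := ⟨a, ha⟩
  rw [val, dif_pos h']
  exact h.isConst_unique h'.choose_spec ha

theorem val_of_isUniv {t : Term (Fin 3) φ.numVars} {u : Fin φ.numVars} (hu : φ.IsUniv t u)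
    (g : Fin φ.numVars → Fin 3) : φ.val g t = g u := by
  have h' : ∃ u, φ.IsUniv t u := ⟨u, hu⟩
  rw [val, dif_neg fun ⟨a, ha⟩ => h.not_isConst hu a ha, dif_pos h']
  rw [h.isUniv_unique h'.choose_spec hu]

omit h in
theorem val_of_isFree {t : Term (Fin 3) φ.numVars} (ht : φ.IsFree t)
    (g : Fin φ.numVars → Fin 3) : φ.val g t = 0 := by
  rw [val, dif_neg fun ⟨a, ha⟩ => ht.1 a ha, dif_neg fun ⟨u, hu⟩ => ht.2 u hu]

end Coherent

/-- The map `val` is a strategy. By `univ_tied`, an existential variable tied to a universal one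
comes after it and may copy its value; all other existential variables have values independent of
the play. Variables tied by an equality share the same value. -/
theorem Coherent.isTrue (h : φ.Coherent)
    (hφ : ∀ g r (scope : Fin r → Term (Fin 3) φ.numVars) tuples, .rel scope tuples ∈ φ.atoms →
      (fun p => φ.val g (scope p)) ∈ tuples) : φ.IsTrue := by
  have eval : ∀ g t, Term.eval (fun i => φ.val g (.var i)) t = φ.val g t := by
    intro g t
    cases t with
    | var i => rfl
    | const a => exact (h.val_of_isConst (t := .const a) rfl g).symm
  refine quantHolds_of_strategy (fun g i => φ.val g (.var i))
    (fun g u hu => h.val_of_isUniv (t := .var u) ⟨.refl, hu⟩ g) (fun g g' i hi hg => ?_)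
    fun g A hA => ?_
  · by_cases hc : ∃ a, φ.IsConst (.var i) a
    · obtain ⟨a, ha⟩ := hc
      simp only [h.val_of_isConst ha]
    by_cases hu : ∃ u, φ.IsUniv (.var i) u
    · obtain ⟨u, hu⟩ := hu
      simp only [h.val_of_isUniv hu]
      rcases h.univ_tied i u hu.1 hu.2 with rfl | ⟨-, hlt⟩
      · rw [hu.2] at hi; cases hi
      · exact hg u hlt hu.2
    · simp only [Coherent.val_of_isFree ⟨not_exists.1 hc, not_exists.1 hu⟩]
  · cases A with
    | eq s t =>
      simp only [Atom.Holds, eval]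
      cases s with
      | var i =>
        cases t with
        | var j => exact Sim.val (.single (.inl hA)) g
        | const a =>
          rw [h.val_of_isConst (t := .const a) rfl]
          exact h.val_of_isConst (t := .var i) ⟨i, .refl, .inl hA⟩ g
      | const a =>
        cases t with
        | var j =>
          rw [h.val_of_isConst (t := .const a) rfl]
          exact (h.val_of_isConst (t := .var j) ⟨j, .refl, .inr hA⟩ g).symm
        | const b => rw [h.eq_const a b hA]
    | rel scope tuples =>
      simp only [Atom.Holds, eval]
      exact hφ g _ _ _ hA

theorem Sim.eq_of_holds {i j : Fin φ.numVars} (h : φ.Sim i j) {v : Fin φ.numVars → Fin 3}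
    (hv : ∀ A ∈ φ.atoms, A.Holds v) : v i = v j := by
  induction h with
  | refl => rfl
  | tail _ h ih =>
    rcases h with h | h
    · exact ih.trans (hv _ h)
    · exact ih.trans (hv _ h).symm

theorem ConstOf.eq_of_holds {i : Fin φ.numVars} {a : Fin 3} (h : φ.ConstOf i a)
    {v : Fin φ.numVars → Fin 3} (hv : ∀ A ∈ φ.atoms, A.Holds v) : v i = a := by
  obtain ⟨j, hj, h | h⟩ := h
  · exact (hj.eq_of_holds hv).trans (hv _ h)
  · exact (hj.eq_of_holds hv).trans (hv _ h).symm

/-- Each violation is refuted by suitable moves of the universal player. -/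
theorem IsTrue.coherent (h : φ.IsTrue) : φ.Coherent where
  eq_const a b hab := by
    obtain ⟨v, hv, -⟩ := h.exists_play fun _ => 0
    exact hv _ hab
  const_unique i a b ha hb := by
    obtain ⟨v, hv, -⟩ := h.exists_play fun _ => 0
    exact (ha.eq_of_holds hv).symm.trans (hb.eq_of_holds hv)
  univ_not_const u a hu ha := by
    -- Any value other than `a` would do.
    obtain ⟨v, hv, hc⟩ := h.exists_play fun _ => a + 1
    have := (ha.eq_of_holds hv).symm.trans (hc u hu)
    simp at this
  univ_tied i u hi hu := by
    by_cases hiu : i = u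
    · exact .inl hiu
    refine .inr ?_
    cases hqi : φ.quant i with
    | all =>
      obtain ⟨v, hv, hc⟩ := h.exists_play fun j => if j = i then 0 else 1
      have := hi.eq_of_holds hv
      rw [hc i hqi, hc u hu] at this
      simp [Ne.symm hiu] at this
    | ex =>
      refine ⟨rfl, lt_of_le_of_ne (not_lt.1 fun hlt => ?_) (Ne.symm hiu)⟩
      -- An existential variable before `u` takes one value in both plays, so it cannot equal both
      -- values of `u`.
      obtain ⟨v, v', hv, hv', h0, h1, hi'⟩ := h.exists_two_plays hu 0 1
      have := hi' i hlt
      rw [hi.eq_of_holds hv, hi.eq_of_holds hv', h0, h1] at this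
      cases this

/-- A winning play against `g` agrees with `val` wherever the equalities force the value. The
remaining entries of its tuple are replaced by `0`, under which the list is assumed to be closed. -/
theorem IsTrue.val_mem (h : φ.IsTrue) (g : Fin φ.numVars → Fin 3) {r : ℕ}
    {scope : Fin r → Term (Fin 3) φ.numVars} {tuples : List (Fin r → Fin 3)}
    (hA : .rel scope tuples ∈ φ.atoms)
    (h0 : ∀ t ∈ tuples, ∀ t' : Fin r → Fin 3, (∀ p, t' p = t p ∨ t' p = 0) → t' ∈ tuples) :
    (fun p => φ.val g (scope p)) ∈ tuples := by
  obtain ⟨v, hv, hc⟩ := h.exists_play g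
  refine h0 _ (hv _ hA) _ fun p => ?_
  have hco := h.coherent
  by_cases hc' : ∃ a, φ.IsConst (scope p) a
  · obtain ⟨a, ha⟩ := hc'
    left
    rw [hco.val_of_isConst ha]
    cases hs : scope p with
    | var i => rw [hs] at ha; exact (ConstOf.eq_of_holds ha hv).symm
    | const b => rw [hs] at ha; exact Eq.symm ha
  by_cases hu : ∃ u, φ.IsUniv (scope p) u
  · obtain ⟨u, hu⟩ := hu
    left
    rw [hco.val_of_isUniv hu, ← hc u ?_]
    · cases hs : scope p with
      | var i => rw [hs] at hu; exact (hu.1.eq_of_holds hv).symm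
      | const b => rw [hs] at hu; exact hu.elim
    · cases hs : scope p with
      | var i => rw [hs] at hu; exact hu.2
      | const b => rw [hs] at hu; exact hu.elim
  · right
    exact Coherent.val_of_isFree ⟨not_exists.1 hc', not_exists.1 hu⟩ g

/-! ### The tuples that arise from the values of the universally quantified variables -/

variable {r : ℕ} {scope : Fin r → Term (Fin 3) φ.numVars} {tuples : List (Fin r → Fin 3)}

/-- The tuple is compatible with the equalities, and its other entries are zero. -/
structure Consistent (scope : Fin r → Term (Fin 3) φ.numVars) (t : Fin r → Fin 3) : Prop where
  const : ∀ p a, φ.IsConst (scope p) a → t p = a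
  free : ∀ p, φ.IsFree (scope p) → t p = 0
  univ : ∀ p p' u, φ.IsUniv (scope p) u → φ.IsUniv (scope p') u → t p = t p'

/-- The assignment `g` is read off from any entry of `t` tied to the universal variable; consistency
makes the choice of the entry immaterial. Consistency can be checked without mentioning assignments.
-/
theorem Coherent.consistent_iff (h : φ.Coherent) {t : Fin r → Fin 3} :
    Consistent scope t ↔ ∃ g, t = fun p => φ.val g (scope p) := by
  classical
  constructor
  · intro ht
    refine ⟨fun u => if hp : ∃ p, φ.IsUniv (scope p) u then t hp.choose else 0, funext fun p => ?_⟩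
    by_cases hc : ∃ a, φ.IsConst (scope p) a
    · obtain ⟨a, ha⟩ := hc
      rw [h.val_of_isConst ha, ht.const p a ha]
    by_cases hu : ∃ u, φ.IsUniv (scope p) u
    · obtain ⟨u, hu⟩ := hu
      have hp : ∃ p, φ.IsUniv (scope p) u := ⟨p, hu⟩
      rw [h.val_of_isUniv hu, dif_pos hp]
      exact ht.univ _ _ u hu hp.choose_spec
    · rw [Coherent.val_of_isFree ⟨not_exists.1 hc, not_exists.1 hu⟩]
      exact ht.free p ⟨not_exists.1 hc, not_exists.1 hu⟩
  · rintro ⟨g, rfl⟩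
    exact ⟨fun p a ha => h.val_of_isConst ha g, fun p hp => Coherent.val_of_isFree hp g,
      fun p p' u hu hu' => by rw [h.val_of_isUniv hu, h.val_of_isUniv hu']⟩

theorem Coherent.val_update (h : φ.Coherent) [DecidableEq (Fin φ.numVars)]
    (g : Fin φ.numVars → Fin 3) (u : Fin φ.numVars)
    (a : Fin 3) (t : Term (Fin 3) φ.numVars) :
    (φ.IsUniv t u → φ.val (Function.update g u a) t = a) ∧
    (¬ φ.IsUniv t u → φ.val (Function.update g u a) t = φ.val g t) := by
  refine ⟨fun hu => by rw [h.val_of_isUniv hu, Function.update_self], fun hu => ?_⟩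
  by_cases hc : ∃ a, φ.IsConst t a
  · obtain ⟨a, ha⟩ := hc
    rw [h.val_of_isConst ha, h.val_of_isConst ha]
  by_cases hu' : ∃ u, φ.IsUniv t u
  · obtain ⟨u', hu'⟩ := hu'
    rw [h.val_of_isUniv hu', h.val_of_isUniv hu', Function.update_of_ne]
    rintro rfl
    exact hu hu'
  · rw [Coherent.val_of_isFree ⟨not_exists.1 hc, not_exists.1 hu'⟩,
      Coherent.val_of_isFree ⟨not_exists.1 hc, not_exists.1 hu'⟩]

/-- All tuples that arise are listed iff one of them is and the list is closed under changing the
value of one universally quantified variable. -/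
theorem Coherent.forall_val_mem_iff (h : φ.Coherent) :
    (∀ g, (fun p => φ.val g (scope p)) ∈ tuples) ↔ (∃ t ∈ tuples, Consistent scope t) ∧
      ∀ t ∈ tuples, Consistent scope t → ∀ u, φ.quant u = .all → ∀ a, ∃ t' ∈ tuples,
        ∀ p, (φ.IsUniv (scope p) u → t' p = a) ∧ (¬ φ.IsUniv (scope p) u → t' p = t p) := by
  classical
  constructor
  · intro hg
    refine ⟨⟨_, hg fun _ => 0, h.consistent_iff.2 ⟨_, rfl⟩⟩, fun t _ ht u hu a => ?_⟩
    obtain ⟨g, rfl⟩ := h.consistent_iff.1 ht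
    exact ⟨_, hg (Function.update g u a), fun p => h.val_update g u a (scope p)⟩
  · rintro ⟨⟨t, htm, ht⟩, hstep⟩ g
    obtain ⟨g₀, rfl⟩ := h.consistent_iff.1 ht
    have step : ∀ g u a, (fun p => φ.val g (scope p)) ∈ tuples →
        (fun p => φ.val (Function.update g u a) (scope p)) ∈ tuples := by
      intro g u a hg
      cases hq : φ.quant u with
      | all =>
        obtain ⟨t', ht', h'⟩ := hstep _ hg (h.consistent_iff.2 ⟨_, rfl⟩) u hq a
        convert ht' using 1
        funext p
        by_cases hu : φ.IsUniv (scope p) u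
        · rw [(h' p).1 hu, (h.val_update g u a _).1 hu]
        · rw [(h' p).2 hu, (h.val_update g u a _).2 hu]
      | ex =>
        convert hg using 1
        funext p
        refine (h.val_update g u a _).2 fun hu => ?_
        cases hs : scope p with
        | var i => rw [hs] at hu; rw [hu.2] at hq; cases hq
        | const b => rw [hs] at hu; exact hu
    -- The assignment `g₀` of the listed tuple is turned into `g` one variable at a time. All tuples
    -- on the way are consistent, so the closure condition keeps applying.
    have key : ∀ s : Finset (Fin φ.numVars), ∃ g', (fun p => φ.val g' (scope p)) ∈ tuples ∧
        ∀ i ∈ s, g' i = g i := by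
      intro s
      induction s using Finset.induction_on with
      | empty => exact ⟨g₀, htm, by simp⟩
      | insert i s hi ih =>
        obtain ⟨g', hg', hs⟩ := ih
        refine ⟨_, step g' i (g i) hg', fun j hj => ?_⟩
        by_cases hji : j = i
        · subst hji
          simp
        · rw [Function.update_of_ne hji]
          exact hs j ((Finset.mem_insert.1 hj).resolve_left hji)
    obtain ⟨g', hg', he⟩ := key Finset.univ
    rwa [funext fun i => he i (Finset.mem_univ i)] at hg'

end Sentence

/-! ### Recognizing the relations `τ_k` -/

def IsRho (m : List Ab) : Prop :=
  ∃ a b c : Fin 3, m = [.elem a, .elem b, .elem c] ∧ rho' {0, 1} {0, 2} a b c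

def IsTriple (m : List Ab) : Prop := ∃ a b c : Fin 3, m = [.elem a, .elem b, .elem c]

/-- The triple at some position divisible by three satisfies `ρ'`. -/
def InTau (s : List Ab) : Prop := ∃ u m v, u ++ (m ++ v) = s ∧ 3 ∣ u.length ∧ IsRho m

/-- The set of strings is closed under the changes of one triple that leave a triple satisfying
`ρ'` at the same position, or that are made next to a triple satisfying `ρ'`. -/
def TripleClosed (T : List Ab → Prop) : Prop :=
  ∀ t, T t → ∀ u m v, u ++ (m ++ v) = t → 3 ∣ u.length → IsTriple m → ∀ m', IsTriple m' →
    (IsRho m ∧ IsRho m') ∨ InTau u ∨ InTau v → T (u ++ (m' ++ v))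

/-- The string of the entries of a tuple. -/
def tupleString {r : ℕ} (t : Fin r → Fin 3) : List Ab := (List.ofFn t).map .elem

theorem length_tupleString {r : ℕ} (t : Fin r → Fin 3) : (tupleString t).length = r := by
  simp [tupleString]

theorem tupleString_injective {r : ℕ} : Function.Injective (tupleString (r := r)) := by
  intro t t' h
  have hinj : Function.Injective (Sym.elem : Fin 3 → Ab) := fun a b h => by injection h
  exact List.ofFn_injective (List.map_injective_iff.2 hinj h)

def IsElems (s : List Ab) : Prop := ∀ c ∈ s, ∃ a : Fin 3, c = .elem a

theorem exists_tupleString {s : List Ab} (h : IsElems s) {r : ℕ} (hr : s.length = r) :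
    ∃ t : Fin r → Fin 3, tupleString t = s := by
  subst hr
  choose a ha using fun i : Fin s.length => h s[i] (List.getElem_mem _)
  refine ⟨a, List.ext_getElem (length_tupleString _) fun i hi hi' => ?_⟩
  simp [tupleString, ← ha ⟨i, hi'⟩]

theorem isElems_tupleString {r : ℕ} (t : Fin r → Fin 3) : IsElems (tupleString t) := by
  intro c hc
  obtain ⟨a, -, rfl⟩ := List.mem_map.1 hc
  exact ⟨a, rfl⟩

theorem IsElems.isTriple {m : List Ab} (h : IsElems m) (hm : m.length = 3) : IsTriple m := by
  obtain ⟨t, rfl⟩ := exists_tupleString h hm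
  exact ⟨t 0, t 1, t 2, by simp [tupleString, List.ofFn_succ]⟩

theorem IsTriple.length {m : List Ab} (h : IsTriple m) : m.length = 3 := by
  obtain ⟨a, b, c, rfl⟩ := h
  rfl

theorem IsTriple.isElems {m : List Ab} (h : IsTriple m) : IsElems m := by
  obtain ⟨a, b, c, rfl⟩ := h
  intro d hd
  simp only [List.mem_cons, List.not_mem_nil, or_false] at hd
  rcases hd with rfl | rfl | rfl <;> exact ⟨_, rfl⟩

theorem IsRho.isTriple {m : List Ab} (h : IsRho m) : IsTriple m := by
  obtain ⟨a, b, c, h, -⟩ := h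
  exact ⟨a, b, c, h⟩

theorem InTau.append_left {s : List Ab} (h : InTau s) {u : List Ab} (hu : 3 ∣ u.length) :
    InTau (u ++ s) := by
  obtain ⟨u', m, v, rfl, h1, h2⟩ := h
  exact ⟨u ++ u', m, v, by simp, by rw [List.length_append]; exact dvd_add hu h1, h2⟩

theorem InTau.append_right {s : List Ab} (h : InTau s) (u : List Ab) : InTau (s ++ u) := by
  obtain ⟨u', m, v, rfl, h1, h2⟩ := h
  exact ⟨u', m, v ++ u, by simp, h1, h2⟩

theorem exists_split {x : List Ab} {a b : ℕ} (hx : x.length = a + b) :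
    ∃ u v, x = u ++ v ∧ u.length = a ∧ v.length = b :=
  ⟨x.take a, x.drop a, by simp, by simp [hx], by simp [hx]⟩

theorem IsElems.of_append {u v : List Ab} (h : IsElems (u ++ v)) : IsElems u ∧ IsElems v :=
  ⟨fun c hc => h c (by simp [hc]), fun c hc => h c (by simp [hc])⟩

namespace TripleClosed

variable {T : List Ab → Prop} (h : TripleClosed T)
include h

/-- A triple satisfying `ρ'` inside `y` licenses arbitrary changes of the triples outside `y`, which
are made from the last to the first. -/
theorem replace_left (k : ℕ) : ∀ {x x' y : List Ab}, T (x ++ y) → x.length = 3 * k →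
    x'.length = 3 * k → IsElems x → IsElems x' → InTau y → T (x' ++ y) := by
  induction k with
  | zero =>
    intro x x' y hT hx hx' _ _ _
    rw [List.eq_nil_of_length_eq_zero hx] at hT
    rwa [List.eq_nil_of_length_eq_zero hx']
  | succ k ih =>
    intro x x' y hT hx hx' he he' hy
    obtain ⟨u, m, rfl, hu, hm⟩ := exists_split (a := 3 * k) (b := 3) hx
    obtain ⟨u', m', rfl, hu', hm'⟩ := exists_split (a := 3 * k) (b := 3) hx'
    have hmt := he'.of_append.2.isTriple hm'
    rw [List.append_assoc] at hT ⊢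
    exact ih (h _ hT u m y rfl ⟨k, hu⟩ (he.of_append.2.isTriple hm) m' hmt (.inr (.inr hy))) hu hu'
      he.of_append.1 he'.of_append.1 (hy.append_left ⟨1, hm'⟩)

theorem replace_right (k : ℕ) : ∀ {x x' y : List Ab}, T (y ++ x) → 3 ∣ y.length →
    x.length = 3 * k → x'.length = 3 * k → IsElems x → IsElems x' → InTau y → T (y ++ x') := by
  induction k with
  | zero =>
    intro x x' y hT _ hx hx' _ _ _
    rw [List.eq_nil_of_length_eq_zero hx] at hT
    rwa [List.eq_nil_of_length_eq_zero hx']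
  | succ k ih =>
    intro x x' y hT hy3 hx hx' he he' hy
    obtain ⟨m, v, rfl, hm, hv⟩ := exists_split (a := 3) (b := 3 * k) (x := x) (by omega)
    obtain ⟨m', v', rfl, hm', hv'⟩ := exists_split (a := 3) (b := 3 * k) (x := x') (by omega)
    have hmt := he'.of_append.1.isTriple hm'
    have := h _ hT y m v rfl hy3 (he.of_append.1.isTriple hm) m' hmt (.inr (.inl hy))
    rw [← List.append_assoc] at this ⊢
    exact ih this (by rw [List.length_append]; omega) hv hv' he.of_append.2 he'.of_append.2
      (hy.append_right _)

/-- A nonempty closed set contains all strings of the same length that have a triple satisfying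
`ρ'`. -/
theorem mem_of_inTau {t t' : List Ab} (ht : T t) (het : IsElems t) (htau : InTau t)
    (h3 : 3 ∣ t.length) (hl : t'.length = t.length) (het' : IsElems t') (htau' : InTau t') :
    T t' := by
  obtain ⟨u, m, v, rfl, ⟨k, hu⟩, hm⟩ := htau
  have hm3 := hm.isTriple.length
  simp only [List.length_append] at hl h3
  obtain ⟨u₁, x, rfl, hu₁, hx⟩ := exists_split (a := u.length) (b := 3 + v.length) (x := t')
    (by omega)
  obtain ⟨m₁, v₁, rfl, hm₁, hv₁⟩ := exists_split hx
  have hm₁' := het'.of_append.2.of_append.1.isTriple hm₁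
  obtain ⟨l, hv⟩ : 3 ∣ v.length := by omega
  have hmv : InTau (m ++ v) := ⟨[], m, v, rfl, by simp, hm⟩
  have hum : InTau (u₁ ++ m) := ⟨u₁, m, [], by simp, ⟨k, by omega⟩, hm⟩
  -- With the good triple `m` of `t` kept fixed, everything to its left and then everything to its
  -- right is replaced by the entries of `t'`. The last change replaces `m` itself and must be
  -- licensed by a good triple of `t'`.
  have h1 := h.replace_left k ht hu (by omega) het.of_append.1 het'.of_append.1 hmv
  rw [← List.append_assoc] at h1
  have h2 := h.replace_right l (x' := v₁) h1 (by rw [List.length_append]; omega) hv (by omega)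
    het.of_append.2.of_append.2 het'.of_append.2.of_append.2 hum
  refine h _ h2 u₁ m v₁ (by simp) ⟨k, by omega⟩ hm.isTriple m₁ hm₁' ?_
  obtain ⟨u₂, m₂, v₂, he, hu₂, hm₂⟩ := htau'
  have hm₂3 := hm₂.isTriple.length
  have hlen := congrArg List.length he
  simp only [List.length_append] at hlen
  -- Both offsets are multiples of three, so the good triple of `t'` lies entirely to the left of
  -- the triple in question, coincides with it, or lies entirely to its right: the three licences in
  -- `TripleClosed`.
  rcases lt_trichotomy u₂.length u₁.length with hlt | heq | hgt
  · obtain ⟨u₃, v₃, rfl, hu₃, hv₃⟩ := exists_split (x := u₁) (a := u₂.length + 3)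
      (b := u₁.length - (u₂.length + 3)) (by omega)
    rw [← List.append_assoc, List.append_assoc (cs := m₁ ++ v₁)] at he
    have he := List.append_inj_left he (by rw [List.length_append]; omega)
    exact .inr (.inl ⟨u₂, m₂, v₃, by rw [← he]; simp, hu₂, hm₂⟩)
  · obtain ⟨-, he⟩ := List.append_inj he heq
    have := List.append_inj_left he (by omega)
    exact .inl ⟨hm, this ▸ hm₂⟩
  · obtain ⟨u₃, v₃, rfl, hu₃, hv₃⟩ := exists_split (x := u₂) (a := u₁.length + 3)
      (b := u₂.length - (u₁.length + 3)) (by omega)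
    rw [← List.append_assoc (bs := m₁), List.append_assoc (as := u₃)] at he
    have he' := List.append_inj_right he (by rw [List.length_append]; omega)
    exact .inr (.inr ⟨v₃, m₂, v₂, he', by rw [List.length_append] at hu₂; omega, hm₂⟩)

end TripleClosed

theorem inTau_tupleString {k : ℕ} {t : Fin (3 * k) → Fin 3} :
    InTau (tupleString t) ↔ t ∈ tau {0, 1} {0, 2} k := by
  have hget : ∀ (i : ℕ) (hi : i < 3 * k), (tupleString t)[i]? = some (.elem (t ⟨i, hi⟩)) := by
    intro i hi
    simp [tupleString, hi]
  constructor
  · rintro ⟨u, m, v, he, ⟨i, hi⟩, a, b, c, rfl, hr⟩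
    have hlen := congrArg List.length he
    simp only [List.length_append, length_tupleString, List.length_cons] at hlen
    have hg : ∀ (j : ℕ) (hj : 3 * i + j < 3 * k) (d : Fin 3),
        ([Sym.elem a, .elem b, .elem c] : List Ab)[j]? = some (.elem d) → t ⟨3 * i + j, hj⟩ = d := by
      intro j hj d hd
      have h1 := hget _ hj
      have hj3 := (List.getElem?_eq_some_iff.1 hd).1
      rw [← he, List.getElem?_append_right (by omega), hi, Nat.add_sub_cancel_left,
        List.getElem?_append_left hj3, hd] at h1
      injection h1 with h1
      injection h1 with h1
      exact h1.symm
    refine ⟨⟨i, by omega⟩, ?_⟩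
    have ha := hg 0 (by omega) a rfl
    have hb := hg 1 (by omega) b rfl
    have hc := hg 2 (by omega) c rfl
    simp only [add_zero] at ha
    dsimp only
    rw [ha, hb, hc]
    exact hr
  · rintro ⟨i, hi⟩
    refine ⟨(tupleString t).take (3 * i), [.elem _, .elem _, .elem _],
      (tupleString t).drop (3 * i + 3), ?_, ?_, _, _, _, rfl, hi⟩
    · conv_rhs => rw [← List.take_append_drop (3 * i) (tupleString t)]
      congr 1
      have hd : ∀ (j : ℕ) (hj : j < 3 * k), (tupleString t).drop j =
          .elem (t ⟨j, hj⟩) :: (tupleString t).drop (j + 1) := by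
        intro j hj
        rw [List.drop_eq_getElem_cons (by rw [length_tupleString]; exact hj)]
        congr 1
        simp [tupleString]
      rw [hd (3 * i) (by omega), hd (3 * i + 1) (by omega), hd (3 * i + 2) (by omega)]
      rfl
    · have := i.2
      rw [List.length_take, length_tupleString]
      omega

theorem mem_tauLanguage_iff {r : ℕ} {S : Set (Fin r → Fin 3)} :
    (⟨r, S⟩ : Σ r : ℕ, Set (Fin r → Fin 3)) ∈ tauLanguage ({0, 1} : Set (Fin 3)) {0, 2} ↔
      3 ∣ r ∧ ∀ t, t ∈ S ↔ InTau (tupleString t) := by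
  constructor
  · rintro ⟨k, h⟩
    obtain ⟨rfl, h⟩ := Sigma.mk.inj_iff.1 h
    obtain rfl := eq_of_heq h
    exact ⟨⟨k, rfl⟩, fun t => inTau_tupleString.symm⟩
  · rintro ⟨⟨k, rfl⟩, h⟩
    have hS : tau {0, 1} {0, 2} k = S := by
      ext t
      rw [h, inTau_tupleString]
    exact ⟨k, by dsimp only; rw [hS]⟩

/-- Membership of a list in the language becomes a local closure test, avoiding an enumeration of
all tuples of arity `r`. Nonemptiness is essential: the empty relation is closed for every arity,
but it is only `τ_0`. -/
theorem mem_tauLanguage_iff_of_nonempty {r : ℕ} {S : Set (Fin r → Fin 3)} (hS : S.Nonempty) :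
    (⟨r, S⟩ : Σ r : ℕ, Set (Fin r → Fin 3)) ∈ tauLanguage ({0, 1} : Set (Fin 3)) {0, 2} ↔
      3 ∣ r ∧ (∀ t ∈ S, InTau (tupleString t)) ∧ TripleClosed fun s => ∃ t ∈ S, tupleString t = s := by
  rw [mem_tauLanguage_iff]
  refine and_congr_right fun h3 => ⟨fun h => ⟨fun t => (h t).1, ?_⟩, fun ⟨h1, h2⟩ t => ⟨h1 t, ?_⟩⟩
  · rintro _ ⟨t, ht, rfl⟩ u m v he hu hm m' hm' hr
    have hlen := congrArg List.length he
    have he' := isElems_tupleString t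
    rw [← he] at he'
    simp only [List.length_append, length_tupleString, hm.length] at hlen
    obtain ⟨t', ht'⟩ := exists_tupleString (s := u ++ (m' ++ v)) (r := r) (fun c hc => by
      simp only [List.mem_append] at hc
      rcases hc with hc | hc | hc
      · exact he'.of_append.1 c hc
      · exact hm'.isElems c hc
      · exact he'.of_append.2.of_append.2 c hc) (by
        simp only [List.length_append, hm'.length]; exact hlen)
    refine ⟨t', ?_, ht'⟩
    rw [h, ht']
    rcases hr with ⟨-, hr⟩ | hr | hr
    · exact ⟨u, m', v, rfl, hu, hr⟩
    · exact hr.append_right _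
    · exact (hr.append_left ⟨1, hm'.length⟩).append_left hu
  · intro ht
    obtain ⟨t₀, ht₀⟩ := hS
    obtain ⟨t', ht', he⟩ := h2.mem_of_inTau ⟨t₀, ht₀, rfl⟩ (isElems_tupleString _) (h1 _ ht₀)
      (by rwa [length_tupleString]) (by rw [length_tupleString, length_tupleString])
      (isElems_tupleString t) ht
    exact tupleString_injective he ▸ ht'

/-- As `0` lies in both `α` and `β`, the disjunct satisfied by `t` remains satisfied by `t'`. -/
theorem mem_of_entries_zero {r : ℕ} {S : Set (Fin r → Fin 3)}
    (hS : (⟨r, S⟩ : Σ r : ℕ, Set (Fin r → Fin 3)) ∈ tauLanguage ({0, 1} : Set (Fin 3)) {0, 2})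
    {t t' : Fin r → Fin 3} (ht : t ∈ S) (h : ∀ p, t' p = t p ∨ t' p = 0) : t' ∈ S := by
  obtain ⟨k, hk⟩ := hS
  obtain ⟨rfl, hk⟩ := Sigma.mk.inj_iff.1 hk
  obtain rfl := eq_of_heq hk
  obtain ⟨i, hi⟩ := ht
  refine ⟨i, ?_⟩
  have hα : ∀ p, t p ∈ ({0, 1} : Set (Fin 3)) → t' p ∈ ({0, 1} : Set (Fin 3)) := fun p hp => by
    rcases h p with h | h <;> rw [h]
    · exact hp
    · simp
  have hβ : ∀ p, t p ∈ ({0, 2} : Set (Fin 3)) → t' p ∈ ({0, 2} : Set (Fin 3)) := fun p hp => by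
    rcases h p with h | h <;> rw [h]
    · exact hp
    · simp
  exact hi.imp (fun h => ⟨hα _ h.1, hα _ h.2.1, hα _ h.2.2⟩)
    fun h => ⟨hβ _ h.1, hβ _ h.2.1, hβ _ h.2.2⟩

/-- A combinatorial criterion for the truth of instances of `QCSP(B)`. -/
theorem Sentence.isOver_and_isTrue_iff {φ : Sentence (Fin 3)} :
    φ.IsOver (tauLanguage {0, 1} {0, 2}) ∧ φ.IsTrue ↔ φ.Coherent ∧
      ∀ r (scope : Fin r → Term (Fin 3) φ.numVars) tuples, .rel scope tuples ∈ φ.atoms →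
        (3 ∣ r ∧ (∀ t ∈ tuples, InTau (tupleString t)) ∧
          TripleClosed fun s => ∃ t ∈ tuples, tupleString t = s) ∧
        (∃ t ∈ tuples, Consistent scope t) ∧
        ∀ t ∈ tuples, Consistent scope t → ∀ u, φ.quant u = .all → ∀ a, ∃ t' ∈ tuples,
          ∀ p, (φ.IsUniv (scope p) u → t' p = a) ∧ (¬ φ.IsUniv (scope p) u → t' p = t p) := by
  constructor
  · rintro ⟨ho, ht⟩
    refine ⟨ht.coherent, fun r scope tuples hA => ?_⟩
    have hB := ho _ hA
    have h := ht.coherent.forall_val_mem_iff.1 fun g =>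
      ht.val_mem g hA fun t h t' h' => mem_of_entries_zero hB h h'
    -- Truth forces the list to be nonempty, as the closure test for membership in the language
    -- requires.
    obtain ⟨t, h0, -⟩ := h.1
    exact ⟨(mem_tauLanguage_iff_of_nonempty ⟨t, h0⟩).1 hB, h⟩
  · rintro ⟨hc, h⟩
    refine ⟨fun A hA => ?_, hc.isTrue fun g r scope tuples hA =>
      hc.forall_val_mem_iff.2 (h r scope tuples hA).2 g⟩
    cases A with
    | eq s t => trivial
    | rel scope tuples =>
      obtain ⟨h1, ⟨t, ht, -⟩, -⟩ := h _ scope tuples hA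
      exact (mem_tauLanguage_iff_of_nonempty (S := {t | t ∈ tuples}) ⟨t, ht⟩).2 h1

/-! ### The components of an encoded sentence -/

def atomMark : Ab → Bool
  | .eq | .rel => true
  | _ => false

def termMark : Ab → Bool
  | .var | .elem _ => true
  | _ => false

def tupMark : Ab → Bool
  | .tup => true
  | _ => false

/-- A variable is represented by the string of the quantifiers before its own. -/
def VarOf (Q q : List Ab) : Prop := ∃ r, q ++ r = Q ∧ r ≠ []

def UnivOf (Q q : List Ab) : Prop := ∃ r, q ++ .all :: r = Q

def EqOf (body s t : List Ab) : Prop := ∃ u, BlockAt atomMark body u (.eq :: (s ++ t))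

def TupleOf (Y t : List Ab) : Prop := ∃ u, BlockAt tupMark Y u (.tup :: t)

/-- The string `s` encodes the variable represented by `q`. -/
def VarStr (s q : List Ab) : Prop :=
  ∃ y, .var :: y = s ∧ (∀ c ∈ y, c = .tick) ∧ y.length = q.length

/-- The entry of the tuple `t` for the term with the string `u` of terms before it is `a`. -/
def EntryAt (t u : List Ab) (a : Fin 3) : Prop :=
  ∃ t₁ t₂, t₁ ++ t₂ = t ∧ u.countP termMark = t₁.length ∧ ∃ v, .elem a :: v = t₂

def EdgeStr (body q q' : List Ab) : Prop :=
  ∃ s t, EqOf body s t ∧ (VarStr s q ∧ VarStr t q' ∨ VarStr s q' ∧ VarStr t q)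

def SimStr (Q body q q' : List Ab) : Prop :=
  q <+: Q ∧ q' <+: Q ∧
    Relation.ReflTransGen (fun u v => u <+: Q ∧ v <+: Q ∧ EdgeStr body u v) q q'

def ConstOfStr (Q body q : List Ab) (a : Fin 3) : Prop :=
  ∃ q', VarOf Q q' ∧ SimStr Q body q q' ∧
    ∃ s t, EqOf body s t ∧ (VarStr s q' ∧ t = [.elem a] ∨ s = [.elem a] ∧ VarStr t q')

def IsConstStr (Q body s : List Ab) (a : Fin 3) : Prop :=
  s = [.elem a] ∨ ∃ q, VarOf Q q ∧ VarStr s q ∧ ConstOfStr Q body q a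

def IsUnivStr (Q body s q' : List Ab) : Prop :=
  UnivOf Q q' ∧ ∃ q, VarOf Q q ∧ VarStr s q ∧ SimStr Q body q q'

def IsFreeStr (Q body s : List Ab) : Prop :=
  (∀ a, ¬ IsConstStr Q body s a) ∧ ∀ q, VarOf Q q → ¬ IsUnivStr Q body s q

/-- The order of variables becomes the prefix order of the strings representing them. A non-strict
prefix suffices in the last clause, since equality is already allowed by its first alternative. -/
def CoherentStr (Q body : List Ab) : Prop :=
  (∀ a b : Fin 3, (∃ s t, EqOf body s t ∧ s = [.elem a] ∧ t = [.elem b]) → a = b) ∧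
  (∀ q, VarOf Q q → ∀ a b, ConstOfStr Q body q a → ConstOfStr Q body q b → a = b) ∧
  (∀ q, VarOf Q q → ∀ a, UnivOf Q q → ¬ ConstOfStr Q body q a) ∧
  ∀ q, VarOf Q q → ∀ q', VarOf Q q' → SimStr Q body q q' → UnivOf Q q' →
    q = q' ∨ (¬ UnivOf Q q ∧ q' <+: q)

/-- An entry is located by the part `u` of the scope before its term. Equality of two entries is
expressed by passing each possible value from one to the other. -/
def ConsistentStr (Q body X t : List Ab) : Prop :=
  (∀ u s, BlockAt termMark X u s → ∀ a, IsConstStr Q body s a → EntryAt t u a) ∧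
  (∀ u s, BlockAt termMark X u s → IsFreeStr Q body s → EntryAt t u 0) ∧
  ∀ u s, BlockAt termMark X u s → ∀ u' s', BlockAt termMark X u' s' → ∀ q, VarOf Q q →
    IsUnivStr Q body s q → IsUnivStr Q body s' q → ∀ a, EntryAt t u a → EntryAt t u' a

/-- The condition on a relational atom with the scope `X` and the listed tuples `Y`. -/
def RelCond (Q body X Y : List Ab) : Prop :=
  ((∀ t, TupleOf Y t → 3 ∣ t.length ∧ InTau t) ∧ TripleClosed (TupleOf Y)) ∧
  (∃ t, TupleOf Y t ∧ ConsistentStr Q body X t) ∧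
  ∀ t, TupleOf Y t → ConsistentStr Q body X t → ∀ q, VarOf Q q → UnivOf Q q → ∀ a,
    ∃ t', TupleOf Y t' ∧ ∀ u s, BlockAt termMark X u s →
      (IsUnivStr Q body s q → EntryAt t' u a) ∧
      (¬ IsUnivStr Q body s q → ∀ c, EntryAt t u c → EntryAt t' u c)

def IsTermStr (Q s : List Ab) : Prop := (∃ a, s = [.elem a]) ∨ ∃ q, VarOf Q q ∧ VarStr s q

def IsScope (Q X : List Ab) : Prop :=
  Bound termMark X ∧ ∀ u s, BlockAt termMark X u s → IsTermStr Q s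

def IsTuples (X Y : List Ab) : Prop :=
  Bound tupMark Y ∧ ∀ u b, BlockAt tupMark Y u b →
    ∃ t, .tup :: t = b ∧ IsElems t ∧ X.countP termMark = t.length

def IsEqStr (Q b : List Ab) : Prop :=
  ∃ c, .eq :: c = b ∧ ∃ s t, s ++ t = c ∧ IsTermStr Q s ∧ IsTermStr Q t

def IsRelStr (Q b : List Ab) (P : List Ab → List Ab → Prop) : Prop :=
  ∃ c, .rel :: c = b ∧ ∃ X Y, X ++ Y = c ∧ (IsScope Q X ∧ IsTuples X Y) ∧ P X Y

/-- The string `Q ++ body` encodes a true sentence over the language of the relations `τ_k`. -/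
def Accepts (Q body : List Ab) : Prop :=
  (∀ c ∈ Q, c = .all ∨ c = .ex) ∧ Bound atomMark body ∧
  (∀ u b, BlockAt atomMark body u b → IsEqStr Q b ∨ IsRelStr Q b (RelCond Q body)) ∧
  CoherentStr Q body

/-! ### Polynomial-time decidability of the conditions on encodings. -/

namespace Dec

variable {k : ℕ}

theorem exists_var {P : (Fin k → List Ab) → List Ab → Prop} (i : Fin k)
    (h : Dec (k + 1) fun x => P (Fin.init x) (x (Fin.last k))) :
    Dec k fun x => ∃ q, VarOf (x i) q ∧ P x q := by
  refine (split (P := fun x q r => r ≠ [] ∧ P x q) i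
    ((eq_nil _).not.and (h.comp Fin.castSucc))).congr fun x => ?_
  exact ⟨fun ⟨q, r, h, hr, hP⟩ => ⟨q, ⟨r, h, hr⟩, hP⟩, fun ⟨q, ⟨r, h, hr⟩, hP⟩ => ⟨q, r, h, hr, hP⟩⟩

theorem forall_var {P : (Fin k → List Ab) → List Ab → Prop} (i : Fin k)
    (h : Dec (k + 1) fun x => P (Fin.init x) (x (Fin.last k))) :
    Dec k fun x => ∀ q, VarOf (x i) q → P x q :=
  (exists_var (P := fun x q => ¬ P x q) i h.not).not.congr fun x => by push Not; rfl

theorem exists_tuple {P : (Fin k → List Ab) → List Ab → Prop} (i : Fin k)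
    (h : Dec (k + 1) fun x => P (Fin.init x) (x (Fin.last k))) :
    Dec k fun x => ∃ t, TupleOf (x i) t ∧ P x t := by
  refine (exists_block (P := fun x u b => ∃ t, .tup :: t = b ∧ P x t) tupMark i
    (cons (P := fun x t => P (Fin.init (Fin.init x)) t) .tup _
      (h.comp (Fin.snoc (fun j => j.castSucc.castSucc.castSucc) (Fin.last (k + 2)) :
        Fin (k + 1) → Fin (k + 3)) |>.congr fun x => ?_))).congr fun x => ?_
  · unfold Fin.init
    simp only [Fin.snoc_castSucc, Fin.snoc_last]
  · constructor
    · rintro ⟨u, _, hb, t, rfl, h⟩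
      exact ⟨t, ⟨u, hb⟩, h⟩
    · rintro ⟨t, ⟨u, hb⟩, h⟩
      exact ⟨u, _, hb, t, rfl, h⟩

theorem forall_tuple {P : (Fin k → List Ab) → List Ab → Prop} (i : Fin k)
    (h : Dec (k + 1) fun x => P (Fin.init x) (x (Fin.last k))) :
    Dec k fun x => ∀ t, TupleOf (x i) t → P x t :=
  (exists_tuple (P := fun x t => ¬ P x t) i h.not).not.congr fun x => by push Not; rfl

theorem exists_eq {P : (Fin k → List Ab) → List Ab → List Ab → Prop} (i : Fin k)
    (h : Dec (k + 2) fun x => P (Fin.init (Fin.init x)) (x (Fin.last k).castSucc)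
      (x (Fin.last (k + 1)))) :
    Dec k fun x => ∃ s t, EqOf (x i) s t ∧ P x s t := by
  refine (exists_block (P := fun x u b => ∃ c, .eq :: c = b ∧ ∃ s t, s ++ t = c ∧ P x s t) atomMark i
    (cons (P := fun x c => ∃ s t, s ++ t = c ∧ P (Fin.init (Fin.init x)) s t) .eq _
      (split (P := fun x s t => P (Fin.init (Fin.init (Fin.init x))) s t) _
        (h.comp (Fin.snoc (Fin.snoc (fun j => j.castSucc.castSucc.castSucc.castSucc.castSucc)
          (Fin.last (k + 3)).castSucc : Fin (k + 1) → Fin (k + 5)) (Fin.last (k + 4)) :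
        Fin (k + 2) → Fin (k + 5)) |>.congr fun x => ?_)))).congr fun x => ?_
  · unfold Fin.init
    simp only [Fin.snoc_castSucc, Fin.snoc_last]
  · constructor
    · rintro ⟨u, _, hb, _, rfl, s, t, rfl, h⟩
      exact ⟨s, t, ⟨u, hb⟩, h⟩
    · rintro ⟨s, t, ⟨u, hb⟩, h⟩
      exact ⟨u, _, hb, _, rfl, s, t, rfl, h⟩

theorem isPrefix (i j : Fin k) : Dec k fun x => x i <+: x j := by
  refine (split (P := fun x u v => u = x i) j (eq _ i.castSucc.castSucc)).congr fun x => ?_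
  exact ⟨fun ⟨_, v, h, e⟩ => ⟨v, e ▸ h⟩, fun ⟨v, h⟩ => ⟨_, v, h, rfl⟩⟩

theorem univOf (i j : Fin k) : Dec k fun x => UnivOf (x i) (x j) := by
  refine (split (P := fun x u v => u = x j ∧ ∃ r, .all :: r = v ∧ True) i
    ((eq _ j.castSucc.castSucc).and (cons _ _ (const _)))).congr fun x => ?_
  constructor
  · rintro ⟨_, _, h, rfl, r, rfl, -⟩
    exact ⟨r, h⟩
  · rintro ⟨r, h⟩
    exact ⟨_, _, h, rfl, r, rfl, trivial⟩

theorem varStr (i j : Fin k) : Dec k fun x => VarStr (x i) (x j) :=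
  cons (P := fun x y => (∀ c ∈ y, c = .tick) ∧ y.length = (x j).length) _ _
    ((forall_mem (· = .tick) _).and (length_eq _ j.castSucc))

theorem countP_bool (p : Ab → Bool) (i j : Fin k) :
    Dec k fun x => (x i).countP p = (x j).length := by
  classical
  exact (countP_eq (p · = true) i j).congr fun x => by simp

theorem entryAt (i j : Fin k) (a : Fin 3) : Dec k fun x => EntryAt (x i) (x j) a := by
  refine (split (P := fun x t₁ t₂ => (x j).countP termMark = t₁.length ∧
    ∃ v, .elem a :: v = t₂ ∧ True) i ((countP_bool _ j.castSucc.castSucc _).and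
      (cons _ _ (const _)))).congr fun x => ?_
  simp only [and_true]
  rfl

theorem simStr (Q body i j : Fin k) : Dec k fun x => SimStr (x Q) (x body) (x i) (x j) := by
  refine reach (R := fun x u v => EdgeStr (x body) u v) Q i j ?_
  refine exists_eq (P := fun x s t => VarStr s (x (Fin.last k).castSucc) ∧
    VarStr t (x (Fin.last (k + 1))) ∨ VarStr s (x (Fin.last (k + 1))) ∧
      VarStr t (x (Fin.last k).castSucc)) body.castSucc.castSucc ?_
  exact ((varStr _ _).and (varStr _ _)).or ((varStr _ _).and (varStr _ _))

theorem constOfStr (Q body i : Fin k) (a : Fin 3) :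
    Dec k fun x => ConstOfStr (x Q) (x body) (x i) a :=
  exists_var Q <| (simStr _ _ _ _).and <| exists_eq _ <|
    ((varStr _ _).and (eq_singleton _ _)).or ((eq_singleton _ _).and (varStr _ _))

end Dec

namespace Dec

variable {k : ℕ}

theorem isConstStr (Q body i : Fin k) (a : Fin 3) :
    Dec k fun x => IsConstStr (x Q) (x body) (x i) a :=
  (eq_singleton _ _).or <| exists_var _ <| (varStr _ _).and (constOfStr _ _ _ _)

theorem isUnivStr (Q body i j : Fin k) :
    Dec k fun x => IsUnivStr (x Q) (x body) (x i) (x j) :=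
  (univOf _ _).and <| exists_var _ <| (varStr _ _).and (simStr _ _ _ _)

theorem isFreeStr (Q body i : Fin k) : Dec k fun x => IsFreeStr (x Q) (x body) (x i) :=
  (forall_fintype fun a => (isConstStr _ _ _ a).not).and <| forall_var _ (isUnivStr _ _ _ _).not

theorem coherentStr (Q body : Fin k) : Dec k fun x => CoherentStr (x Q) (x body) :=
  (forall_fintype fun _ => forall_fintype fun _ =>
    (exists_eq _ ((eq_singleton _ _).and (eq_singleton _ _))).imp (const _)).and <|
  (forall_var _ <| forall_fintype fun _ => forall_fintype fun _ =>
    (constOfStr _ _ _ _).imp ((constOfStr _ _ _ _).imp (const _))).and <|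
  (forall_var _ <| forall_fintype fun _ => (univOf _ _).imp (constOfStr _ _ _ _).not).and <|
  forall_var _ <| forall_var _ <| (simStr _ _ _ _).imp <| (univOf _ _).imp <|
    (eq _ _).or ((univOf _ _).not.and (isPrefix _ _))

theorem consistentStr (Q body X i : Fin k) :
    Dec k fun x => ConsistentStr (x Q) (x body) (x X) (x i) :=
  (forall_block _ _ <| forall_fintype fun _ => (isConstStr _ _ _ _).imp (entryAt _ _ _)).and <|
  (forall_block _ _ <| (isFreeStr _ _ _).imp (entryAt _ _ _)).and <|
  forall_block _ _ <| forall_block _ _ <| forall_var _ <| (isUnivStr _ _ _ _).imp <|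
    (isUnivStr _ _ _ _).imp <| forall_fintype fun _ => (entryAt _ _ _).imp (entryAt _ _ _)

/-- Divisibility by three means that the string can be cut into three parts of equal length. -/
theorem three_dvd_length (i : Fin k) : Dec k fun x => 3 ∣ (x i).length := by
  refine (split₃ (P := fun _ u m v => u.length = m.length ∧ m.length = v.length) i
    ((length_eq _ _).and (length_eq _ _))).congr fun x => ?_
  constructor
  · rintro ⟨u, m, v, h, h1, h2⟩
    rw [← h, List.length_append, List.length_append]
    omega
  · rintro ⟨l, hl⟩
    obtain ⟨u, y, h, hu, hy⟩ := exists_split (a := l) (b := l + l) (x := x i) (by omega)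
    obtain ⟨m, v, rfl, hm, hv⟩ := exists_split hy
    exact ⟨u, m, v, h.symm, by omega, by omega⟩

theorem eq_triple (i : Fin k) (a b c : Ab) : Dec k fun x => x i = [a, b, c] := by
  refine (cons (P := fun _ t => ∃ t', b :: t' = t ∧ t' = [c]) a i
    (cons (P := fun _ t' => t' = [c]) b _ (eq_singleton _ _))).congr fun x => ?_
  constructor
  · rintro ⟨_, h, _, rfl, rfl⟩
    exact h.symm
  · intro h
    exact ⟨_, h.symm, _, rfl, rfl⟩

theorem isTriple (i : Fin k) : Dec k fun x => IsTriple (x i) :=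
  exists_fintype fun _ => exists_fintype fun _ => exists_fintype fun _ => eq_triple _ _ _ _

theorem isRho (i : Fin k) : Dec k fun x => IsRho (x i) :=
  exists_fintype fun _ => exists_fintype fun _ => exists_fintype fun _ =>
    (eq_triple _ _ _ _).and (const _)

theorem inTau (i : Fin k) : Dec k fun x => InTau (x i) :=
  split₃ _ ((three_dvd_length _).and (isRho _))

theorem tripleClosed (i : Fin k) : Dec k fun x => TripleClosed (TupleOf (x i)) := by
  -- The modified string `u ++ (m' ++ v)` is not a factor of the input, so predicates in `Dec`
  -- cannot mention it. Instead, a listed tuple is sought that splits into `u`, `m'` and `v`; the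
  -- triple `m'` ranges over a finite type.
  refine (forall_tuple (P := fun x t => ¬ ∃ u m v, u ++ (m ++ v) = t ∧ 3 ∣ u.length ∧ IsTriple m ∧
    ∃ a b c : Fin 3, ((IsRho m ∧ IsRho [.elem a, .elem b, .elem c]) ∨ InTau u ∨ InTau v) ∧
      ¬ ∃ t', TupleOf (x i) t' ∧ ∃ u' m' v', u' ++ (m' ++ v') = t' ∧ u' = u ∧
        m' = [.elem a, .elem b, .elem c] ∧ v' = v) i ?_).congr fun x => ?_
  · refine (split₃ (P := fun x u m v => 3 ∣ u.length ∧ IsTriple m ∧ ∃ a b c : Fin 3,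
      ((IsRho m ∧ IsRho [.elem a, .elem b, .elem c]) ∨ InTau u ∨ InTau v) ∧
      ¬ ∃ t', TupleOf (x i.castSucc) t' ∧ ∃ u' m' v', u' ++ (m' ++ v') = t' ∧ u' = u ∧
        m' = [.elem a, .elem b, .elem c] ∧ v' = v) (Fin.last k) ?_).not
    refine (three_dvd_length _).and <| (isTriple _).and <| exists_fintype fun a =>
      exists_fintype fun b => exists_fintype fun c =>
      (((isRho _).and (const _)).or ((inTau _).or (inTau _))).and ?_
    refine (exists_tuple (P := fun x t' => ∃ u' m' v', u' ++ (m' ++ v') = t' ∧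
      u' = x (Fin.last (k + 1)).castSucc.castSucc ∧
        m' = [.elem a, .elem b, .elem c] ∧ v' = x (Fin.last (k + 3)))
      i.castSucc.castSucc.castSucc.castSucc ?_).not
    exact split₃ _ ((eq _ (Fin.last (k + 1)).castSucc.castSucc.castSucc.castSucc.castSucc.castSucc).and
      ((eq_triple _ _ _ _).and (eq _ (Fin.last (k + 3)).castSucc.castSucc.castSucc.castSucc)))
  · constructor
    · rintro h t ht u m v he hu hm m' ⟨a, b, c, rfl⟩ hr
      by_contra hT
      refine h t ht ⟨u, m, v, he, hu, hm, a, b, c, hr, ?_⟩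
      rintro ⟨_, ht', _, _, _, rfl, rfl, rfl, rfl⟩
      exact hT ht'
    · rintro h t ht ⟨u, m, v, he, hu, hm, a, b, c, hr, hT⟩
      exact hT ⟨_, h t ht u m v he hu hm _ ⟨a, b, c, rfl⟩ hr, _, _, _, rfl, rfl, rfl, rfl⟩

theorem relCond (Q body X Y : Fin k) :
    Dec k fun x => RelCond (x Q) (x body) (x X) (x Y) :=
  ((forall_tuple _ <| (three_dvd_length _).and (inTau _)).and (tripleClosed _)).and <|
  (exists_tuple _ (consistentStr _ _ _ _)).and <|
  forall_tuple _ <| (consistentStr _ _ _ _).imp <| forall_var _ <| (univOf _ _).imp <|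
    forall_fintype fun _ => exists_tuple _ <| forall_block _ _ <|
    ((isUnivStr _ _ _ _).imp (entryAt _ _ _)).and <| (isUnivStr _ _ _ _).not.imp <|
    forall_fintype fun _ => (entryAt _ _ _).imp (entryAt _ _ _)

theorem isTermStr (Q i : Fin k) : Dec k fun x => IsTermStr (x Q) (x i) :=
  (exists_fintype fun _ => eq_singleton _ _).or <| exists_var _ (varStr _ _)

theorem isScope (Q X : Fin k) : Dec k fun x => IsScope (x Q) (x X) :=
  (bound _ _).and <| forall_block _ _ (isTermStr _ _)

theorem isTuples (X Y : Fin k) : Dec k fun x => IsTuples (x X) (x Y) :=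
  (bound _ _).and <| forall_block _ _ <| cons _ _ <|
    (forall_mem _ _).and (countP_bool _ _ _)

theorem accepts (Q body : Fin k) : Dec k fun x => Accepts (x Q) (x body) :=
  (forall_mem _ _).and <| (bound _ _).and <| (forall_block _ _ <|
    (cons _ _ <| split _ <| (isTermStr _ _).and (isTermStr _ _)).or <|
    cons _ _ <| split _ <| ((isScope _ _).and (isTuples _ _)).and (relCond _ _ _ _)).and
    (coherentStr _ _)

end Dec

theorem inP_accepts : InP {w | ∃ Q body, Q ++ body = w ∧ Accepts Q body} :=
  Dec.inP (P := fun w => ∃ Q body, Q ++ body = w ∧ Accepts Q body) <|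
    Dec.split (P := fun _ Q body => Accepts Q body) _ (Dec.accepts _ _)

/-! ### Encodings of terms, tuples and atoms -/

section

variable {n : ℕ}

theorem varStr_encode_iff {t : Term (Fin 3) n} {q : List Ab} :
    VarStr t.encode q ↔ ∃ i, t = .var i ∧ q.length = i := by
  constructor
  · rintro ⟨y, h, -, hq⟩
    cases t with
    | var i =>
      simp only [Term.encode, List.cons.injEq, true_and] at h
      exact ⟨i, rfl, by rw [← hq, h, List.length_replicate]⟩
    | const a => simp [Term.encode] at h
  · rintro ⟨i, rfl, hi⟩
    exact ⟨_, rfl, fun c hc => List.eq_of_mem_replicate hc, by simp [hi]⟩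

theorem encode_eq_elem_iff {t : Term (Fin 3) n} {a : Fin 3} :
    t.encode = [.elem a] ↔ t = .const a := by
  cases t <;> simp [Term.encode]

theorem isBlock_elem (a : Fin 3) : IsBlock termMark [.elem a] :=
  ⟨_, _, rfl, rfl, by simp⟩

theorem VarStr.isBlock {s q : List Ab} (h : VarStr s q) : IsBlock termMark s := by
  obtain ⟨y, rfl, hy, -⟩ := h
  exact ⟨_, _, rfl, rfl, fun c hc => by rw [hy c hc]; rfl⟩

theorem VarStr.eq {s s' q q' : List Ab} (h : VarStr s q) (h' : VarStr s' q')
    (hq : q.length = q'.length) : s = s' := by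
  obtain ⟨y, rfl, hy, hl⟩ := h
  obtain ⟨y', rfl, hy', hl'⟩ := h'
  rw [List.eq_replicate_of_mem hy, List.eq_replicate_of_mem hy', hl, hl', hq]

theorem isBlock_encode (t : Term (Fin 3) n) : IsBlock termMark t.encode := by
  cases t with
  | var i => exact (varStr_encode_iff (q := List.replicate i .tick)).2 ⟨i, rfl, by simp⟩ |>.isBlock
  | const a => exact isBlock_elem a

theorem IsBlock.bound {p : Ab → Bool} {b : List Ab} (h : IsBlock p b) : Bound p b := by
  have := h.bound_append []
  rwa [List.append_nil] at this

theorem isTermStr_iff {Q s : List Ab} (hQ : Q.length = n) :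
    IsTermStr Q s ↔ ∃ t : Term (Fin 3) n, t.encode = s := by
  constructor
  · rintro (⟨a, rfl⟩ | ⟨q, ⟨r, hr, hr0⟩, hs⟩)
    · exact ⟨.const a, rfl⟩
    · have : q.length < n := by
        rw [← hQ, ← hr, List.length_append]
        have := List.length_pos_iff.2 hr0
        omega
      exact ⟨.var ⟨_, this⟩, (varStr_encode_iff.2 ⟨_, rfl, rfl⟩).eq hs rfl⟩
  · rintro ⟨t, rfl⟩
    cases t with
    | var i =>
      refine .inr ⟨Q.take i, ⟨Q.drop i, List.take_append_drop _ _, ?_⟩, ?_⟩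
      · rw [Ne, List.drop_eq_nil_iff]
        have := i.2
        omega
      · refine varStr_encode_iff.2 ⟨i, rfl, ?_⟩
        have := i.2
        rw [List.length_take]
        omega
    | const a => exact .inl ⟨a, rfl⟩

def scopeString {r : ℕ} (scope : Fin r → Term (Fin 3) n) : List Ab :=
  (List.ofFn scope).flatMap Term.encode

def tuplesString {r : ℕ} (tuples : List (Fin r → Fin 3)) : List Ab :=
  tuples.flatMap fun t => .tup :: tupleString t

variable {r : ℕ} {scope : Fin r → Term (Fin 3) n} {tuples : List (Fin r → Fin 3)}

theorem isBlock_of_mem_map_encode {l : List (Term (Fin 3) n)} :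
    ∀ b ∈ l.map Term.encode, IsBlock termMark b := by
  intro b hb
  obtain ⟨t, -, rfl⟩ := List.mem_map.1 hb
  exact isBlock_encode t

theorem isBlock_tup (t : Fin r → Fin 3) : IsBlock tupMark (.tup :: tupleString t) :=
  ⟨_, _, rfl, rfl, fun c hc => by obtain ⟨a, rfl⟩ := isElems_tupleString t c hc; rfl⟩

theorem isBlock_of_mem_map_tup :
    ∀ b ∈ tuples.map fun t => .tup :: tupleString t, IsBlock tupMark b := by
  intro b hb
  obtain ⟨t, -, rfl⟩ := List.mem_map.1 hb
  exact isBlock_tup t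

theorem tupleOf_tuplesString {s : List Ab} :
    TupleOf (tuplesString tuples) s ↔ ∃ t ∈ tuples, tupleString t = s := by
  unfold TupleOf tuplesString
  rw [List.flatMap_def, exists_blockAt_flatten isBlock_of_mem_map_tup]
  simp

theorem countP_scopeString : (scopeString scope).countP termMark = r := by
  rw [scopeString, List.flatMap_def, countP_flatten_blocks isBlock_of_mem_map_encode]
  simp

theorem exists_blockAt_scopeString (p : Fin r) :
    ∃ u, BlockAt termMark (scopeString scope) u (scope p).encode ∧ u.countP termMark = p := by
  rw [scopeString, List.flatMap_def, exists_blockAt_flatten_countP isBlock_of_mem_map_encode]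
  simp

theorem blockAt_scopeString {u s : List Ab} (h : BlockAt termMark (scopeString scope) u s) :
    ∃ p : Fin r, s = (scope p).encode ∧ u.countP termMark = p := by
  have h' := (exists_blockAt_flatten_countP (l := (List.ofFn scope).map Term.encode)
    isBlock_of_mem_map_encode).1 ⟨u, (by rwa [scopeString, List.flatMap_def] at h), rfl⟩
  rw [List.getElem?_map, List.getElem?_ofFn] at h'
  split_ifs at h' with hu
  · simp only [Option.map_some, Option.some.injEq] at h'
    exact ⟨⟨_, hu⟩, h'.symm, rfl⟩
  · cases h'

/-- Transfer principle between blocks of the scope and argument positions: the position is the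
number of term markers before the block. -/
theorem forall_blockAt_scopeString {P : List Ab → List Ab → Prop} {P' : Fin r → Prop}
    (h : ∀ (p : Fin r) (u : List Ab), u.countP termMark = (p : ℕ) → (P u (scope p).encode ↔ P' p)) :
    (∀ u s, BlockAt termMark (scopeString scope) u s → P u s) ↔ ∀ p, P' p := by
  constructor
  · intro hP p
    obtain ⟨u, hu, hp⟩ := exists_blockAt_scopeString (scope := scope) p
    exact (h p u hp).1 (hP u _ hu)
  · intro hP u s hu
    obtain ⟨p, rfl, hp⟩ := blockAt_scopeString hu
    exact (h p u hp).2 (hP p)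

/-- Each entry of a tuple is a single symbol, so the number of terms before position `p` is also the
length of the part of the tuple before it. -/
theorem entryAt_tupleString {t : Fin r → Fin 3} {u : List Ab} {p : Fin r} {a : Fin 3}
    (hu : u.countP termMark = p) : EntryAt (tupleString t) u a ↔ t p = a := by
  have hp : (tupleString t)[(p : ℕ)]? = some (.elem (t p)) := by simp [tupleString]
  unfold EntryAt
  rw [hu]
  constructor
  · rintro ⟨t₁, _, h, h1, v, rfl⟩
    rw [← h, List.getElem?_append_right (by omega)] at hp
    simp only [h1, Nat.sub_self, List.getElem?_cons_zero, Option.some.injEq] at hp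
    injection hp with hp
    exact hp.symm
  · rintro rfl
    refine ⟨(tupleString t).take p, (tupleString t).drop p, List.take_append_drop _ _, ?_,
      (tupleString t).drop (p + 1), ?_⟩
    · have := p.2
      rw [List.length_take, length_tupleString]
      omega
    · rw [List.drop_eq_getElem_cons (i := p) (by rw [length_tupleString]; exact p.2)]
      congr 1
      simp [tupleString]

theorem isScope_iff {Q X : List Ab} (hQ : Q.length = n) :
    IsScope Q X ↔ ∃ (r : ℕ) (scope : Fin r → Term (Fin 3) n), scopeString scope = X := by
  constructor
  · rintro ⟨hb, h⟩
    obtain ⟨l, hl, rfl⟩ := hb.exists_flatten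
    have h' : l ∈ Set.range (List.map (Term.encode (D := Fin 3) (n := n))) := by
      rw [Set.range_list_map]
      intro b hb
      obtain ⟨u, hu⟩ := (exists_blockAt_flatten hl).2 hb
      exact (isTermStr_iff hQ).1 (h u b hu)
    obtain ⟨ts, rfl⟩ := h'
    exact ⟨ts.length, ts.get, by rw [scopeString, List.ofFn_get, List.flatMap_def]⟩
  · rintro ⟨r, scope, rfl⟩
    refine ⟨?_, fun u s hs => ?_⟩
    · rw [scopeString, List.flatMap_def]
      exact bound_flatten isBlock_of_mem_map_encode
    · obtain ⟨p, rfl, -⟩ := blockAt_scopeString hs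
      exact (isTermStr_iff hQ).2 ⟨_, rfl⟩

theorem bound_tuplesString : Bound tupMark (tuplesString tuples) := by
  rw [tuplesString, List.flatMap_def]
  exact bound_flatten isBlock_of_mem_map_tup

theorem isTuples_iff {Y : List Ab} :
    IsTuples (scopeString scope) Y ↔ ∃ tuples : List (Fin r → Fin 3), tuplesString tuples = Y := by
  unfold IsTuples
  rw [countP_scopeString]
  constructor
  · rintro ⟨hb, h⟩
    obtain ⟨l, hl, rfl⟩ := hb.exists_flatten
    have h' : l ∈ Set.range (List.map fun t : Fin r → Fin 3 => .tup :: tupleString t) := by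
      rw [Set.range_list_map]
      intro b hb
      obtain ⟨u, hu⟩ := (exists_blockAt_flatten hl).2 hb
      obtain ⟨s, rfl, hs, hr⟩ := h u b hu
      obtain ⟨t, rfl⟩ := exists_tupleString hs hr.symm
      exact ⟨t, rfl⟩
    obtain ⟨ts, rfl⟩ := h'
    exact ⟨ts, by rw [tuplesString, List.flatMap_def]⟩
  · rintro ⟨tuples, rfl⟩
    refine ⟨bound_tuplesString, fun u b hb => ?_⟩
    have := (exists_blockAt_flatten (isBlock_of_mem_map_tup (tuples := tuples)) (b := b)).1
      ⟨u, by rwa [tuplesString, List.flatMap_def] at hb⟩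
    obtain ⟨t, -, rfl⟩ := List.mem_map.1 this
    exact ⟨_, rfl, isElems_tupleString t, (length_tupleString t).symm⟩

theorem tupMark_of_mem_scopeString : ∀ c ∈ scopeString scope, tupMark c = false := by
  intro c hc
  obtain ⟨t, -, hc⟩ := List.mem_flatMap.1 hc
  cases t with
  | var i =>
    rcases List.mem_cons.1 hc with rfl | hc
    · rfl
    · rw [List.eq_of_mem_replicate hc]; rfl
  | const a =>
    rw [List.mem_singleton.1 hc]; rfl

theorem encode_rel :
    (Atom.rel scope tuples).encode = .rel :: (scopeString scope ++ tuplesString tuples) := rfl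

/-- Terms contain no tuple marker and the list of tuples is empty or starts with one, so the
boundary between them is determined. -/
theorem scopeString_append_inj {X Y : List Ab} {Q : List Ab} (hQ : Q.length = n)
    (hX : IsScope Q X) (hY : IsTuples X Y) (h : X ++ Y = scopeString scope ++ tuplesString tuples) :
    X = scopeString scope ∧ Y = tuplesString tuples := by
  obtain ⟨r', scope', rfl⟩ := (isScope_iff hQ).1 hX
  exact unmarked_append_inj tupMark_of_mem_scopeString tupMark_of_mem_scopeString hY.1
    bound_tuplesString h

theorem isRelStr_encode_iff {Q : List Ab} (hQ : Q.length = n) {P : List Ab → List Ab → Prop} :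
    IsRelStr Q (Atom.rel scope tuples).encode P ↔ P (scopeString scope) (tuplesString tuples) := by
  constructor
  · rintro ⟨c, hc, X, Y, rfl, ⟨hX, hY⟩, hP⟩
    rw [encode_rel, List.cons.injEq] at hc
    obtain ⟨rfl, rfl⟩ := scopeString_append_inj hQ hX hY hc.2
    exact hP
  · intro hP
    exact ⟨_, rfl, _, _, rfl, ⟨(isScope_iff hQ).2 ⟨_, _, rfl⟩, isTuples_iff.2 ⟨_, rfl⟩⟩, hP⟩

theorem isEqStr_encode {Q : List Ab} (hQ : Q.length = n) (s t : Term (Fin 3) n) :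
    IsEqStr Q (Atom.eq s t).encode :=
  ⟨_, rfl, _, _, rfl, (isTermStr_iff hQ).2 ⟨s, rfl⟩, (isTermStr_iff hQ).2 ⟨t, rfl⟩⟩

theorem exists_atom {Q b : List Ab} (hQ : Q.length = n) {P : List Ab → List Ab → Prop}
    (h : IsEqStr Q b ∨ IsRelStr Q b P) : ∃ A : Atom (Fin 3) n, A.encode = b := by
  rcases h with ⟨_, rfl, _, _, rfl, hs, ht⟩ | ⟨_, rfl, X, Y, rfl, ⟨hX, hY⟩, -⟩
  · obtain ⟨s, rfl⟩ := (isTermStr_iff hQ).1 hs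
    obtain ⟨t, rfl⟩ := (isTermStr_iff hQ).1 ht
    exact ⟨.eq s t, rfl⟩
  · obtain ⟨r, scope, rfl⟩ := (isScope_iff hQ).1 hX
    obtain ⟨tuples, rfl⟩ := isTuples_iff.1 hY
    exact ⟨.rel scope tuples, rfl⟩

theorem atomMark_of_mem_encode {t : Term (Fin 3) n} : ∀ c ∈ t.encode, atomMark c = false := by
  intro c hc
  cases t with
  | var i =>
    rcases List.mem_cons.1 hc with rfl | hc
    · rfl
    · rw [List.eq_of_mem_replicate hc]; rfl
  | const a => rw [List.mem_singleton.1 hc]; rfl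

theorem isBlock_encode_atom (A : Atom (Fin 3) n) : IsBlock atomMark A.encode := by
  cases A with
  | eq s t =>
    refine ⟨_, _, rfl, rfl, fun c hc => ?_⟩
    rcases List.mem_append.1 hc with hc | hc <;> exact atomMark_of_mem_encode c hc
  | rel scope tuples =>
    refine ⟨_, _, rfl, rfl, fun c hc => ?_⟩
    rcases List.mem_append.1 hc with hc | hc
    · obtain ⟨t, -, hc⟩ := List.mem_flatMap.1 hc
      exact atomMark_of_mem_encode c hc
    · obtain ⟨t, -, hc⟩ := List.mem_flatMap.1 hc
      rcases List.mem_cons.1 hc with rfl | hc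
      · rfl
      · obtain ⟨a, rfl⟩ := isElems_tupleString t c hc
        rfl

theorem isBlock_of_mem_map_encode_atom {l : List (Atom (Fin 3) n)} :
    ∀ b ∈ l.map Atom.encode, IsBlock atomMark b := by
  intro b hb
  obtain ⟨A, -, rfl⟩ := List.mem_map.1 hb
  exact isBlock_encode_atom A

end

/-! ### Sentences and their encodings -/

namespace Sentence

variable (φ : Sentence (Fin 3))

def quantString : List Ab := (List.ofFn φ.quant).map Quantifier.encode

def atomsString : List Ab := φ.atoms.flatMap Atom.encode

/-- The string that represents a variable. -/
def before (i : Fin φ.numVars) : List Ab := φ.quantString.take i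

theorem length_quantString : φ.quantString.length = φ.numVars := by simp [quantString]

variable {φ}

theorem length_before (i : Fin φ.numVars) : (φ.before i).length = i := by
  have := i.2
  rw [before, List.length_take, length_quantString]
  omega

theorem before_injective : Function.Injective φ.before := fun i j h => by
  have := congrArg List.length h
  rw [length_before, length_before] at this
  exact Fin.ext this

theorem before_prefix (i : Fin φ.numVars) : φ.before i <+: φ.quantString := List.take_prefix _ _

theorem eq_before {q : List Ab} (hq : q <+: φ.quantString) {i : Fin φ.numVars}
    (h : q.length = i) : q = φ.before i := by
  rw [List.prefix_iff_eq_take.1 hq, h, before]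

theorem varOf_iff {q : List Ab} : VarOf φ.quantString q ↔ ∃ i, φ.before i = q := by
  constructor
  · rintro ⟨r, h, hr⟩
    have hlt : q.length < φ.numVars := by
      have := List.length_pos_iff.2 hr
      rw [← length_quantString, ← h, List.length_append]
      omega
    exact ⟨⟨_, hlt⟩, (eq_before ⟨r, h⟩ rfl).symm⟩
  · rintro ⟨i, rfl⟩
    refine ⟨_, List.take_append_drop _ _, ?_⟩
    rw [Ne, List.drop_eq_nil_iff, length_quantString]
    exact not_le.2 i.2

theorem forall_varOf_iff {P : List Ab → Prop} :
    (∀ q, VarOf φ.quantString q → P q) ↔ ∀ i, P (φ.before i) := by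
  simp only [varOf_iff, forall_exists_index, forall_apply_eq_imp_iff]

theorem exists_varOf_iff {P : List Ab → Prop} :
    (∃ q, VarOf φ.quantString q ∧ P q) ↔ ∃ i, P (φ.before i) := by
  simp only [varOf_iff, exists_exists_eq_and]

theorem univOf_iff {i : Fin φ.numVars} : UnivOf φ.quantString (φ.before i) ↔ φ.quant i = .all := by
  have hg : φ.quantString[(i : ℕ)]? = some (φ.quant i).encode := by simp [quantString]
  constructor
  · rintro ⟨r, h⟩
    rw [← h, List.getElem?_append_right (length_before i).le, length_before] at hg
    simp only [Nat.sub_self, List.getElem?_cons_zero, Option.some.injEq] at hg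
    cases hq : φ.quant i with
    | all => rfl
    | ex => rw [hq] at hg; cases hg
  · intro hq
    rw [hq] at hg
    obtain ⟨hi, hg⟩ := List.getElem?_eq_some_iff.1 hg
    refine ⟨φ.quantString.drop (i + 1), ?_⟩
    rw [← Quantifier.encode, ← hg, ← List.drop_eq_getElem_cons, before, List.take_append_drop]

theorem eqOf_iff {s t : List Ab} (hs : IsBlock termMark s) (ht : IsBlock termMark t) :
    EqOf φ.atomsString s t ↔
      ∃ s' t' : Term (Fin 3) φ.numVars, .eq s' t' ∈ φ.atoms ∧ s'.encode = s ∧ t'.encode = t := by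
  unfold EqOf atomsString
  rw [List.flatMap_def, exists_blockAt_flatten isBlock_of_mem_map_encode_atom]
  constructor
  · intro h
    obtain ⟨A, hA, h⟩ := List.mem_map.1 h
    cases A with
    | eq s' t' =>
      simp only [Atom.encode, List.cons.injEq, true_and] at h
      exact ⟨s', t', hA, (isBlock_encode s').append_inj hs (isBlock_encode t').bound ht.bound h⟩
    | rel scope tuples => simp [Atom.encode] at h
  · rintro ⟨s', t', h, rfl, rfl⟩
    exact List.mem_map.2 ⟨_, h, rfl⟩

/-- `EqOf` permits any cut of the body of an equality. The hypothesis that `P` admits only term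
blocks singles out the cut between the two terms. -/
theorem exists_eqOf_iff {P : List Ab → List Ab → Prop}
    (hP : ∀ s t, P s t → IsBlock termMark s ∧ IsBlock termMark t) :
    (∃ s t, EqOf φ.atomsString s t ∧ P s t) ↔
      ∃ s t : Term (Fin 3) φ.numVars, .eq s t ∈ φ.atoms ∧ P s.encode t.encode := by
  constructor
  · rintro ⟨s, t, h, h'⟩
    obtain ⟨hs, ht⟩ := hP s t h'
    obtain ⟨s', t', hA, rfl, rfl⟩ := (eqOf_iff hs ht).1 h
    exact ⟨s', t', hA, h'⟩
  · rintro ⟨s, t, h, h'⟩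
    exact ⟨_, _, (eqOf_iff (isBlock_encode s) (isBlock_encode t)).2 ⟨s, t, h, rfl, rfl⟩, h'⟩

theorem edgeStr_iff {q q' : List Ab} :
    EdgeStr φ.atomsString q q' ↔
      ∃ i j : Fin φ.numVars, q.length = i ∧ q'.length = j ∧ φ.Edge i j := by
  unfold EdgeStr
  rw [exists_eqOf_iff]
  · simp only [varStr_encode_iff]
    constructor
    · rintro ⟨_, _, h, ⟨⟨i, rfl, hi⟩, j, rfl, hj⟩ | ⟨⟨i, rfl, hi⟩, j, rfl, hj⟩⟩
      · exact ⟨i, j, hi, hj, .inl h⟩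
      · exact ⟨j, i, hj, hi, .inr h⟩
    · rintro ⟨i, j, hi, hj, h | h⟩
      · exact ⟨_, _, h, .inl ⟨⟨i, rfl, hi⟩, j, rfl, hj⟩⟩
      · exact ⟨_, _, h, .inr ⟨⟨j, rfl, hj⟩, i, rfl, hi⟩⟩
  · rintro s t (h | h) <;> exact ⟨h.1.isBlock, h.2.isBlock⟩

/-- Paths of prefixes correspond to paths of variables. The full quantifier string is a prefix that
represents no variable, but no edge touches it, because `EdgeStr` forces both lengths to be indices
of variables. -/
theorem simStr_iff {i j : Fin φ.numVars} :
    SimStr φ.quantString φ.atomsString (φ.before i) (φ.before j) ↔ φ.Sim i j := by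
  constructor
  · rintro ⟨-, -, h⟩
    have key : ∀ q, Relation.ReflTransGen (fun u v => u <+: φ.quantString ∧ v <+: φ.quantString ∧
        EdgeStr φ.atomsString u v) (φ.before i) q → ∃ j, q = φ.before j ∧ φ.Sim i j := by
      intro q h
      induction h with
      | refl => exact ⟨i, rfl, .refl⟩
      | tail _ h ih =>
        obtain ⟨j, rfl, hj⟩ := ih
        obtain ⟨-, hq, h⟩ := h
        obtain ⟨j', k, hj', hk, h⟩ := edgeStr_iff.1 h
        rw [length_before] at hj'
        obtain rfl := Fin.ext hj'
        exact ⟨k, eq_before hq hk, hj.tail h⟩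
    obtain ⟨j', h1, h2⟩ := key _ h
    rwa [before_injective h1]
  · intro h
    refine ⟨before_prefix i, before_prefix j, h.lift φ.before fun i j h => ?_⟩
    exact ⟨before_prefix i, before_prefix j,
      edgeStr_iff.2 ⟨i, j, length_before i, length_before j, h⟩⟩

theorem constOfStr_iff {i : Fin φ.numVars} {a : Fin 3} :
    ConstOfStr φ.quantString φ.atomsString (φ.before i) a ↔ φ.ConstOf i a := by
  unfold ConstOfStr
  rw [exists_varOf_iff]
  simp only [simStr_iff]
  refine exists_congr fun j => and_congr_right fun _ => ?_
  rw [exists_eqOf_iff]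
  · simp only [varStr_encode_iff, encode_eq_elem_iff, length_before]
    constructor
    · rintro ⟨_, _, h, ⟨⟨i, rfl, hi⟩, rfl⟩ | ⟨rfl, i, rfl, hi⟩⟩
      · rw [Fin.ext hi]; exact .inl h
      · rw [Fin.ext hi]; exact .inr h
    · rintro (h | h)
      · exact ⟨_, _, h, .inl ⟨⟨j, rfl, rfl⟩, rfl⟩⟩
      · exact ⟨_, _, h, .inr ⟨rfl, j, rfl, rfl⟩⟩
  · rintro s t (⟨h, rfl⟩ | ⟨rfl, h⟩)
    · exact ⟨h.isBlock, isBlock_elem a⟩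
    · exact ⟨isBlock_elem a, h.isBlock⟩

theorem varStr_before_iff {t : Term (Fin 3) φ.numVars} {i : Fin φ.numVars} :
    VarStr t.encode (φ.before i) ↔ t = .var i := by
  rw [varStr_encode_iff, length_before]
  constructor
  · rintro ⟨j, rfl, h⟩
    rw [Fin.ext h]
  · rintro rfl
    exact ⟨i, rfl, rfl⟩

theorem isConstStr_iff {t : Term (Fin 3) φ.numVars} {a : Fin 3} :
    IsConstStr φ.quantString φ.atomsString t.encode a ↔ φ.IsConst t a := by
  unfold IsConstStr
  rw [exists_varOf_iff, encode_eq_elem_iff]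
  simp only [varStr_before_iff, constOfStr_iff]
  cases t <;> simp [IsConst]

theorem isUnivStr_iff {t : Term (Fin 3) φ.numVars} {u : Fin φ.numVars} :
    IsUnivStr φ.quantString φ.atomsString t.encode (φ.before u) ↔ φ.IsUniv t u := by
  unfold IsUnivStr
  rw [exists_varOf_iff, univOf_iff]
  simp only [varStr_before_iff, simStr_iff]
  cases t <;> simp [IsUniv, and_comm]

theorem isFreeStr_iff {t : Term (Fin 3) φ.numVars} :
    IsFreeStr φ.quantString φ.atomsString t.encode ↔ φ.IsFree t := by
  unfold IsFreeStr
  rw [forall_varOf_iff]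
  simp only [isConstStr_iff, isUnivStr_iff]
  rfl

theorem before_prefix_before {i j : Fin φ.numVars} : φ.before i <+: φ.before j ↔ i ≤ j := by
  constructor
  · intro h
    have := h.length_le
    rwa [length_before, length_before] at this
  · intro h
    exact List.prefix_of_prefix_length_le (before_prefix i) (before_prefix j)
      (by rwa [length_before, length_before])

theorem coherentStr_iff : CoherentStr φ.quantString φ.atomsString ↔ φ.Coherent := by
  have h1 : ∀ a b : Fin 3, (∃ s t, EqOf φ.atomsString s t ∧ s = [.elem a] ∧ t = [.elem b]) ↔
      .eq (.const a) (.const b) ∈ φ.atoms := by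
    intro a b
    rw [exists_eqOf_iff]
    · simp only [encode_eq_elem_iff]
      constructor
      · rintro ⟨_, _, h, rfl, rfl⟩
        exact h
      · exact fun h => ⟨_, _, h, rfl, rfl⟩
    · rintro _ _ ⟨rfl, rfl⟩
      exact ⟨isBlock_elem a, isBlock_elem b⟩
  have h2 : ∀ i u, (φ.before i = φ.before u ∨ φ.quant i ≠ .all ∧ φ.before u <+: φ.before i) ↔
      (i = u ∨ φ.quant i = .ex ∧ u < i) := by
    intro i u
    rw [before_injective.eq_iff, before_prefix_before]
    cases φ.quant i with
    | all => simp
    | ex =>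
      simp only [ne_eq, reduceCtorEq, not_false_eq_true, true_and, le_iff_lt_or_eq]
      tauto
  unfold CoherentStr
  simp only [forall_varOf_iff, constOfStr_iff, simStr_iff, univOf_iff, h1, ← ne_eq, h2]
  constructor
  · rintro ⟨h1, h2, h3, h4⟩
    exact ⟨h1, h2, h3, h4⟩
  · rintro ⟨h1, h2, h3, h4⟩
    exact ⟨h1, h2, h3, h4⟩

variable {r : ℕ} {scope : Fin r → Term (Fin 3) φ.numVars} {tuples : List (Fin r → Fin 3)}

theorem consistentStr_iff {t : Fin r → Fin 3} :
    ConsistentStr φ.quantString φ.atomsString (scopeString scope) (tupleString t) ↔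
      Consistent scope t := by
  have h1 : (∀ u s, BlockAt termMark (scopeString scope) u s → ∀ a,
      IsConstStr φ.quantString φ.atomsString s a → EntryAt (tupleString t) u a) ↔
      ∀ p a, φ.IsConst (scope p) a → t p = a :=
    forall_blockAt_scopeString fun p u hu => by simp only [isConstStr_iff, entryAt_tupleString hu]
  have h2 : (∀ u s, BlockAt termMark (scopeString scope) u s →
      IsFreeStr φ.quantString φ.atomsString s → EntryAt (tupleString t) u 0) ↔
      ∀ p, φ.IsFree (scope p) → t p = 0 :=
    forall_blockAt_scopeString fun p u hu => by rw [isFreeStr_iff, entryAt_tupleString hu]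
  have h3 : (∀ u s, BlockAt termMark (scopeString scope) u s → ∀ u' s',
      BlockAt termMark (scopeString scope) u' s' → ∀ q, VarOf φ.quantString q →
      IsUnivStr φ.quantString φ.atomsString s q → IsUnivStr φ.quantString φ.atomsString s' q →
      ∀ a, EntryAt (tupleString t) u a → EntryAt (tupleString t) u' a) ↔
      ∀ p p' u, φ.IsUniv (scope p) u → φ.IsUniv (scope p') u → t p = t p' := by
    refine forall_blockAt_scopeString fun p u hu => forall_blockAt_scopeString fun p' u' hu' => ?_
    simp only [forall_varOf_iff, isUnivStr_iff, entryAt_tupleString hu, entryAt_tupleString hu']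
    refine forall_congr' fun v => imp_congr_right fun _ => imp_congr_right fun _ => ?_
    exact ⟨fun h => (h _ rfl).symm, fun h a ha => h ▸ ha⟩
  unfold ConsistentStr
  rw [h1, h2, h3]
  exact ⟨fun ⟨h1, h2, h3⟩ => ⟨h1, h2, h3⟩, fun ⟨h1, h2, h3⟩ => ⟨h1, h2, h3⟩⟩

theorem exists_tupleOf_iff {P : List Ab → Prop} :
    (∃ s, TupleOf (tuplesString tuples) s ∧ P s) ↔ ∃ t ∈ tuples, P (tupleString t) := by
  simp only [tupleOf_tuplesString]
  constructor
  · rintro ⟨_, ⟨t, ht, rfl⟩, h⟩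
    exact ⟨t, ht, h⟩
  · rintro ⟨t, ht, h⟩
    exact ⟨_, ⟨t, ht, rfl⟩, h⟩

theorem forall_tupleOf_iff {P : List Ab → Prop} :
    (∀ s, TupleOf (tuplesString tuples) s → P s) ↔ ∀ t ∈ tuples, P (tupleString t) := by
  simp only [tupleOf_tuplesString]
  constructor
  · intro h t ht
    exact h _ ⟨t, ht, rfl⟩
  · rintro h _ ⟨t, ht, rfl⟩
    exact h t ht

theorem relCond_iff : RelCond φ.quantString φ.atomsString (scopeString scope)
      (tuplesString tuples) ↔
    (3 ∣ r ∧ (∀ t ∈ tuples, InTau (tupleString t)) ∧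
      TripleClosed fun s => ∃ t ∈ tuples, tupleString t = s) ∧
    (∃ t ∈ tuples, Consistent scope t) ∧
    ∀ t ∈ tuples, Consistent scope t → ∀ u, φ.quant u = .all → ∀ a, ∃ t' ∈ tuples,
      ∀ p, (φ.IsUniv (scope p) u → t' p = a) ∧ (¬ φ.IsUniv (scope p) u → t' p = t p) := by
  have h1 : ∀ (t t' : Fin r → Fin 3) v a,
      (∀ u s, BlockAt termMark (scopeString scope) u s →
      (IsUnivStr φ.quantString φ.atomsString s (φ.before v) → EntryAt (tupleString t') u a) ∧
      (¬ IsUnivStr φ.quantString φ.atomsString s (φ.before v) →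
        ∀ c, EntryAt (tupleString t) u c → EntryAt (tupleString t') u c)) ↔
      ∀ p, (φ.IsUniv (scope p) v → t' p = a) ∧ (¬ φ.IsUniv (scope p) v → t' p = t p) := by
    intro t t' v a
    refine forall_blockAt_scopeString fun p u hu => ?_
    simp only [isUnivStr_iff, entryAt_tupleString hu]
    refine and_congr_right fun _ => imp_congr_right fun _ => ?_
    exact ⟨fun h => h _ rfl, fun h c hc => h.trans hc⟩
  unfold RelCond
  rw [show TupleOf (tuplesString tuples) = fun s => ∃ t ∈ tuples, tupleString t = s from
    funext fun s => propext tupleOf_tuplesString]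
  simp only [← tupleOf_tuplesString, exists_tupleOf_iff, forall_tupleOf_iff, forall_varOf_iff,
    consistentStr_iff, univOf_iff, h1, length_tupleString]
  constructor
  · rintro ⟨⟨h1, h2⟩, ⟨t, ht, h3⟩, h4⟩
    -- `RelCond` states divisibility of the arity through the lengths of the listed tuples; the
    -- consistent tuple shows that there is one.
    exact ⟨⟨(h1 t ht).1, fun t ht => (h1 t ht).2, h2⟩, ⟨t, ht, h3⟩, h4⟩
  · rintro ⟨⟨h0, h1, h2⟩, h3, h4⟩
    exact ⟨⟨fun t ht => ⟨h0, h1 t ht⟩, h2⟩, h3, h4⟩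

theorem accepts_iff : Accepts φ.quantString φ.atomsString ↔
    φ.IsOver (tauLanguage {0, 1} {0, 2}) ∧ φ.IsTrue := by
  have hQ := φ.length_quantString
  have hb := fun b => exists_blockAt_flatten (l := φ.atoms.map Atom.encode)
    isBlock_of_mem_map_encode_atom (b := b)
  rw [isOver_and_isTrue_iff]
  unfold Accepts
  rw [coherentStr_iff]
  constructor
  · rintro ⟨-, -, h, hc⟩
    refine ⟨hc, fun r scope tuples hA => ?_⟩
    obtain ⟨u, hu⟩ := (hb _).2 (List.mem_map_of_mem hA)
    rcases h u _ (by rwa [atomsString, List.flatMap_def]) with ⟨_, h, -⟩ | h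
    · simp [Atom.encode] at h
    · exact relCond_iff.1 ((isRelStr_encode_iff hQ).1 h)
  · rintro ⟨hc, h⟩
    refine ⟨?_, ?_, fun u b hu => ?_, hc⟩
    · intro c hc
      obtain ⟨q, -, rfl⟩ := List.mem_map.1 hc
      cases q
      · exact .inl rfl
      · exact .inr rfl
    · rw [atomsString, List.flatMap_def]
      exact bound_flatten isBlock_of_mem_map_encode_atom
    · rw [atomsString, List.flatMap_def] at hu
      obtain ⟨A, hA, rfl⟩ := List.mem_map.1 ((hb b).1 ⟨u, hu⟩)
      cases A with
      | eq s t => exact .inl (isEqStr_encode hQ s t)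
      | rel scope tuples =>
        exact .inr ((isRelStr_encode_iff hQ).2 (relCond_iff.2 (h _ scope tuples hA)))

end Sentence

/-! ### Decoding accepted strings, and the main theorem. -/

theorem Accepts.exists_sentence {Q body : List Ab} (h : Accepts Q body) :
    ∃ φ : Sentence (Fin 3), φ.quantString = Q ∧ φ.atomsString = body := by
  obtain ⟨hQ, hb, h, -⟩ := h
  obtain ⟨l, hl, rfl⟩ := hb.exists_flatten
  have hl' : l ∈ Set.range (List.map (Atom.encode (D := Fin 3) (n := Q.length))) := by
    rw [Set.range_list_map]
    intro b hb
    obtain ⟨u, hu⟩ := (exists_blockAt_flatten hl).2 hb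
    exact exists_atom rfl (h u b hu)
  obtain ⟨atoms, rfl⟩ := hl'
  have hq : ∀ i : Fin Q.length, ∃ q : Quantifier, q.encode = Q[i] := fun i =>
    (hQ Q[i] (List.getElem_mem _)).elim (fun h => ⟨.all, h.symm⟩) fun h => ⟨.ex, h.symm⟩
  choose quant hquant using hq
  refine ⟨⟨Q.length, quant, atoms⟩, ?_, by rw [Sentence.atomsString, List.flatMap_def]⟩
  refine List.ext_getElem (Sentence.length_quantString _) fun i hi hi' => ?_
  simp [Sentence.quantString, hquant]

/-- Acceptance includes well-formedness, so any accepted splitting decodes to a sentence with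
exactly this encoding. Uniqueness of the splitting into quantifiers and atoms is not needed. -/
theorem qcspTupleListing_tauLanguage :
    qcspTupleListing (tauLanguage ({0, 1} : Set (Fin 3)) {0, 2}) =
      {w | ∃ Q body, Q ++ body = w ∧ Accepts Q body} := by
  ext w
  constructor
  · rintro ⟨φ, ho, ht, rfl⟩
    exact ⟨_, _, rfl, Sentence.accepts_iff.2 ⟨ho, ht⟩⟩
  · rintro ⟨Q, body, rfl, h⟩
    obtain ⟨φ, rfl, rfl⟩ := h.exists_sentence
    obtain ⟨ho, ht⟩ := Sentence.accepts_iff.1 h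
    exact ⟨φ, ho, ht, rfl⟩

theorem inP_qcspTupleListing_tauLanguage :
    InP (qcspTupleListing (tauLanguage ({0, 1} : Set (Fin 3)) {0, 2})) := by
  rw [qcspTupleListing_tauLanguage]
  exact inP_accepts

end QCSP

theorem mainTheorem12 :
    let B : QCSP.ConstraintLanguage (Fin 3) := QCSP.tauLanguage {0, 1} {0, 2}
    QCSP.InP (QCSP.qcspTupleListing B) ∧
      QCSP.HasEGP (QCSP.Pol B) ∧ ¬ QCSP.HasPGP (QCSP.Pol B) := by
  intro B
  exact ⟨QCSP.inP_qcspTupleListing_tauLanguage, QCSP.hasEGP_pol_tauLanguage,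
    QCSP.hasEGP_pol_tauLanguage.not_hasPGP⟩
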